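/- Setting. Let $n\ge 1$ and let $a_\mu,a_\mu^\dagger$ ($\mu=1,\dots,n$) be the annihilation and creation operators on the $2^n$-dimensional Fock space of $n$ fermionic modes, with Majorana operators $\gamma_{2\mu-1}=a_\mu+a_\mu^\dagger$, $\gamma_{2\mu}=i(a_\mu-a_\mu^\dagger)$. A Gaussian state is a density matrix $\rho$ which, written as a polynomial in the $\gamma_j$ with each $\gamma_j$ appearing with exponent $0$ or $1$ in each (ordered) term, becomes $2^{-n}\exp(\frac i2\theta^TM\theta)$ for some real antisymmetric $2n\times 2n$ matrix $M$ when the $\gamma_j$ are replaced by Grassmann variables $\theta_j$; then $M_{jk}=\frac i2\operatorname{Tr}\rho[\gamma_j,\gamma_k]$ is its correlation matrix. Put $S_{\rm proxy}(\rho)=(\log 2)\,(n+\frac12\operatorname{Tr}M^2)$. Measuring $i\gamma_1\gamma_2$ gives the outcome $\pm1$ with probability $p_\pm=\operatorname{Tr}(\Pi_\pm\rho)$ and post-measurement state $\Pi_\pm\rho\,\Pi_\pm/p_\pm$, where $\Pi_\pm=\frac12(1\pm i\gamma_1\gamma_2)$; let $\Delta S_{\rm proxy}(\rho)$ be the change of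 $S_{\rm proxy}$, averaged over the two outcomes with the weights $p_\pm$. For $O\in SO(2n)$ let $\rho^O$ be the image of $\rho$ under the automorphism of the operator algebra with $\gamma_j\mapsto\sum_kO_{kj}\gamma_k$, and let $\langle\Delta S_{\rm proxy}\rangle(\rho)=\int_{SO(2n)}\Delta S_{\rm proxy}(\rho^O)\,dO$ with respect to the Haar probability measure. Let $Q$ be the orthogonal projector of $\mathbb R^{2n}$ onto the first two basis vectors, and let $$L(\rho)=\frac{\log 2}{4n^2}\Big[\big(\operatorname{Tr}(1+M^2)\big)^2-\operatorname{Tr}\,(1+M^2)^2\Big].$$ (1) For every Gaussian state $\rho$ with correlation matrix $M$: $M$ is antisymmetric, $1+M^2$ is positive semidefinite, $M_{12}^2\le1$, and $$\Delta S_{\rm proxy}(\rho)=-\frac{\log 2}{1-M_{12}^2}\,\det\big[Q(1+M^2)Q\big]\quad\text{if }M_{12}^2\ne1,\qquad \Delta S_{\rm proxy}(\rho)=0\quad\text{if }M_{12}^2=1,$$ where $\det$ is the determinant of the upper left $2\times2$ block. In particular $\Delta S_{\rm proxy}(\rho)\le0$. (2) For every Gaussian state $\rho$ and $O\in SO(2n)$,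 $\rho^O$ is Gaussian with correlation matrix $OMO^T$. (3) To leading order in $1/n$, $|\langle\Delta S_{\rm proxy}\rangle(\rho)|$ equals $L(\rho)$: there are constants $C$ and $n_0$ such that for all $n\ge n_0$ and all Gaussian states $\rho$ on $n$ modes, $\Delta S_{\rm proxy}(\rho^O)$ is integrable in $O$ and $$\Big|\,\big|\langle\Delta S_{\rm proxy}\rangle(\rho)\big|-L(\rho)\Big|\le\frac Cn\,L(\rho).$$ (4) For every $n\ge1$ and every probability measure on Gaussian states (the average over which is denoted by a bar), with $\bar s=\overline{S_{\rm proxy}}/(n\log2)$, the averages below are those of integrable functions and $$\Big|\,\overline{\langle\Delta S_{\rm proxy}\rangle}\,\Big|\;\ge\;\overline{L}\;\ge\;(\log 2)\Big[\bar s^{\,2}-\frac{\bar s}{2n}\Big].$$ (5) The maximally mixed state $2^{-n}\cdot 1$ is Gaussian with $S_{\rm proxy}=n\log 2$. Start from it, or from any other Gaussian state, and at each step apply an independent Haar-random rotation in $SO(2n)$, $\rho\mapsto\rho^O$, and then measure $i\gamma_1\gamma_2$, the outcome being drawn with the probabilities $p_\pm$. The random state $\rho_t$ after $t$ steps is almost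 surely Gaussian, and there are constants $K,c>0$ and $B$, independent of $n$, $t$ and the initial state, such that $$\mathbb E\,S_{\rm proxy}(\rho_t)\le\tfrac12\,n\log2\quad\text{for all }t\ge Kn,$$ $$\mathbb E\,S_{\rm proxy}(\rho_t)\le B\quad\text{and}\quad \mathbb E\operatorname{Tr}\rho_t^2\ge c\quad\text{for all }t\ge Kn^2.$$ -/

import Mathlib

open MeasureTheory Matrix
open scoped ComplexOrder

noncomputable section

namespace FreeFermion

/-! ### Fock space and Majorana operators -/

/-- Operators on the `2 ^ n`-dimensional Fock space of `n` fermionic modes, as matrices in the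
occupation number basis (a basis vector says which of the modes are filled). -/
abbrev FockOp (n : ℕ) : Type := Matrix (Fin n → Bool) (Fin n → Bool) ℂ

/-- The annihilation operator of mode `μ` (in the Jordan-Wigner form): it empties the mode `μ`
with the sign `(-1) ^ (number of filled modes before μ)`, and kills states in which `μ` is empty. -/
def annihilation {n : ℕ} (μ : Fin n) : FockOp n := fun x y =>
  if y μ = true ∧ x = Function.update y μ false then
    (-1 : ℂ) ^ (Finset.univ.filter fun ν : Fin n => ν < μ ∧ y ν = true).card
  else 0

/-- The Majorana operators `γ_{2μ-1} = a_μ + a_μ†` and `γ_{2μ} = i (a_μ - a_μ†)`. Indices are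
counted from zero, so these are `majorana (2μ)` and `majorana (2μ+1)` for `μ = 0, …, n-1`. -/
def majorana {n : ℕ} (j : Fin (2 * n)) : FockOp n :=
  let a : FockOp n := annihilation (⟨j.1 / 2, by omega⟩ : Fin n)
  if j.1 % 2 = 0 then a + aᴴ else Complex.I • (a - aᴴ)

/-- The index of the first Majorana operator `γ₁`. -/
def fst (n : ℕ) [NeZero n] : Fin (2 * n) :=
  ⟨0, by have := Nat.pos_of_ne_zero (NeZero.ne n); omega⟩

/-- The index of the second Majorana operator `γ₂`. -/
def snd (n : ℕ) [NeZero n] : Fin (2 * n) :=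
  ⟨1, by have := Nat.pos_of_ne_zero (NeZero.ne n); omega⟩

/-- The product of the `f j` with `j ∈ S`, in increasing order of `j`. -/
def orderedProd {A : Type*} [Monoid A] {m : ℕ} (f : Fin m → A) (S : Finset (Fin m)) : A :=
  ((S.sort (· ≤ ·)).map f).prod

/-! ### Gaussian states -/

/-- The Grassmann algebra over `ℂ` on the `2n` generators `θ_1, …, θ_{2n}`. -/
abbrev Grassmann (n : ℕ) : Type := ExteriorAlgebra ℂ (Fin (2 * n) → ℂ)

/-- The Grassmann generator `θ_j`. -/
def theta {n : ℕ} (j : Fin (2 * n)) : Grassmann n := ExteriorAlgebra.ι ℂ (Pi.single j 1)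

/-- The Grassmann element `(i / 2) θᵀ M θ`. -/
def grassmannQuadratic {n : ℕ} (M : Matrix (Fin (2 * n)) (Fin (2 * n)) ℝ) : Grassmann n :=
  (Complex.I / 2) • ∑ j, ∑ k, (M j k : ℂ) • (theta j * theta k)

/-- The exponential `exp ((i / 2) θᵀ M θ)` in the Grassmann algebra. The series is finite: an
element of degree two in `2n` generators has vanishing `(n+1)`-st power. -/
def grassmannExp {n : ℕ} (M : Matrix (Fin (2 * n)) (Fin (2 * n)) ℝ) : Grassmann n :=
  ∑ k ∈ Finset.range (n + 1), ((k.factorial : ℂ)⁻¹) • grassmannQuadratic M ^ k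

/-- A Gaussian state: a density matrix `ρ` which, when written as a polynomial in the Majorana
operators with each `γ_j` appearing with exponent `0` or `1` in each term, becomes
`2 ^ (-n) exp ((i / 2) θᵀ M θ)` for a real antisymmetric `M` when the `γ_j` are replaced with
Grassmann variables `θ_j`. -/
def IsGaussian {n : ℕ} (ρ : FockOp n) : Prop :=
  ρ.PosSemidef ∧ ρ.trace = 1 ∧
    ∃ (M : Matrix (Fin (2 * n)) (Fin (2 * n)) ℝ) (c : Finset (Fin (2 * n)) → ℂ),
      Mᵀ = -M ∧
      ρ = ∑ S, c S • orderedProd majorana S ∧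
      ∑ S, c S • orderedProd theta S = ((2 : ℂ) ^ n)⁻¹ • grassmannExp M

/-- The correlation matrix `M_{jk} = (i / 2) Tr ρ [γ_j, γ_k]` (a real number for Hermitian `ρ`). -/
def corrMatrix {n : ℕ} (ρ : FockOp n) : Matrix (Fin (2 * n)) (Fin (2 * n)) ℝ := fun j k =>
  (Complex.I / 2 *
    (ρ * (majorana j * majorana k - majorana k * majorana j)).trace).re

/-- The maximally mixed state `2 ^ (-n) · 1`. -/
def maximallyMixed (n : ℕ) : FockOp n := ((2 : ℂ) ^ n)⁻¹ • 1

/-- The purity `Tr ρ²`. -/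
def purity {n : ℕ} (ρ : FockOp n) : ℝ := (ρ * ρ).trace.re

/-- The proxy entropy `S_proxy(ρ) = (log 2) (n + ½ Tr M²)`, `M` the correlation matrix of `ρ`. -/
def proxyEntropy {n : ℕ} (ρ : FockOp n) : ℝ :=
  Real.log 2 * (n + (corrMatrix ρ * corrMatrix ρ).trace / 2)

/-! ### The measurement of `i γ₁ γ₂` -/

section Measurement

variable {n : ℕ} [NeZero n]

/-- The spectral projector `(1 ± i γ₁ γ₂) / 2` of the observable `i γ₁ γ₂`; the outcome `+1` is
encoded as `true` (first mode empty), the outcome `-1` as `false` (first mode filled). -/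
def outcomeProj (b : Bool) : FockOp n :=
  (1 / 2 : ℂ) •
    (1 + (if b then (1 : ℂ) else -1) •
      (Complex.I • ((majorana (fst n) : FockOp n) * majorana (snd n))))

/-- Born rule: the probability `Tr (Π ρ)` of an outcome. -/
def outcomeProb (b : Bool) (ρ : FockOp n) : ℝ := (outcomeProj b * ρ).trace.re

/-- The normalized post-measurement state `Π ρ Π / Tr (Π ρ)`. (For outcomes of probability zero
this is the zero matrix; it is only ever used with the weight `outcomeProb b ρ`.) -/
def postState (b : Bool) (ρ : FockOp n) : FockOp n :=
  ((outcomeProb b ρ : ℂ)⁻¹) • (outcomeProj b * ρ * outcomeProj b)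

/-- The change of the proxy entropy in the measurement of `i γ₁ γ₂`, averaged over the outcomes. -/
def entropyChange (ρ : FockOp n) : ℝ :=
  (∑ b : Bool, outcomeProb b ρ * proxyEntropy (postState b ρ)) - proxyEntropy ρ

/-- The projector `Q` onto the first two basis vectors of `ℝ^{2n}`. -/
def firstTwoProj (n : ℕ) : Matrix (Fin (2 * n)) (Fin (2 * n)) ℝ :=
  Matrix.diagonal fun j => if j.1 < 2 then 1 else 0

/-- The upper left `2 × 2` block of a matrix. -/
def upperLeftBlock (A : Matrix (Fin (2 * n)) (Fin (2 * n)) ℝ) : Matrix (Fin 2) (Fin 2) ℝ :=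
  A.submatrix ![fst n, snd n] ![fst n, snd n]

end Measurement

/-! ### Haar-random rotations -/

/-- The rotation group `SO(2n)`. -/
abbrev SO (n : ℕ) : Type := Matrix.specialOrthogonalGroup (Fin (2 * n)) ℝ

instance instMeasurableSpaceMatrix {ι κ α : Type*} [MeasurableSpace α] :
    MeasurableSpace (Matrix ι κ α) :=
  inferInstanceAs (MeasurableSpace (ι → κ → α))

instance instBorelSpaceMatrix {ι κ α : Type*} [Countable ι] [Countable κ] [TopologicalSpace α]
    [SecondCountableTopology α] [MeasurableSpace α] [BorelSpace α] :
    BorelSpace (Matrix ι κ α) :=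
  inferInstanceAs (BorelSpace (ι → κ → α))

theorem mem_SO_iff {n : ℕ} (A : Matrix (Fin (2 * n)) (Fin (2 * n)) ℝ) :
    A ∈ Matrix.specialOrthogonalGroup (Fin (2 * n)) ℝ ↔ Aᵀ * A = 1 ∧ A.det = 1 := by
  rw [Matrix.mem_specialOrthogonalGroup_iff, Matrix.mem_orthogonalGroup_iff']

instance instIsTopologicalGroupSO (n : ℕ) : IsTopologicalGroup (SO n) where
  continuous_mul := by
    refine Continuous.subtype_mk ?_ _
    exact (continuous_subtype_val.comp continuous_fst).matrix_mul
      (continuous_subtype_val.comp continuous_snd)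
  continuous_inv := by
    refine Continuous.subtype_mk ?_ _
    exact (continuous_subtype_val (X := Matrix (Fin (2 * n)) (Fin (2 * n)) ℝ)).matrix_transpose

instance instCompactSpaceSO (n : ℕ) : CompactSpace (SO n) := by
  refine isCompact_iff_compactSpace.mp ?_
  have hclosed : IsClosed
      ((Matrix.specialOrthogonalGroup (Fin (2 * n)) ℝ : Submonoid _) :
        Set (Matrix (Fin (2 * n)) (Fin (2 * n)) ℝ)) := by
    have h : ((Matrix.specialOrthogonalGroup (Fin (2 * n)) ℝ : Submonoid _) :
        Set (Matrix (Fin (2 * n)) (Fin (2 * n)) ℝ)) =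
        {A | Aᵀ * A = 1} ∩ {A | A.det = 1} := by
      ext A
      exact mem_SO_iff A
    rw [h]
    have h1 : Continuous fun A : Matrix (Fin (2 * n)) (Fin (2 * n)) ℝ => Aᵀ * A :=
      Continuous.matrix_mul (Continuous.matrix_transpose continuous_id) continuous_id
    have h2 : Continuous fun A : Matrix (Fin (2 * n)) (Fin (2 * n)) ℝ => A.det :=
      Continuous.matrix_det continuous_id
    exact (isClosed_eq h1 continuous_const).inter (isClosed_eq h2 continuous_const)
  have hbox : IsCompact
      (Set.pi Set.univ fun _ : Fin (2 * n) => Set.pi Set.univ fun _ : Fin (2 * n) =>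
        Set.Icc (-1 : ℝ) 1) :=
    isCompact_univ_pi fun _ => isCompact_univ_pi fun _ => isCompact_Icc
  refine hbox.of_isClosed_subset hclosed ?_
  intro (A : Matrix (Fin (2 * n)) (Fin (2 * n)) ℝ) hA i _ j _
  have h1 : (Aᵀ * A) j j = 1 := by rw [((mem_SO_iff A).mp hA).1]; simp
  rw [Matrix.mul_apply] at h1
  have h2 : A i j * A i j ≤ 1 := by
    rw [← h1]
    exact Finset.single_le_sum (f := fun k => Aᵀ j k * A k j)
      (fun k _ => mul_self_nonneg (A k j)) (Finset.mem_univ i)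
  exact abs_le.mp (abs_le_one_iff_mul_self_le_one.mpr h2)

/-- The Haar probability measure on `SO(2n)`. -/
def haarSO (n : ℕ) : Measure (SO n) := Measure.haarMeasure ⊤

/-- The action of the free fermion unitary of the rotation `O` on operators, `X ↦ Û† X Û`: the
automorphism of the operator algebra with `γ_j ↦ ∑_k O_{kj} γ_k` (equivalently
`Û γ_j Û† = ∑_k O_{jk} γ_k`). The operator `X` is expanded in the ordered products of Majorana
operators, which are orthogonal for the trace inner product, and each factor is substituted. -/
def rotate {n : ℕ} (O : SO n) (X : FockOp n) : FockOp n :=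
  ∑ S : Finset (Fin (2 * n)),
    (((2 : ℂ) ^ n)⁻¹ * ((orderedProd majorana S)ᴴ * X).trace) •
      orderedProd (fun j => ∑ k, (O.1 k j : ℂ) • (majorana k : FockOp n)) S

/-- `(log 2) / (4 n²) · [(Tr (1 + M²))² - Tr (1 + M²)²]`, `M` the correlation matrix of `ρ`. -/
def leadingTerm {n : ℕ} (ρ : FockOp n) : ℝ :=
  let N : Matrix (Fin (2 * n)) (Fin (2 * n)) ℝ := 1 + corrMatrix ρ * corrMatrix ρ
  Real.log 2 / (4 * (n : ℝ) ^ 2) * (N.trace ^ 2 - (N * N).trace)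

section Dynamics

variable {n : ℕ} [NeZero n]

/-- The change of the proxy entropy in the measurement, averaged over the outcomes and over the
Haar-random rotation that precedes the measurement. -/
def haarEntropyChange (ρ : FockOp n) : ℝ := ∫ O, entropyChange (rotate O ρ) ∂(haarSO n)

/-- One step of the circuit on ensembles of states: apply an independent Haar-random rotation, then
measure `i γ₁ γ₂`, the outcome being drawn with the Born probabilities. -/
def circuitStep (μ : Measure (FockOp n)) : Measure (FockOp n) :=
  ∑ b : Bool,
    ((μ.prod (haarSO n)).withDensity fun x =>
      ENNReal.ofReal (outcomeProb b (rotate x.2 x.1))).map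
      fun x => postState b (rotate x.2 x.1)

/-- The law of the state after `t` steps of the circuit started in `ρ₀`. -/
def circuitLaw (ρ₀ : FockOp n) (t : ℕ) : Measure (FockOp n) :=
  circuitStep^[t] (Measure.dirac ρ₀)

end Dynamics

end FreeFermion

end

/-!
The Grassmann exponential `exp ((i / 2) θᵀ M θ)` is, up to a factor, the only solution of the
equations `∂_j c = i ∑_k M_{jk} θ_k c`. On operators these read `[γ_j, ρ] = i ∑_k M_{jk} {γ_k, ρ}`,
so the Gaussian states are the even states that satisfy such a linear equation, with `M` the
correlation matrix (`isGaussian_iff`, `GaussianEq.corrMatrix_eq`). The statements about single states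
follow from this equation by linear algebra. A rotation is a `*`-automorphism, and conjugates `M`
(`GaussianEq.rotate`). Compressing the equation by a projector of the measurement again gives such an
equation (`GaussianEq.measure`), and the new `M` yields the entropy change
(`IsGaussian.entropyChange_eq`). Positivity of `Tr ρ Γ†Γ` for `Γ` linear in the `γ_j` gives
`1 + M² ≥ 0` (`GaussianEq.posSemidef`).

For the Haar average put `X = O M Oᵀ`, `N = 1 + X²`, `α = X₁₂`, and let `D = N₁₁ N₂₂ - N₁₂²`, the
diagonal entry with index `2` of the positive semidefinite matrix `A = N₁₁ N - N e₁ e₁ᵀ N`. The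
entropy change is `-(log 2) D / (1 - α²)`. Invariance under rotations by a right angle computes the
average of `D` from traces (`integral_schur`, `integral_schurTrace`). Since
`D / (1 - α²) = D + α² D + α⁴ D / (1 - α²) ≥ D`, this already gives the lower bound without error
term. The two remaining terms are of relative order `1 / n`: the average of the derivative of a
function along the plane rotations vanishes (`integral_deriv_planeRot`), and applied to
`A₂₂ α_k α₂` and `(tr A) α_k α₂³ / (1 + δ - α₂²)`, with `α_k = X₁ₖ`, this bounds the averages of
`α² D` and of `(tr A) α⁴ / (1 + δ - α²)` (`integral_schur_mul_row_sq_le`,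
`integral_schurTrace_mul_le`). The regularization costs at most `δ`, because `D ≤ (1 - α²)²`.

A step of the circuit preserves the Gaussian ensembles, and by the lower bound and Jensen's
inequality the mean entropy density `s` obeys `s' ≤ s - 2 / (2n - 1) (s² - s / (2n))`
(`entropyDensity_succ`); solving this recursion gives the two time scales (`entropy_recursion`). The
purity is at least `exp (-S_proxy)`: along the states with correlation matrices `r² M` the
logarithmic derivative of the purity is bounded below through the Gram matrix of the derivatives
`∂_j c` (`sum_norm_sq_lower_ge`, `CoeffEq.log_sum_norm_sq_ge`).
-/

noncomputable section

namespace FreeFermion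

/-! ### Ordered products and their coefficient functions -/

section OrderedProducts

variable {m : ℕ}

/-- The sign `(-1) ^ #{i ∈ S | i < j}` picked up by the `j`-th generator when it is moved to its
place in the ordered product over `S`. -/
def sgn (j : Fin m) (S : Finset (Fin m)) : ℂ := ∏ i ∈ S, if i < j then -1 else 1

/-- `S` with the membership of `j` reversed. -/
def toggle (j : Fin m) (S : Finset (Fin m)) : Finset (Fin m) := symmDiff S {j}

theorem mem_toggle {i j : Fin m} {S : Finset (Fin m)} :
    i ∈ toggle j S ↔ (i ∈ S ∧ i ≠ j) ∨ (i = j ∧ j ∉ S) := by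
  simp only [toggle, Finset.mem_symmDiff, Finset.mem_singleton]
  constructor
  · rintro (h | ⟨rfl, h⟩)
    · exact Or.inl h
    · exact Or.inr ⟨rfl, h⟩
  · rintro (h | ⟨rfl, h⟩)
    · exact Or.inl h
    · exact Or.inr ⟨rfl, h⟩

theorem mem_toggle_self {j : Fin m} {S : Finset (Fin m)} : j ∈ toggle j S ↔ j ∉ S := by
  simp [mem_toggle]

theorem mem_toggle_of_ne {i j : Fin m} (h : i ≠ j) {S : Finset (Fin m)} :
    i ∈ toggle j S ↔ i ∈ S := by
  simp [mem_toggle, h]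

theorem toggle_toggle (j : Fin m) (S : Finset (Fin m)) : toggle j (toggle j S) = S := by
  simp [toggle]

theorem sum_toggle {A : Type*} [AddCommMonoid A] (j : Fin m) (f : Finset (Fin m) → A) :
    ∑ S, f (toggle j S) = ∑ S, f S :=
  Equiv.sum_comp (Function.Involutive.toPerm (toggle j) (toggle_toggle j : _)) f

theorem toggle_comm (j k : Fin m) (S : Finset (Fin m)) :
    toggle j (toggle k S) = toggle k (toggle j S) := by
  simp only [toggle, symmDiff_assoc, symmDiff_comm {k} {j}]

theorem toggle_of_notMem {j : Fin m} {S : Finset (Fin m)} (h : j ∉ S) :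
    toggle j S = insert j S := by
  ext i; by_cases hi : i = j
  · subst hi; simp [mem_toggle, h]
  · simp [mem_toggle, hi]

theorem toggle_of_mem {j : Fin m} {S : Finset (Fin m)} (h : j ∈ S) :
    toggle j S = S.erase j := by
  ext i; by_cases hi : i = j
  · subst hi; simp [mem_toggle, h]
  · simp [mem_toggle, hi]

theorem sgn_mul_self (j : Fin m) (S : Finset (Fin m)) : sgn j S * sgn j S = 1 := by
  rw [sgn, ← Finset.prod_mul_distrib]
  exact Finset.prod_eq_one fun i _ => by split_ifs <;> simp

theorem star_sgn (j : Fin m) (S : Finset (Fin m)) : star (sgn j S) = sgn j S := by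
  simp only [sgn, star_prod]
  exact Finset.prod_congr rfl fun i _ => by split_ifs <;> simp

theorem sgn_insert {a : Fin m} {S : Finset (Fin m)} (j : Fin m) (h : a ∉ S) :
    sgn j (insert a S) = (if a < j then -1 else 1) * sgn j S := by
  rw [sgn, Finset.prod_insert h, sgn]

theorem sgn_toggle (j k : Fin m) (S : Finset (Fin m)) :
    sgn j (toggle k S) = (if k < j then -1 else 1) * sgn j S := by
  by_cases h : k ∈ S
  · rw [toggle_of_mem h]
    conv_rhs => rw [← Finset.insert_erase h, sgn_insert j (Finset.notMem_erase k S), ← mul_assoc]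
    split_ifs <;> simp
  · rw [toggle_of_notMem h, sgn_insert j h]

theorem sgn_toggle_self (j : Fin m) (S : Finset (Fin m)) : sgn j (toggle j S) = sgn j S := by
  simp [sgn_toggle]

theorem sgn_eq_one_of_lt {j : Fin m} {S : Finset (Fin m)} (h : ∀ i ∈ S, j < i) : sgn j S = 1 :=
  Finset.prod_eq_one fun i hi => by simp [(h i hi).le]

theorem sgn_toggle_mul {j k : Fin m} (h : j ≠ k) (S : Finset (Fin m)) :
    sgn j (toggle k S) * sgn k S = -(sgn k (toggle j S) * sgn j S) := by
  rw [sgn_toggle, sgn_toggle]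
  rcases lt_or_gt_of_ne h with h | h
  · simp [h, h.le, mul_comm]
  · simp [h, h.le, mul_comm]

theorem sgn_mul_toggle {j k : Fin m} (h : j ≠ k) (S : Finset (Fin m)) :
    sgn j S * sgn k (toggle j S) = -(sgn k S * sgn j (toggle k S)) := by
  have := sgn_toggle_mul h S
  linear_combination this

/-- Multiplication by the `j`-th Grassmann generator, on coefficient functions. -/
def raise (j : Fin m) : (Finset (Fin m) → ℂ) →ₗ[ℂ] (Finset (Fin m) → ℂ) where
  toFun c S := if j ∈ S then sgn j S * c (toggle j S) else 0
  map_add' c d := by ext S; simp only [Pi.add_apply]; split_ifs <;> ring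
  map_smul' a c := by
    ext S
    simp only [Pi.smul_apply, smul_eq_mul, RingHom.id_apply]
    split_ifs <;> ring

/-- The derivative with respect to the `j`-th Grassmann generator, on coefficient functions. -/
def lower (j : Fin m) : (Finset (Fin m) → ℂ) →ₗ[ℂ] (Finset (Fin m) → ℂ) where
  toFun c S := if j ∈ S then 0 else sgn j S * c (toggle j S)
  map_add' c d := by ext S; simp only [Pi.add_apply]; split_ifs <;> ring
  map_smul' a c := by
    ext S
    simp only [Pi.smul_apply, smul_eq_mul, RingHom.id_apply]
    split_ifs <;> ring

theorem raise_apply (j : Fin m) (c : Finset (Fin m) → ℂ) (S : Finset (Fin m)) :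
    raise j c S = if j ∈ S then sgn j S * c (toggle j S) else 0 := rfl

theorem lower_apply (j : Fin m) (c : Finset (Fin m) → ℂ) (S : Finset (Fin m)) :
    lower j c S = if j ∈ S then 0 else sgn j S * c (toggle j S) := rfl

theorem raise_mul_self (j : Fin m) : raise j * raise j = 0 := by
  ext c S
  simp only [Module.End.mul_apply, LinearMap.comp_apply, raise_apply, mem_toggle_self]
  by_cases h : j ∈ S <;> simp [h]

theorem raise_mul_raise {j k : Fin m} (h : j ≠ k) : raise j * raise k = -(raise k * raise j) := by
  refine LinearMap.ext fun c => funext fun S => ?_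
  simp only [Module.End.mul_apply, raise_apply, LinearMap.neg_apply, Pi.neg_apply,
    mem_toggle_of_ne h, mem_toggle_of_ne h.symm]
  have := sgn_mul_toggle h S
  rw [toggle_comm k j]
  by_cases hj : j ∈ S <;> by_cases hk : k ∈ S <;> simp only [hj, hk, if_true, if_false]
  · linear_combination c (toggle j (toggle k S)) * this
  all_goals simp

/-- The canonical anticommutation relation between derivatives and generators. -/
theorem lower_raise (j k : Fin m) (c : Finset (Fin m) → ℂ) :
    lower j (raise k c) = (if j = k then c else 0) - raise k (lower j c) := by
  funext S
  by_cases h : j = k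
  · subst h
    simp only [if_true, Pi.sub_apply, raise_apply, lower_apply, mem_toggle_self, toggle_toggle,
      sgn_toggle_self]
    have := sgn_mul_self j S
    by_cases hj : j ∈ S <;> simp only [hj, if_true, if_false, not_true, not_false_eq_true]
    · linear_combination (c S) * this
    · linear_combination (c S) * this
  · simp only [h, if_false, Pi.sub_apply, raise_apply, lower_apply, mem_toggle_of_ne h,
      mem_toggle_of_ne (Ne.symm h), Pi.zero_apply]
    have := sgn_mul_toggle h S
    rw [toggle_comm k j]
    by_cases hj : j ∈ S <;> by_cases hk : k ∈ S <;> simp only [hj, hk, if_true, if_false]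
    · simp
    · simp
    · linear_combination c (toggle j (toggle k S)) * this
    · simp

/-- The derivatives are adjoint to the generators for the standard inner product. -/
theorem sum_star_raise_mul (j : Fin m) (c d : Finset (Fin m) → ℂ) :
    ∑ S, star (raise j c S) * d S = ∑ S, star (c S) * lower j d S := by
  rw [← sum_toggle j]
  refine Finset.sum_congr rfl fun S _ => ?_
  simp only [raise_apply, lower_apply, mem_toggle_self,
    toggle_toggle, sgn_toggle_self]
  by_cases hj : j ∈ S
  · simp [hj]
  · simp only [hj, not_false_eq_true, if_true, if_false, star_mul', star_sgn]; ring

theorem orderedProd_empty {A : Type*} [Monoid A] (g : Fin m → A) : orderedProd g ∅ = 1 := by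
  simp [orderedProd]

theorem orderedProd_insert {A : Type*} [Monoid A] (g : Fin m → A) {a : Fin m}
    {S : Finset (Fin m)} (h : ∀ x ∈ S, a < x) :
    orderedProd g (insert a S) = g a * orderedProd g S := by
  rw [orderedProd, Finset.sort_insert (· ≤ ·) (fun b hb => (h b hb).le)
    (fun ha => lt_irrefl _ (h a ha))]
  simp [orderedProd]

/-- Left multiplication of an ordered product of anticommuting generators of square `q` by one of
them. -/
theorem mul_orderedProd {A : Type*} [Ring A] [Algebra ℂ A] {g : Fin m → A} {q : ℂ}
    (hsq : ∀ j, g j * g j = q • (1 : A)) (hanti : ∀ j k, j ≠ k → g j * g k = -(g k * g j))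
    (j : Fin m) (S : Finset (Fin m)) :
    g j * orderedProd g S =
      (sgn j S * if j ∈ S then q else 1) • orderedProd g (toggle j S) := by
  induction S using Finset.induction_on_min with
  | empty =>
    have : toggle j (∅ : Finset (Fin m)) = insert j ∅ := toggle_of_notMem (by simp)
    rw [this, orderedProd_insert g (by simp)]
    simp [orderedProd_empty, sgn]
  | insert a S ha ih =>
    have haS : a ∉ S := fun h => lt_irrefl _ (ha a h)
    rcases lt_trichotomy j a with hja | rfl | haj
    · have hlt : ∀ x ∈ insert a S, j < x := by
        intro x hx
        rcases Finset.mem_insert.mp hx with rfl | hx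
        · exact hja
        · exact hja.trans (ha x hx)
      have hj : j ∉ insert a S := fun h => lt_irrefl _ (hlt j h)
      rw [toggle_of_notMem hj, orderedProd_insert g hlt, sgn_eq_one_of_lt hlt]
      simp [hj]
    · have h1 : toggle j (insert j S) = S := by
        rw [← toggle_of_notMem haS, toggle_toggle]
      rw [h1, orderedProd_insert g ha, ← mul_assoc, hsq, sgn_insert j haS, sgn_eq_one_of_lt ha]
      simp
    · have hmin : ∀ x ∈ toggle j S, a < x := by
        intro x hx
        rcases mem_toggle.mp hx with ⟨hx, _⟩ | ⟨rfl, _⟩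
        · exact ha x hx
        · exact haj
      have h1 : toggle j (insert a S) = insert a (toggle j S) := by
        rw [← toggle_of_notMem haS, toggle_comm,
          toggle_of_notMem (fun h => lt_irrefl _ (hmin a h))]
      rw [h1, orderedProd_insert g ha, orderedProd_insert g hmin, ← mul_assoc,
        hanti j a haj.ne', neg_mul, mul_assoc, ih, sgn_insert j haS]
      by_cases hj : j ∈ S <;> simp [hj, haj, haj.ne']

/-- Left multiplication by a generator, on coefficient functions. -/
theorem mul_sum_orderedProd {A : Type*} [Ring A] [Algebra ℂ A] {g : Fin m → A} {q : ℂ}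
    (hsq : ∀ j, g j * g j = q • (1 : A)) (hanti : ∀ j k, j ≠ k → g j * g k = -(g k * g j))
    (j : Fin m) (c : Finset (Fin m) → ℂ) :
    g j * ∑ S, c S • orderedProd g S = ∑ S, (raise j c S + q * lower j c S) • orderedProd g S := by
  rw [Finset.mul_sum, ← sum_toggle j]
  refine Finset.sum_congr rfl fun S _ => ?_
  rw [mul_smul_comm, mul_orderedProd hsq hanti, smul_smul]
  simp only [raise_apply, lower_apply, mem_toggle_self,
    toggle_toggle, sgn_toggle_self]
  congr 1
  by_cases hj : j ∈ S <;> simp [hj] <;> ring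

/-- An ordered product commutes with a generator up to a sign that depends on the parity. -/
theorem orderedProd_mul {A : Type*} [Ring A] [Algebra ℂ A] {g : Fin m → A}
    (hanti : ∀ j k, j ≠ k → g j * g k = -(g k * g j))
    (j : Fin m) (S : Finset (Fin m)) :
    orderedProd g S * g j =
      ((-1 : ℂ) ^ S.card * if j ∈ S then -1 else 1) • (g j * orderedProd g S) := by
  induction S using Finset.induction_on_min with
  | empty => simp [orderedProd_empty]
  | insert a S ha ih =>
    have haS : a ∉ S := fun h => lt_irrefl _ (ha a h)
    rw [orderedProd_insert g ha, mul_assoc, ih, Finset.card_insert_of_notMem haS, pow_succ]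
    by_cases hja : j = a
    · subst hja
      simp [haS]
    · have h2 : j ∈ insert a S ↔ j ∈ S := by simp [hja]
      simp only [h2]
      rw [mul_smul_comm, ← mul_assoc, ← mul_assoc, hanti a j (Ne.symm hja), neg_mul, smul_neg,
        ← neg_smul]
      congr 1; ring

/-- An even coefficient function: it is supported on sets with an even number of elements. -/
def IsEven (c : Finset (Fin m) → ℂ) : Prop := ∀ S, c S ≠ 0 → Even S.card

/-- Right multiplication of an even operator by a generator, on coefficient functions. -/
theorem sum_orderedProd_mul {A : Type*} [Ring A] [Algebra ℂ A] {g : Fin m → A}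
    (hsq : ∀ j, g j * g j = 1) (hanti : ∀ j k, j ≠ k → g j * g k = -(g k * g j))
    (j : Fin m) {c : Finset (Fin m) → ℂ} (hc : IsEven c) :
    (∑ S, c S • orderedProd g S) * g j = ∑ S, (raise j c S - lower j c S) • orderedProd g S := by
  rw [Finset.sum_mul, ← sum_toggle j]
  refine Finset.sum_congr rfl fun S _ => ?_
  rw [smul_mul_assoc, orderedProd_mul hanti, mul_orderedProd (q := 1) (by simpa using hsq) hanti,
    smul_smul, smul_smul]
  simp only [raise_apply, lower_apply, mem_toggle_self,
    toggle_toggle, sgn_toggle_self]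
  by_cases h0 : c (toggle j S) = 0
  · simp [h0]
  · rw [(hc _ h0).neg_one_pow]
    congr 1
    by_cases hj : j ∈ S <;> simp [hj] <;> ring

end OrderedProducts

/-! ### The Majorana operators -/

section Majorana

variable {n : ℕ}

/-- The occupation numbers `y` with that of the mode `μ` reversed. -/
def flip (μ : Fin n) (y : Fin n → Bool) : Fin n → Bool := Function.update y μ (!y μ)

/-- The set of filled modes. -/
def filled (y : Fin n → Bool) : Finset (Fin n) := Finset.univ.filter fun ν => y ν = true

theorem mem_filled {y : Fin n → Bool} {ν : Fin n} : ν ∈ filled y ↔ y ν = true := by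
  simp [filled]

theorem filled_flip (μ : Fin n) (y : Fin n → Bool) : filled (flip μ y) = toggle μ (filled y) := by
  ext ν
  by_cases h : ν = μ
  · subst h; simp [mem_filled, flip, mem_toggle]
  · simp [mem_filled, flip, mem_toggle, h]

theorem flip_flip (μ : Fin n) (y : Fin n → Bool) : flip μ (flip μ y) = y := by
  simp [flip]

theorem flip_comm (μ ν : Fin n) (y : Fin n → Bool) : flip μ (flip ν y) = flip ν (flip μ y) := by
  by_cases h : μ = ν
  · rw [h]
  · simp only [flip, Function.update_of_ne h, Function.update_of_ne (Ne.symm h)]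
    rw [Function.update_comm h]

theorem flip_apply_self (μ : Fin n) (y : Fin n → Bool) : flip μ y μ = !y μ := by simp [flip]

theorem flip_apply_of_ne {μ ν : Fin n} (h : μ ≠ ν) (y : Fin n → Bool) : flip ν y μ = y μ := by
  simp [flip, h]

theorem eq_flip_comm {μ : Fin n} {x y : Fin n → Bool} : x = flip μ y ↔ y = flip μ x :=
  ⟨fun h => by rw [h, flip_flip], fun h => by rw [h, flip_flip]⟩

theorem pow_card_eq_sgn (μ : Fin n) (y : Fin n → Bool) :
    (-1 : ℂ) ^ (Finset.univ.filter fun ν : Fin n => ν < μ ∧ y ν = true).card =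
      sgn μ (filled y) := by
  rw [sgn, Finset.prod_ite, Finset.prod_const, Finset.prod_const_one, mul_one]
  congr 2
  ext ν
  simp [filled, and_comm]

theorem annihilation_apply (μ : Fin n) (x y : Fin n → Bool) :
    (annihilation μ : FockOp n) x y =
      if x = flip μ y then (if y μ then sgn μ (filled y) else 0) else 0 := by
  rw [annihilation, pow_card_eq_sgn]
  by_cases h : y μ = true
  · simp [h, flip]
  · simp [h]

theorem annihilation_conjTranspose_apply (μ : Fin n) (x y : Fin n → Bool) :
    ((annihilation μ : FockOp n)ᴴ) x y =
      if x = flip μ y then (if y μ then 0 else sgn μ (filled y)) else 0 := by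
  rw [Matrix.conjTranspose_apply, annihilation_apply]
  by_cases h : x = flip μ y
  · subst h
    rw [flip_apply_self, filled_flip, sgn_toggle_self]
    cases h : y μ <;> simp [flip_flip, star_sgn, -RCLike.star_def]
  · have : y ≠ flip μ x := fun h' => h (eq_flip_comm.mp h')
    simp [h, this]

/-- The mode to which the Majorana operator `γ_j` belongs. -/
def modeOf (j : Fin (2 * n)) : Fin n := ⟨j.1 / 2, by omega⟩

/-- The phase, apart from the Jordan-Wigner sign, of the only nonzero entry of `γ_j` in the
column of a basis state in which the mode of `γ_j` has occupation number `b`. -/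
def majoranaPhase (j : Fin (2 * n)) (b : Bool) : ℂ :=
  if j.1 % 2 = 0 then 1 else if b then Complex.I else -Complex.I

/-- The Majorana operators are monomial matrices. -/
theorem majorana_apply (j : Fin (2 * n)) (x y : Fin n → Bool) :
    (majorana j : FockOp n) x y = if x = flip (modeOf j) y then
      majoranaPhase j (y (modeOf j)) * sgn (modeOf j) (filled y) else 0 := by
  have h1 := annihilation_apply (modeOf j) x y
  have h2 := annihilation_conjTranspose_apply (modeOf j) x y
  rw [modeOf] at h1 h2
  by_cases hj : j.1 % 2 = 0
  · simp only [majorana, hj, if_true, Matrix.add_apply, h1, h2, majoranaPhase, modeOf]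
    split_ifs <;> simp
  · simp only [majorana, hj, if_false, Matrix.smul_apply, Matrix.sub_apply, h1, h2,
      majoranaPhase, modeOf, smul_eq_mul]
    clear h1 h2
    split_ifs <;> simp_all

theorem majorana_mul_apply (j k : Fin (2 * n)) (x z : Fin n → Bool) :
    ((majorana j : FockOp n) * majorana k) x z =
      if x = flip (modeOf j) (flip (modeOf k) z) then
        (majoranaPhase j (flip (modeOf k) z (modeOf j)) *
          sgn (modeOf j) (toggle (modeOf k) (filled z))) *
        (majoranaPhase k (z (modeOf k)) * sgn (modeOf k) (filled z)) else 0 := by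
  rw [Matrix.mul_apply, Finset.sum_eq_single (flip (modeOf k) z)]
  · rw [majorana_apply, majorana_apply]
    simp [filled_flip]
  · intro y _ hy
    rw [majorana_apply k, if_neg hy, mul_zero]
  · simp

theorem majorana_mul_self (j : Fin (2 * n)) : (majorana j : FockOp n) * majorana j = 1 := by
  ext x z
  rw [majorana_mul_apply, flip_flip, Matrix.one_apply, flip_apply_self, sgn_toggle_self]
  split_ifs
  · have := sgn_mul_self (modeOf j) (filled z)
    have h2 : majoranaPhase j (!z (modeOf j)) * majoranaPhase j (z (modeOf j)) = 1 := by
      rw [majoranaPhase, majoranaPhase]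
      cases z (modeOf j) <;> split_ifs <;> simp_all
    linear_combination h2 * sgn (modeOf j) (filled z) * sgn (modeOf j) (filled z) + this
  · rfl

theorem majorana_anticomm (j k : Fin (2 * n)) (h : j ≠ k) :
    (majorana j : FockOp n) * majorana k = -(majorana k * majorana j) := by
  ext x z
  rw [Matrix.neg_apply, majorana_mul_apply, majorana_mul_apply, flip_comm (modeOf k)]
  split_ifs
  · by_cases hm : modeOf j = modeOf k
    · rw [hm, flip_apply_self, sgn_toggle_self]
      have hm' : j.1 / 2 = k.1 / 2 := congrArg Fin.val hm
      have h2 : majoranaPhase j (!z (modeOf k)) * majoranaPhase k (z (modeOf k)) =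
          - (majoranaPhase k (!z (modeOf k)) * majoranaPhase j (z (modeOf k))) := by
        rw [majoranaPhase, majoranaPhase, majoranaPhase, majoranaPhase]
        have hne : j.1 ≠ k.1 := fun h' => h (Fin.ext h')
        rcases Nat.mod_two_eq_zero_or_one j.1 with h1 | h1 <;>
          rcases Nat.mod_two_eq_zero_or_one k.1 with h2 | h2
        · omega
        · cases z (modeOf k) <;> simp [h1, h2]
        · cases z (modeOf k) <;> simp [h1, h2]
        · omega
      linear_combination h2 * sgn (modeOf k) (filled z) * sgn (modeOf k) (filled z)
    · rw [flip_apply_of_ne hm, flip_apply_of_ne (Ne.symm hm)]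
      have := sgn_toggle_mul hm (filled z)
      linear_combination majoranaPhase j (z (modeOf j)) * majoranaPhase k (z (modeOf k)) * this
  · simp

theorem majorana_conjTranspose (j : Fin (2 * n)) : (majorana j : FockOp n)ᴴ = majorana j := by
  rw [majorana]
  split_ifs
  · simp [add_comm]
  · rw [Matrix.conjTranspose_smul, Matrix.conjTranspose_sub, Matrix.conjTranspose_conjTranspose]
    rw [Complex.star_def, Complex.conj_I, neg_smul, ← smul_neg, neg_sub]

/-- A family of operators that satisfies the relations of the Majorana operators. -/
structure IsMajoranaFamily (g : Fin (2 * n) → FockOp n) : Prop where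
  mul_self : ∀ j, g j * g j = 1
  anticomm : ∀ j k, j ≠ k → g j * g k = -(g k * g j)
  conjTranspose : ∀ j, (g j)ᴴ = g j

theorem isMajoranaFamily_majorana : IsMajoranaFamily (majorana : Fin (2 * n) → FockOp n) :=
  ⟨majorana_mul_self, majorana_anticomm, majorana_conjTranspose⟩

theorem trace_eq_zero_of_anticomm {X Y : FockOp n} (hX : X * X = 1) (h : X * Y = -(Y * X)) :
    Y.trace = 0 := by
  have h1 : (X * (Y * X)).trace = Y.trace := by
    rw [Matrix.trace_mul_comm, mul_assoc, hX, mul_one]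
  have h2 : (X * (Y * X)).trace = -Y.trace := by
    rw [← mul_assoc, h, neg_mul, mul_assoc, hX, mul_one, Matrix.trace_neg]
  have h3 : Y.trace = -Y.trace := h1.symm.trans h2
  exact self_eq_neg.mp h3

theorem IsMajoranaFamily.orderedProd_mul_comm {g : Fin (2 * n) → FockOp n}
    (hg : IsMajoranaFamily g) (j : Fin (2 * n)) (S : Finset (Fin (2 * n))) :
    g j * orderedProd g S =
      ((-1 : ℂ) ^ S.card * if j ∈ S then -1 else 1) • (orderedProd g S * g j) := by
  rw [orderedProd_mul hg.anticomm, smul_smul]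
  have : ((-1 : ℂ) ^ S.card * if j ∈ S then -1 else 1) *
      ((-1 : ℂ) ^ S.card * if j ∈ S then -1 else 1) = 1 := by
    rcases neg_one_pow_eq_or ℂ S.card with h | h <;> rw [h] <;> split_ifs <;> norm_num
  rw [this, one_smul]

theorem IsMajoranaFamily.orderedProd_unitary {g : Fin (2 * n) → FockOp n}
    (hg : IsMajoranaFamily g) (S : Finset (Fin (2 * n))) :
    (orderedProd g S)ᴴ * orderedProd g S = 1 := by
  induction S using Finset.induction_on_min with
  | empty => simp [orderedProd_empty]
  | insert a S ha ih =>
    rw [orderedProd_insert g ha, Matrix.conjTranspose_mul, hg.conjTranspose, mul_assoc,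
      ← mul_assoc (g a), hg.mul_self, one_mul, ih]

/-- The ordered products of Majorana operators are orthogonal for the trace inner product. -/
theorem IsMajoranaFamily.trace_orderedProd {g : Fin (2 * n) → FockOp n}
    (hg : IsMajoranaFamily g) (S T : Finset (Fin (2 * n))) :
    ((orderedProd g S)ᴴ * orderedProd g T).trace = if S = T then (2 : ℂ) ^ n else 0 := by
  split_ifs with hST
  · subst hST
    rw [hg.orderedProd_unitary, Matrix.trace_one]
    simp
  · -- A generator that anticommutes with the product lies in the symmetric difference of `S` and
    -- `T` if their sizes have the same parity, and outside of it otherwise.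
    obtain ⟨j, hj⟩ : ∃ j, ((-1 : ℂ) ^ S.card * if j ∈ S then -1 else 1) *
        ((-1 : ℂ) ^ T.card * if j ∈ T then -1 else 1) = -1 := by
      have hcard : (symmDiff S T).card + 2 * (S ∩ T).card = S.card + T.card := by
        have h1 := Finset.card_sdiff_add_card_inter S T
        have h2 := Finset.card_sdiff_add_card_inter T S
        rw [Finset.inter_comm T S] at h2
        have h3 : (symmDiff S T).card = (S \ T).card + (T \ S).card := by
          rw [symmDiff_def, Finset.sup_eq_union, Finset.card_union_of_disjoint]
          exact disjoint_sdiff_sdiff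
        omega
      rcases Nat.even_or_odd (S.card + T.card) with he | ho
      · obtain ⟨j, hj⟩ : (symmDiff S T).Nonempty := by
          rw [Finset.nonempty_iff_ne_empty]
          intro h
          exact hST (symmDiff_eq_bot.mp h)
        refine ⟨j, ?_⟩
        have h1 : (-1 : ℂ) ^ S.card * (-1 : ℂ) ^ T.card = 1 := by
          rw [← pow_add, he.neg_one_pow]
        rcases Finset.mem_symmDiff.mp hj with ⟨h2, h3⟩ | ⟨h2, h3⟩ <;> simp [h2, h3] <;>
          exact h1
      · obtain ⟨j, hj⟩ : ∃ j, j ∉ symmDiff S T := by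
          by_contra! h
          have : symmDiff S T = Finset.univ := Finset.eq_univ_iff_forall.mpr h
          rw [this, Finset.card_univ, Fintype.card_fin] at hcard
          rw [← hcard] at ho
          rw [Nat.odd_iff] at ho
          omega
        refine ⟨j, ?_⟩
        have h1 : (-1 : ℂ) ^ S.card * (-1 : ℂ) ^ T.card = -1 := by
          rw [← pow_add, ho.neg_one_pow]
        rw [Finset.mem_symmDiff] at hj
        push Not at hj
        by_cases h2 : j ∈ S
        · simp [h2, hj.1 h2, h1]
        · have h3 : j ∉ T := fun h3 => h2 (hj.2 h3)
          simp [h2, h3, h1]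
    refine trace_eq_zero_of_anticomm (hg.mul_self j) ?_
    have hS : g j * (orderedProd g S)ᴴ =
        ((-1 : ℂ) ^ S.card * if j ∈ S then -1 else 1) • ((orderedProd g S)ᴴ * g j) := by
      have := congrArg Matrix.conjTranspose (orderedProd_mul hg.anticomm j S)
      rw [Matrix.conjTranspose_mul, Matrix.conjTranspose_smul, Matrix.conjTranspose_mul,
        hg.conjTranspose] at this
      rw [this]
      congr 1
      rcases neg_one_pow_eq_or ℂ S.card with h | h <;> rw [h] <;> split_ifs <;> simp
    rw [← mul_assoc, hS, smul_mul_assoc, mul_assoc, hg.orderedProd_mul_comm, mul_smul_comm,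
      smul_smul, hj, neg_one_smul, mul_assoc]

/-- The coefficients of an operator with respect to the ordered products of Majorana operators. -/
def coeffs (X : FockOp n) (S : Finset (Fin (2 * n))) : ℂ :=
  ((2 : ℂ) ^ n)⁻¹ * ((orderedProd majorana S)ᴴ * X).trace

theorem coeffs_sum (c : Finset (Fin (2 * n)) → ℂ) :
    coeffs (∑ S, c S • orderedProd (majorana (n := n)) S) = c := by
  funext S
  rw [coeffs, Finset.mul_sum, Matrix.trace_sum]
  simp only [mul_smul_comm, Matrix.trace_smul, isMajoranaFamily_majorana.trace_orderedProd]
  simp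
  field_simp

/-- Every operator is a combination of ordered products of Majorana operators. -/
theorem sum_coeffs (X : FockOp n) :
    ∑ S, coeffs X S • orderedProd (majorana (n := n)) S = X := by
  let f : (Finset (Fin (2 * n)) → ℂ) →ₗ[ℂ] FockOp n :=
    Fintype.linearCombination ℂ (fun S => orderedProd (majorana (n := n)) S)
  have hf : ∀ c, f c = ∑ S, c S • orderedProd (majorana (n := n)) S := fun c =>
    Fintype.linearCombination_apply ℂ _ c
  have hinj : Function.Injective f := by
    intro c d h
    rw [hf, hf] at h
    rw [← coeffs_sum c, h, coeffs_sum d]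
  have hsurj : Function.Surjective f := by
    refine (LinearMap.injective_iff_surjective_of_finrank_eq_finrank ?_).mp hinj
    rw [Module.finrank_fintype_fun_eq_card, Module.finrank_matrix]
    simp [← pow_add, two_mul]
  obtain ⟨c, rfl⟩ := hsurj X
  rw [hf, coeffs_sum]

end Majorana

/-! ### A linear characterization of Gaussian states -/

section Characterization

variable {n : ℕ}

/-- The equation `∂_j c = i ∑_k M_{jk} θ_k c` for coefficient functions, which characterizes the
multiples of the Grassmann exponential `exp ((i / 2) θᵀ M θ)`. -/
def CoeffEq (M : Matrix (Fin (2 * n)) (Fin (2 * n)) ℝ) (c : Finset (Fin (2 * n)) → ℂ) : Prop :=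
  ∀ j, lower j c = Complex.I • ∑ k, (M j k : ℂ) • raise k c

/-- The equation `[γ_j, ρ] = i ∑_k M_{jk} {γ_k, ρ}`. For even operators it is the Grassmann
equation `∂_j c = i ∑_k M_{jk} θ_k c` in operator form. -/
def GaussianEq (M : Matrix (Fin (2 * n)) (Fin (2 * n)) ℝ) (ρ : FockOp n) : Prop :=
  ∀ j, majorana j * ρ - ρ * majorana j =
    Complex.I • ∑ k, (M j k : ℂ) • (majorana k * ρ + ρ * majorana k)

theorem CoeffEq.apply_eq {M : Matrix (Fin (2 * n)) (Fin (2 * n)) ℝ}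
    {c : Finset (Fin (2 * n)) → ℂ} (h : CoeffEq M c) {j : Fin (2 * n)}
    {S : Finset (Fin (2 * n))} (hj : j ∈ S) :
    c S = sgn j S * (Complex.I * ∑ k, (M j k : ℂ) * raise k c (toggle j S)) := by
  have h1 := congrFun (h j) (toggle j S)
  rw [lower_apply, if_neg (by rwa [mem_toggle_self, not_not]), toggle_toggle, sgn_toggle_self] at h1
  simp only [Pi.smul_apply, Finset.sum_apply, smul_eq_mul] at h1
  rw [← h1, ← mul_assoc, sgn_mul_self, one_mul]

/-- A coefficient of a solution is determined by those with two generators less. -/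
theorem CoeffEq.apply_eq_zero {M : Matrix (Fin (2 * n)) (Fin (2 * n)) ℝ}
    {c : Finset (Fin (2 * n)) → ℂ} (h : CoeffEq M c) {S : Finset (Fin (2 * n))}
    (hS : S.Nonempty) (hc : ∀ T : Finset (Fin (2 * n)), T.card + 2 = S.card → c T = 0) :
    c S = 0 := by
  obtain ⟨j, hj⟩ := hS
  rw [h.apply_eq hj, Finset.sum_eq_zero, mul_zero, mul_zero]
  intro k _
  rw [raise_apply]
  split_ifs with hk
  · rw [hc, mul_zero, mul_zero]
    rw [toggle_of_mem hk, toggle_of_mem hj] at *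
    have h1 := Finset.card_erase_add_one hj
    have h2 := Finset.card_erase_add_one hk
    omega
  · rw [mul_zero]

theorem CoeffEq.isEven {M : Matrix (Fin (2 * n)) (Fin (2 * n)) ℝ}
    {c : Finset (Fin (2 * n)) → ℂ} (h : CoeffEq M c) : IsEven c := by
  suffices ∀ k, ∀ S : Finset (Fin (2 * n)), S.card = 2 * k + 1 → c S = 0 by
    intro S hS
    by_contra hodd
    obtain ⟨k, hk⟩ := Nat.not_even_iff_odd.mp hodd
    exact hS (this k S hk)
  intro k
  induction k with
  | zero =>
    intro S hS
    refine h.apply_eq_zero (Finset.card_pos.mp (by omega)) fun T hT => ?_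
    omega
  | succ k ih =>
    intro S hS
    exact h.apply_eq_zero (Finset.card_pos.mp (by omega)) fun T hT => ih T (by omega)

theorem CoeffEq.eq_zero {M : Matrix (Fin (2 * n)) (Fin (2 * n)) ℝ}
    {c : Finset (Fin (2 * n)) → ℂ} (h : CoeffEq M c) (h0 : c ∅ = 0) : c = 0 := by
  suffices ∀ k, ∀ S : Finset (Fin (2 * n)), S.card = 2 * k → c S = 0 by
    funext S
    by_contra hS
    obtain ⟨k, hk⟩ := (h.isEven S hS).exists_two_nsmul
    exact hS (this k S (by simpa using hk))
  intro k
  induction k with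
  | zero =>
    intro S hS
    rw [Finset.card_eq_zero.mp (by omega : S.card = 0), h0]
  | succ k ih =>
    intro S hS
    exact h.apply_eq_zero (Finset.card_pos.mp (by omega)) fun T hT => ih T (by omega)

theorem CoeffEq.smul {M : Matrix (Fin (2 * n)) (Fin (2 * n)) ℝ}
    {c : Finset (Fin (2 * n)) → ℂ} (h : CoeffEq M c) (a : ℂ) : CoeffEq M (a • c) := by
  intro j
  simp only [map_smul, h j, Finset.smul_sum, smul_comm a]

theorem CoeffEq.sub {M : Matrix (Fin (2 * n)) (Fin (2 * n)) ℝ}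
    {c d : Finset (Fin (2 * n)) → ℂ} (hc : CoeffEq M c) (hd : CoeffEq M d) :
    CoeffEq M (c - d) := by
  intro j
  simp only [map_sub, hc j, hd j, smul_sub, Finset.sum_sub_distrib]

/-- The constant coefficient of a solution fixes the others, by induction on the degree. -/
theorem CoeffEq.unique {M : Matrix (Fin (2 * n)) (Fin (2 * n)) ℝ}
    {c d : Finset (Fin (2 * n)) → ℂ} (hc : CoeffEq M c) (hd : CoeffEq M d) (h : c ∅ = d ∅) :
    c = d :=
  sub_eq_zero.mp ((hc.sub hd).eq_zero (by simp [h]))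

theorem raise_anticomm {m : ℕ} (j k : Fin m) :
    (raise j * raise k : Module.End ℂ (Finset (Fin m) → ℂ)) = -(raise k * raise j) := by
  by_cases h : j = k
  · subst h; rw [raise_mul_self, neg_zero]
  · exact raise_mul_raise h

/-- The action of the Grassmann algebra on coefficient functions by multiplication. -/
def grassmannRep (n : ℕ) : Grassmann n →ₐ[ℂ] Module.End ℂ (Finset (Fin (2 * n)) → ℂ) :=
  ExteriorAlgebra.lift ℂ ⟨Fintype.linearCombination ℂ raise, fun v => by
    rw [Fintype.linearCombination_apply, Finset.sum_mul_sum]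
    set X := ∑ i, ∑ j, v i • raise i * v j • raise j with hX
    have h : X = -X := by
      conv_lhs => rw [hX, Finset.sum_comm]
      rw [hX, ← Finset.sum_neg_distrib]
      refine Finset.sum_congr rfl fun i _ => ?_
      rw [← Finset.sum_neg_distrib]
      refine Finset.sum_congr rfl fun j _ => ?_
      rw [smul_mul_smul_comm, smul_mul_smul_comm, raise_anticomm, smul_neg, mul_comm (v j)]
    have h2 : (2 : ℂ) • X = 0 := by
      rw [two_smul]; nth_rewrite 1 [h]; rw [neg_add_cancel]
    exact (smul_eq_zero.mp h2).resolve_left two_ne_zero⟩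

theorem grassmannRep_theta (j : Fin (2 * n)) : grassmannRep n (theta j) = raise j := by
  rw [grassmannRep, theta, ExteriorAlgebra.lift_ι_apply]
  simp [Fintype.linearCombination_apply_single]

theorem orderedProd_raise_vacuum {m : ℕ} (S : Finset (Fin m)) :
    orderedProd (raise (m := m)) S (Pi.single ∅ 1) = Pi.single S 1 := by
  induction S using Finset.induction_on_min with
  | empty => simp [orderedProd_empty]
  | insert a S ha ih =>
    have haS : a ∉ S := fun h => lt_irrefl _ (ha a h)
    rw [orderedProd_insert _ ha, Module.End.mul_apply, ih]
    funext T
    rw [raise_apply]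
    by_cases hT : T = insert a S
    · subst hT
      rw [if_pos (Finset.mem_insert_self a S), sgn_insert a haS, sgn_eq_one_of_lt ha,
        ← toggle_of_notMem haS, toggle_toggle]
      simp
    · rw [Pi.single_eq_of_ne hT]
      split_ifs with h
      · rw [Pi.single_eq_of_ne, mul_zero]
        intro h'
        exact hT (by rw [← toggle_of_notMem haS, ← h', toggle_toggle])
      · rfl

theorem grassmannRep_orderedProd (S : Finset (Fin (2 * n))) :
    grassmannRep n (orderedProd theta S) = orderedProd raise S := by
  rw [orderedProd, orderedProd, map_list_prod, List.map_map]
  congr 2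
  funext j
  exact grassmannRep_theta j

/-- The action on the vacuum recovers the coefficients of a Grassmann element. -/
theorem grassmannRep_sum_vacuum (c : Finset (Fin (2 * n)) → ℂ) :
    grassmannRep n (∑ S, c S • orderedProd theta S) (Pi.single ∅ 1) = c := by
  simp only [map_sum, map_smul, grassmannRep_orderedProd, LinearMap.sum_apply,
    LinearMap.smul_apply, orderedProd_raise_vacuum]
  funext T
  simp [Finset.sum_apply, Pi.single_apply]

theorem theta_mul_self (j : Fin (2 * n)) : (theta j : Grassmann n) * theta j = 0 :=
  ExteriorAlgebra.ι_sq_zero _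

theorem theta_mul_sum (j : Fin (2 * n)) (c : Finset (Fin (2 * n)) → ℂ) :
    (theta j : Grassmann n) * ∑ S, c S • orderedProd theta S =
      ∑ S, raise j c S • orderedProd theta S := by
  rw [mul_sum_orderedProd (g := theta) (q := 0) (fun j => by rw [theta_mul_self, zero_smul])
    (fun j k _ => eq_neg_of_add_eq_zero_left (ExteriorAlgebra.ι_add_mul_swap _ _))]
  simp

/-- Multiplication by `(i / 2) θᵀ M θ`, on coefficient functions. -/
def quadraticOp (M : Matrix (Fin (2 * n)) (Fin (2 * n)) ℝ) :
    Module.End ℂ (Finset (Fin (2 * n)) → ℂ) :=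
  (Complex.I / 2) • ∑ j, ∑ k, (M j k : ℂ) • (raise j * raise k)

theorem grassmannRep_quadratic (M : Matrix (Fin (2 * n)) (Fin (2 * n)) ℝ) :
    grassmannRep n (grassmannQuadratic M) = quadraticOp M := by
  simp only [grassmannQuadratic, quadraticOp, map_smul, map_sum, map_mul, grassmannRep_theta]

/-- Multiplication by `i ∑_k M_{jk} θ_k`, the `j`-th derivative of `(i / 2) θᵀ M θ`, on coefficient
functions. -/
def linearOp (M : Matrix (Fin (2 * n)) (Fin (2 * n)) ℝ) (j : Fin (2 * n)) :
    Module.End ℂ (Finset (Fin (2 * n)) → ℂ) :=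
  Complex.I • ∑ k, (M j k : ℂ) • raise k

theorem quadraticOp_commute_raise (M : Matrix (Fin (2 * n)) (Fin (2 * n)) ℝ) (l : Fin (2 * n)) :
    Commute (quadraticOp M) (raise l) := by
  refine Commute.smul_left (Commute.sum_left _ _ _ fun j _ => Commute.sum_left _ _ _ fun k _ =>
    Commute.smul_left ?_ _) _
  have h : ∀ (a b : Fin (2 * n)) (c : Finset (Fin (2 * n)) → ℂ),
      raise a (raise b c) = -raise b (raise a c) := fun a b c =>
    LinearMap.congr_fun (raise_anticomm a b) c
  refine LinearMap.ext fun c => ?_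
  simp only [Module.End.mul_apply]
  rw [h k l, map_neg, h j l, neg_neg]

theorem quadraticOp_commute_linearOp (M : Matrix (Fin (2 * n)) (Fin (2 * n)) ℝ)
    (j : Fin (2 * n)) : Commute (quadraticOp M) (linearOp M j) :=
  Commute.smul_right (Commute.sum_right _ _ _ fun k _ =>
    (quadraticOp_commute_raise M k).smul_right _) _

/-- The Leibniz rule for the quadratic form; as the form is even, no sign appears. -/
theorem lower_quadraticOp {M : Matrix (Fin (2 * n)) (Fin (2 * n)) ℝ} (hM : Mᵀ = -M)
    (j : Fin (2 * n)) (c : Finset (Fin (2 * n)) → ℂ) :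
    lower j (quadraticOp M c) = linearOp M j c + quadraticOp M (lower j c) := by
  have hM' : ∀ a b, M b a = -M a b := fun a b => congrFun (congrFun hM a) b
  have h1 : ∀ a b, lower j (raise a (raise b c)) =
      (if j = a then raise b c else 0) - (if j = b then raise a c else 0) +
        raise a (raise b (lower j c)) := by
    intro a b
    rw [lower_raise, lower_raise, map_sub]
    by_cases h : j = b <;> simp [h, sub_add]
  simp only [quadraticOp, linearOp, LinearMap.smul_apply, LinearMap.sum_apply,
    Module.End.mul_apply, map_smul, map_sum, h1, smul_add, smul_sub, smul_ite, smul_zero,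
    Finset.sum_add_distrib, Finset.sum_sub_distrib, Finset.sum_ite_eq, Finset.mem_univ, if_true]
  congr 1
  rw [Finset.sum_comm]
  simp only [Finset.sum_ite_eq, Finset.mem_univ, if_true, hM' j, Complex.ofReal_neg, neg_smul,
    Finset.sum_neg_distrib, smul_neg, sub_neg_eq_add]
  rw [← add_smul, add_halves]

theorem lower_vacuum {m : ℕ} (j : Fin m) : lower j (Pi.single ∅ 1) = 0 := by
  funext S
  rw [lower_apply]
  split_ifs with h
  · rfl
  · rw [toggle_of_notMem h, Pi.single_eq_of_ne (Finset.insert_ne_empty j S), mul_zero,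
      Pi.zero_apply]

theorem lower_quadraticOp_pow {M : Matrix (Fin (2 * n)) (Fin (2 * n)) ℝ} (hM : Mᵀ = -M)
    (j : Fin (2 * n)) (k : ℕ) :
    lower j ((quadraticOp M ^ (k + 1)) (Pi.single ∅ 1)) =
      ((k : ℂ) + 1) • linearOp M j ((quadraticOp M ^ k) (Pi.single ∅ 1)) := by
  induction k with
  | zero => simp [lower_quadraticOp hM, lower_vacuum]
  | succ k ih =>
    rw [pow_succ', Module.End.mul_apply, lower_quadraticOp hM, ih, map_smul,
      ← Module.End.mul_apply (quadraticOp M), (quadraticOp_commute_linearOp M j).eq,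
      Module.End.mul_apply, ← Module.End.mul_apply (quadraticOp M), ← pow_succ']
    push_cast
    module

/-- A homogeneous coefficient function of degree `d`. -/
def HasDegree {m : ℕ} (d : ℕ) (c : Finset (Fin m) → ℂ) : Prop := ∀ S, S.card ≠ d → c S = 0

theorem HasDegree.raise {m d : ℕ} {c : Finset (Fin m) → ℂ} (h : HasDegree d c) (j : Fin m) :
    HasDegree (d + 1) (raise j c) := by
  intro S hS
  rw [raise_apply]
  split_ifs with hj
  · rw [h, mul_zero]
    rw [toggle_of_mem hj]
    have := Finset.card_erase_add_one hj
    omega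
  · rfl

theorem hasDegree_quadraticOp_pow (M : Matrix (Fin (2 * n)) (Fin (2 * n)) ℝ) (k : ℕ) :
    HasDegree (2 * k) ((quadraticOp M ^ k) (Pi.single ∅ 1)) := by
  induction k with
  | zero =>
    intro S hS
    rw [pow_zero, Module.End.one_apply, Pi.single_eq_of_ne]
    rintro rfl
    simp at hS
  | succ k ih =>
    rw [pow_succ', Module.End.mul_apply]
    generalize (quadraticOp M ^ k) (Pi.single ∅ 1) = c at ih
    intro S hS
    simp only [quadraticOp, LinearMap.smul_apply, LinearMap.sum_apply, Module.End.mul_apply,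
      Pi.smul_apply, Finset.sum_apply]
    rw [Finset.sum_eq_zero, smul_zero]
    intro a _
    refine Finset.sum_eq_zero fun b _ => ?_
    rw [((ih.raise b).raise a) S (by omega), smul_zero]

/-- The coefficients of the Grassmann exponential `exp ((i / 2) θᵀ M θ)`. -/
def expCoeffs (M : Matrix (Fin (2 * n)) (Fin (2 * n)) ℝ) : Finset (Fin (2 * n)) → ℂ :=
  ∑ k ∈ Finset.range (n + 1), ((k.factorial : ℂ)⁻¹) • (quadraticOp M ^ k) (Pi.single ∅ 1)

theorem grassmannRep_exp (M : Matrix (Fin (2 * n)) (Fin (2 * n)) ℝ) :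
    grassmannRep n (grassmannExp M) (Pi.single ∅ 1) = expCoeffs M := by
  simp only [grassmannExp, expCoeffs, map_sum, map_smul, map_pow, grassmannRep_quadratic,
    LinearMap.sum_apply, LinearMap.smul_apply]

theorem expCoeffs_empty (M : Matrix (Fin (2 * n)) (Fin (2 * n)) ℝ) : expCoeffs M ∅ = 1 := by
  rw [expCoeffs, Finset.sum_range_succ', Pi.add_apply, Finset.sum_apply, Finset.sum_eq_zero]
  · simp
  · intro k _
    rw [Pi.smul_apply, hasDegree_quadraticOp_pow M (k + 1) ∅ (by simp), smul_zero]

/-- The exponential of the quadratic form satisfies the differential equation. Cutting off the series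
after the `n`-th power is harmless, as the next term would have degree `2n + 2`. -/
theorem coeffEq_expCoeffs {M : Matrix (Fin (2 * n)) (Fin (2 * n)) ℝ} (hM : Mᵀ = -M) :
    CoeffEq M (expCoeffs M) := by
  intro j
  have hlin : ∀ c, Complex.I • ∑ k, (M j k : ℂ) • raise k c = linearOp M j c := by
    intro c
    simp only [linearOp, LinearMap.smul_apply, LinearMap.sum_apply]
  -- The last term of the exponential has the top degree, so it does not contribute on the right.
  have htop : linearOp M j ((quadraticOp M ^ n) (Pi.single ∅ 1)) = 0 := by
    rw [← hlin, Finset.sum_eq_zero, smul_zero]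
    intro k _
    have : raise k ((quadraticOp M ^ n) (Pi.single ∅ 1)) = 0 := by
      funext S
      refine (hasDegree_quadraticOp_pow M n).raise k S ?_
      have := Finset.card_le_univ S
      rw [Fintype.card_fin] at this
      omega
    rw [this, smul_zero]
  rw [hlin, expCoeffs, map_sum, map_sum, Finset.sum_range_succ', Finset.sum_range_succ]
  simp only [map_smul, lower_quadraticOp_pow hM, htop, pow_zero, Module.End.one_apply,
    lower_vacuum, smul_zero, add_zero]
  refine Finset.sum_congr rfl fun k _ => ?_
  rw [smul_smul, Nat.factorial_succ]
  congr 1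
  push_cast
  have : (k : ℂ) + 1 ≠ 0 := by exact_mod_cast Nat.succ_ne_zero k
  have h2 : (k.factorial : ℂ) ≠ 0 := by exact_mod_cast Nat.factorial_ne_zero k
  field_simp

/-- The Grassmann exponential has the coefficients `expCoeffs`. -/
theorem sum_expCoeffs (M : Matrix (Fin (2 * n)) (Fin (2 * n)) ℝ) :
    ∑ S, expCoeffs M S • orderedProd theta S = grassmannExp M := by
  let Ψ : (Finset (Fin (2 * n)) → ℂ) →ₗ[ℂ] Grassmann n :=
    Fintype.linearCombination ℂ (fun S => orderedProd (theta (n := n)) S)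
  have hΨ : ∀ c, Ψ c = ∑ S, c S • orderedProd theta S := fun c =>
    Fintype.linearCombination_apply ℂ _ c
  have hraise : ∀ j c, Ψ (raise j c) = theta j * Ψ c := fun j c => by
    rw [hΨ, hΨ, theta_mul_sum]
  have hquad : ∀ c, Ψ (quadraticOp M c) = grassmannQuadratic M * Ψ c := by
    intro c
    simp only [quadraticOp, grassmannQuadratic, LinearMap.smul_apply, LinearMap.sum_apply,
      Module.End.mul_apply, map_smul, map_sum, hraise, smul_mul_assoc, Finset.sum_mul, mul_assoc]
  have hpow : ∀ k, Ψ ((quadraticOp M ^ k) (Pi.single ∅ 1)) = grassmannQuadratic M ^ k := by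
    intro k
    induction k with
    | zero =>
      rw [pow_zero, pow_zero, Module.End.one_apply]
      simp [Ψ, Fintype.linearCombination_apply_single, orderedProd_empty]
    | succ k ih => rw [pow_succ', pow_succ', Module.End.mul_apply, hquad, ih]
  rw [← hΨ, expCoeffs, grassmannExp, map_sum]
  exact Finset.sum_congr rfl fun k _ => by rw [map_smul, hpow]

/-- The fermion parity operator, up to a phase: it anticommutes with every Majorana operator. -/
def parityOp (n : ℕ) : FockOp n := orderedProd majorana Finset.univ

theorem majorana_mul_parityOp (j : Fin (2 * n)) :
    majorana j * parityOp n = -(parityOp n * majorana j) := by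
  rw [parityOp, isMajoranaFamily_majorana.orderedProd_mul_comm]
  simp

theorem orderedProd_mul_of_anticomm {g : Fin (2 * n) → FockOp n} {P : FockOp n}
    (h : ∀ j, g j * P = -(P * g j)) (S : Finset (Fin (2 * n))) :
    orderedProd g S * P = (-1 : ℂ) ^ S.card • (P * orderedProd g S) := by
  induction S using Finset.induction_on_min with
  | empty => simp [orderedProd_empty]
  | insert a S ha ih =>
    have haS : a ∉ S := fun h => lt_irrefl _ (ha a h)
    rw [orderedProd_insert g ha, mul_assoc, ih, mul_smul_comm, ← mul_assoc, h, neg_mul, smul_neg,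
      Finset.card_insert_of_notMem haS, pow_succ, mul_assoc]
    simp

theorem isEven_coeffs_iff (X : FockOp n) :
    IsEven (coeffs X) ↔ X * parityOp n = parityOp n * X := by
  have h1 : X * parityOp n =
      parityOp n * ∑ S, ((-1 : ℂ) ^ S.card * coeffs X S) • orderedProd majorana S := by
    conv_lhs => rw [← sum_coeffs X, Finset.sum_mul]
    rw [Finset.mul_sum]
    refine Finset.sum_congr rfl fun S _ => ?_
    rw [smul_mul_assoc, orderedProd_mul_of_anticomm majorana_mul_parityOp,
      mul_smul_comm, smul_smul, mul_comm]
  have h2 : (parityOp n)ᴴ * parityOp n = 1 := isMajoranaFamily_majorana.orderedProd_unitary _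
  have h3 : X * parityOp n = parityOp n * X ↔
      (fun S => (-1 : ℂ) ^ S.card * coeffs X S) = coeffs X := by
    rw [h1]
    constructor
    · intro h
      have := congrArg (fun Y => (parityOp n)ᴴ * Y) h
      simp only [← mul_assoc, h2, one_mul] at this
      rw [← coeffs_sum fun S => (-1 : ℂ) ^ S.card * coeffs X S, this]
    · intro h
      simp only [funext_iff] at h
      simp only [h, sum_coeffs]
  rw [h3, funext_iff]
  refine forall_congr' fun S => ?_
  rcases Nat.even_or_odd S.card with h | h
  · simp [h, h.neg_one_pow]
  · have : ¬ Even S.card := Nat.not_even_iff_odd.mpr h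
    simp only [this, imp_false, not_not, h.neg_one_pow]
    constructor
    · intro h; rw [h, mul_zero]
    · intro h; rw [neg_one_mul] at h; exact neg_eq_self.mp h

/-- For even operators `[γ_j, ·]` and `{γ_k, ·}` are twice the derivative `∂_j` and twice the
multiplication by `θ_k`. -/
theorem gaussianEq_iff_coeffEq (M : Matrix (Fin (2 * n)) (Fin (2 * n)) ℝ) {X : FockOp n}
    (hX : IsEven (coeffs X)) : GaussianEq M X ↔ CoeffEq M (coeffs X) := by
  have hL : ∀ j, majorana j * X =
      ∑ S, (raise j (coeffs X) S + lower j (coeffs X) S) • orderedProd majorana S := by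
    intro j
    conv_lhs => rw [← sum_coeffs X, mul_sum_orderedProd (q := 1)
      (fun j => by rw [majorana_mul_self, one_smul]) majorana_anticomm]
    simp only [one_mul]
  have hR : ∀ j, X * majorana j =
      ∑ S, (raise j (coeffs X) S - lower j (coeffs X) S) • orderedProd majorana S := by
    intro j
    conv_lhs => rw [← sum_coeffs X, sum_orderedProd_mul majorana_mul_self majorana_anticomm j hX]
  refine forall_congr' fun j => ?_
  have h1 : majorana j * X - X * majorana j =
      ∑ S, ((2 : ℂ) • lower j (coeffs X)) S • orderedProd majorana S := by
    rw [hL, hR, ← Finset.sum_sub_distrib]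
    refine Finset.sum_congr rfl fun S _ => ?_
    rw [← sub_smul, Pi.smul_apply, smul_eq_mul]
    congr 1; ring
  have h2 : Complex.I • ∑ k, (M j k : ℂ) • (majorana k * X + X * majorana k) =
      ∑ S, ((2 : ℂ) • Complex.I • ∑ k, (M j k : ℂ) • raise k (coeffs X)) S •
        orderedProd majorana S := by
    have : ∀ k, majorana k * X + X * majorana k =
        ∑ S, ((2 : ℂ) • raise k (coeffs X)) S • orderedProd majorana S := by
      intro k
      rw [hL, hR, ← Finset.sum_add_distrib]
      refine Finset.sum_congr rfl fun S _ => ?_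
      rw [← add_smul, Pi.smul_apply, smul_eq_mul]
      congr 1; ring
    simp only [this, Finset.smul_sum, smul_smul]
    rw [Finset.sum_comm]
    refine Finset.sum_congr rfl fun S _ => ?_
    rw [← Finset.sum_smul]
    congr 1
    simp only [Pi.smul_apply, Finset.sum_apply, smul_eq_mul]
    exact Finset.sum_congr rfl fun k _ => by ring
  rw [h1, h2]
  constructor
  · intro h
    have := congrArg coeffs h
    rw [coeffs_sum, coeffs_sum] at this
    exact smul_right_injective _ (two_ne_zero (α := ℂ)) this
  · intro h
    rw [h]

theorem coeffs_empty (X : FockOp n) : coeffs X ∅ = ((2 : ℂ) ^ n)⁻¹ * X.trace := by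
  simp [coeffs, orderedProd_empty]

/-- Gaussian states are the even states `ρ` that satisfy `[γ_j, ρ] = i ∑_k M_{jk} {γ_k, ρ}` for a
real antisymmetric matrix `M`. -/
theorem isGaussian_iff (ρ : FockOp n) :
    IsGaussian ρ ↔ ρ.PosSemidef ∧ ρ.trace = 1 ∧ ρ * parityOp n = parityOp n * ρ ∧
      ∃ M : Matrix (Fin (2 * n)) (Fin (2 * n)) ℝ, Mᵀ = -M ∧ GaussianEq M ρ := by
  constructor
  · rintro ⟨hpos, htr, M, c, hM, rfl, hc⟩
    refine ⟨hpos, htr, ?_⟩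
    have hc' : CoeffEq M c := by
      have := congrArg (fun y => grassmannRep n y (Pi.single ∅ 1)) hc
      simp only [grassmannRep_sum_vacuum, map_smul, LinearMap.smul_apply, grassmannRep_exp] at this
      rw [this]
      exact (coeffEq_expCoeffs hM).smul _
    rw [← isEven_coeffs_iff, coeffs_sum]
    refine ⟨hc'.isEven, M, hM, ?_⟩
    rw [gaussianEq_iff_coeffEq M (by rw [coeffs_sum]; exact hc'.isEven), coeffs_sum]
    exact hc'
  · rintro ⟨hpos, htr, heven, M, hM, hρ⟩
    rw [← isEven_coeffs_iff] at heven
    rw [gaussianEq_iff_coeffEq M heven] at hρ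
    refine ⟨hpos, htr, M, coeffs ρ, hM, (sum_coeffs ρ).symm, ?_⟩
    have : coeffs ρ = ((2 : ℂ) ^ n)⁻¹ • expCoeffs M := by
      refine hρ.unique ((coeffEq_expCoeffs hM).smul _) ?_
      rw [Pi.smul_apply, expCoeffs_empty, coeffs_empty, htr, smul_eq_mul]
    rw [this, ← sum_expCoeffs, Finset.smul_sum]
    exact Finset.sum_congr rfl fun S _ => by rw [Pi.smul_apply, smul_assoc]

/-- The matrix in the linear equation of a Gaussian state is its correlation matrix. -/
theorem GaussianEq.corrMatrix_eq {M : Matrix (Fin (2 * n)) (Fin (2 * n)) ℝ} {ρ : FockOp n}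
    (h : GaussianEq M ρ) (htr : ρ.trace = 1) : corrMatrix ρ = M := by
  ext j k
  have h1 := congrArg (fun X => (X * majorana k).trace) (h j)
  have h2 : ∀ l : Fin (2 * n), ((majorana l * ρ + ρ * majorana l) * majorana k).trace =
      if l = k then (2 : ℂ) else 0 := by
    intro l
    have h3 : ((majorana l * ρ + ρ * majorana l) * majorana k).trace =
        (ρ * (majorana k * majorana l + majorana l * majorana k)).trace := by
      rw [add_mul, mul_add, Matrix.trace_add, Matrix.trace_add, mul_assoc,
        Matrix.trace_mul_comm (majorana l), mul_assoc, mul_assoc]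
    rw [h3]
    split_ifs with hlk
    · subst hlk
      rw [majorana_mul_self, mul_add, mul_one, Matrix.trace_add, htr]
      norm_num
    · rw [majorana_anticomm l k hlk, add_neg_cancel, mul_zero, Matrix.trace_zero]
  have h4 : ((majorana j * ρ - ρ * majorana j) * majorana k).trace =
      -(ρ * (majorana j * majorana k - majorana k * majorana j)).trace := by
    rw [sub_mul, mul_sub, Matrix.trace_sub, Matrix.trace_sub, mul_assoc,
      Matrix.trace_mul_comm (majorana j), mul_assoc, mul_assoc]
    ring
  simp only [h4, smul_mul_assoc, Finset.sum_mul, Matrix.trace_smul, Matrix.trace_sum, h2,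
    smul_eq_mul, mul_ite, mul_zero, Finset.sum_ite_eq', Finset.mem_univ, if_true] at h1
  rw [corrMatrix, neg_eq_iff_eq_neg.mp h1]
  have : Complex.I / 2 * -(Complex.I * ((M j k : ℂ) * 2)) = (M j k : ℂ) := by
    linear_combination -(M j k : ℂ) * Complex.I_mul_I
  rw [this, Complex.ofReal_re]

end Characterization

/-! ### Rotations -/

section Rotations

variable {n : ℕ}

theorem majorana_anticommutator (j k : Fin (2 * n)) :
    (majorana j : FockOp n) * majorana k + majorana k * majorana j =
      (if j = k then (2 : ℂ) else 0) • 1 := by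
  split_ifs with h
  · subst h; rw [majorana_mul_self, two_smul]
  · rw [majorana_anticomm j k h, neg_add_cancel, zero_smul]

theorem SO_transpose_mul (O : SO n) : O.1ᵀ * O.1 = 1 := ((mem_SO_iff O.1).mp O.2).1

theorem SO_mul_transpose (O : SO n) : O.1 * O.1ᵀ = 1 :=
  mul_eq_one_comm.mp (SO_transpose_mul O)

/-- The rotated Majorana operators `∑_k O_{kj} γ_k`. -/
def rotatedMajorana (O : SO n) (j : Fin (2 * n)) : FockOp n :=
  ∑ k, (O.1 k j : ℂ) • majorana k

theorem rotatedMajorana_anticommutator (O : SO n) (j k : Fin (2 * n)) :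
    rotatedMajorana O j * rotatedMajorana O k + rotatedMajorana O k * rotatedMajorana O j =
      (if j = k then (2 : ℂ) else 0) • 1 := by
  have h1 : rotatedMajorana O k * rotatedMajorana O j =
      ∑ a, ∑ b, ((O.1 a j : ℂ) * O.1 b k) • (majorana b * majorana a) := by
    rw [rotatedMajorana, rotatedMajorana, Finset.sum_mul_sum, Finset.sum_comm]
    exact Finset.sum_congr rfl fun a _ => Finset.sum_congr rfl fun b _ => by
      rw [smul_mul_smul_comm, mul_comm (O.1 b k : ℂ)]
  have h2 : rotatedMajorana O j * rotatedMajorana O k =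
      ∑ a, ∑ b, ((O.1 a j : ℂ) * O.1 b k) • (majorana a * majorana b) := by
    rw [rotatedMajorana, rotatedMajorana, Finset.sum_mul_sum]
    exact Finset.sum_congr rfl fun a _ => Finset.sum_congr rfl fun b _ => by
      rw [smul_mul_smul_comm]
  rw [h1, h2, ← Finset.sum_add_distrib]
  simp only [← Finset.sum_add_distrib, ← smul_add, majorana_anticommutator, smul_smul,
    ← Finset.sum_smul, mul_ite, mul_zero, Finset.sum_ite_eq, Finset.mem_univ, if_true]
  have h3 := congrFun (congrFun (SO_transpose_mul O) j) k
  rw [Matrix.mul_apply, Matrix.one_apply] at h3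
  have h4 : ∑ a, (O.1 a j : ℂ) * O.1 a k * 2 = ((∑ a, O.1ᵀ j a * O.1 a k : ℝ) : ℂ) * 2 := by
    rw [← Finset.sum_mul]
    push_cast
    rfl
  rw [h4, h3]
  congr 1
  split_ifs <;> simp

theorem isMajoranaFamily_rotatedMajorana (O : SO n) : IsMajoranaFamily (rotatedMajorana O) where
  mul_self j := by
    have := rotatedMajorana_anticommutator O j j
    rw [if_pos rfl, ← two_smul ℂ] at this
    exact smul_right_injective _ (two_ne_zero (α := ℂ)) this
  anticomm j k h := by
    have := rotatedMajorana_anticommutator O j k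
    rw [if_neg h, zero_smul] at this
    exact eq_neg_of_add_eq_zero_left this
  conjTranspose j := by
    simp only [rotatedMajorana, Matrix.conjTranspose_sum, Matrix.conjTranspose_smul,
      majorana_conjTranspose, Complex.star_def, Complex.conj_ofReal]

theorem rotate_eq (O : SO n) (X : FockOp n) :
    rotate O X = ∑ S, coeffs X S • orderedProd (rotatedMajorana O) S := rfl

theorem rotate_sum (O : SO n) (c : Finset (Fin (2 * n)) → ℂ) :
    rotate O (∑ S, c S • orderedProd majorana S) =
      ∑ S, c S • orderedProd (rotatedMajorana O) S := by
  rw [rotate_eq, coeffs_sum]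

theorem coeffs_add (X Y : FockOp n) : coeffs (X + Y) = coeffs X + coeffs Y := by
  funext S
  simp only [coeffs, mul_add, Matrix.trace_add, Pi.add_apply]

theorem coeffs_smul (a : ℂ) (X : FockOp n) : coeffs (a • X) = a • coeffs X := by
  funext S
  simp only [coeffs, mul_smul_comm, Matrix.trace_smul, Pi.smul_apply, smul_eq_mul]
  ring

/-- A rotation as a linear map on operators. -/
def rotateLin (O : SO n) : FockOp n →ₗ[ℂ] FockOp n where
  toFun := rotate O
  map_add' X Y := by
    simp only [rotate_eq, coeffs_add, Pi.add_apply, add_smul, Finset.sum_add_distrib]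
  map_smul' a X := by
    simp only [rotate_eq, coeffs_smul, Pi.smul_apply, smul_assoc, Finset.smul_sum, RingHom.id_apply]

theorem rotateLin_apply (O : SO n) (X : FockOp n) : rotateLin O X = rotate O X := rfl

theorem rotate_orderedProd (O : SO n) (S : Finset (Fin (2 * n))) :
    rotate O (orderedProd majorana S) = orderedProd (rotatedMajorana O) S := by
  have := rotate_sum O (Pi.single S 1)
  simpa [Pi.single_apply] using this

theorem rotate_one (O : SO n) : rotate O (1 : FockOp n) = 1 := by
  have := rotate_orderedProd O ∅
  rwa [orderedProd_empty, orderedProd_empty] at this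

theorem rotate_majorana_mul (O : SO n) (j : Fin (2 * n)) (X : FockOp n) :
    rotate O (majorana j * X) = rotatedMajorana O j * rotate O X := by
  have hO := isMajoranaFamily_rotatedMajorana O
  conv_lhs => rw [← sum_coeffs X, mul_sum_orderedProd (q := 1)
    (fun j => by rw [majorana_mul_self, one_smul]) majorana_anticomm]
  rw [rotate_sum, rotate_eq, mul_sum_orderedProd (q := 1)
    (fun j => by rw [hO.mul_self, one_smul]) hO.anticomm]

/-- A rotation is multiplicative: left multiplication by a generator is given by the same operation on
coefficients for the rotated Majorana operators, which satisfy the same relations. -/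
theorem rotate_mul (O : SO n) (Y X : FockOp n) : rotate O (Y * X) = rotate O Y * rotate O X := by
  have h : ∀ S, rotate O (orderedProd majorana S * X) =
      orderedProd (rotatedMajorana O) S * rotate O X := by
    intro S
    induction S using Finset.induction_on_min with
    | empty => simp [orderedProd_empty]
    | insert a S ha ih =>
      rw [orderedProd_insert _ ha, orderedProd_insert _ ha, mul_assoc, rotate_majorana_mul, ih,
        mul_assoc]
  conv_lhs => rw [← sum_coeffs Y, Finset.sum_mul]
  rw [rotate_eq O Y, Finset.sum_mul, ← rotateLin_apply, map_sum]
  refine Finset.sum_congr rfl fun S _ => ?_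
  rw [smul_mul_assoc, map_smul, rotateLin_apply, h, smul_mul_assoc]

theorem rotate_majorana (O : SO n) (j : Fin (2 * n)) :
    rotate O (majorana j) = rotatedMajorana O j := by
  have := rotate_majorana_mul O j 1
  rwa [mul_one, rotate_one, mul_one] at this

theorem rotate_conjTranspose (O : SO n) (X : FockOp n) : rotate O Xᴴ = (rotate O X)ᴴ := by
  have hO := isMajoranaFamily_rotatedMajorana O
  have h : ∀ S, rotate O (orderedProd majorana S)ᴴ = (orderedProd (rotatedMajorana O) S)ᴴ := by
    intro S
    induction S using Finset.induction_on_min with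
    | empty => simp [orderedProd_empty, rotate_one]
    | insert a S ha ih =>
      rw [orderedProd_insert _ ha, orderedProd_insert _ ha, Matrix.conjTranspose_mul,
        Matrix.conjTranspose_mul, rotate_mul, ih, majorana_conjTranspose, rotate_majorana,
        hO.conjTranspose]
  conv_lhs => rw [← sum_coeffs X]
  rw [rotate_eq O X, Matrix.conjTranspose_sum, Matrix.conjTranspose_sum, ← rotateLin_apply, map_sum]
  refine Finset.sum_congr rfl fun S _ => ?_
  rw [Matrix.conjTranspose_smul, Matrix.conjTranspose_smul, map_smul, rotateLin_apply, h]

theorem rotate_trace (O : SO n) (X : FockOp n) : (rotate O X).trace = X.trace := by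
  have hO := isMajoranaFamily_rotatedMajorana O
  have h : ∀ S : Finset (Fin (2 * n)), (orderedProd (rotatedMajorana O) S).trace =
      (orderedProd (majorana (n := n)) S).trace := by
    intro S
    have h1 := hO.trace_orderedProd ∅ S
    have h2 := isMajoranaFamily_majorana.trace_orderedProd ∅ S
    rw [orderedProd_empty, Matrix.conjTranspose_one, one_mul] at h1 h2
    rw [h1, h2]
  conv_rhs => rw [← sum_coeffs X]
  rw [rotate_eq, Matrix.trace_sum, Matrix.trace_sum]
  exact Finset.sum_congr rfl fun S _ => by rw [Matrix.trace_smul, Matrix.trace_smul, h]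

open scoped MatrixOrder in
theorem rotate_posSemidef (O : SO n) {X : FockOp n} (hX : X.PosSemidef) :
    (rotate O X).PosSemidef := by
  obtain ⟨B, rfl⟩ := CStarAlgebra.nonneg_iff_eq_star_mul_self.mp hX.nonneg
  rw [Matrix.star_eq_conjTranspose, rotate_mul, rotate_conjTranspose]
  exact Matrix.posSemidef_conjTranspose_mul_self _

theorem rotate_parity (O : SO n) {X : FockOp n} (hX : X * parityOp n = parityOp n * X) :
    rotate O X * parityOp n = parityOp n * rotate O X := by
  have h : ∀ j, rotatedMajorana O j * parityOp n = -(parityOp n * rotatedMajorana O j) := by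
    intro j
    simp only [rotatedMajorana, Finset.sum_mul, Finset.mul_sum, smul_mul_assoc,
      majorana_mul_parityOp, mul_smul_comm, smul_neg, Finset.sum_neg_distrib]
  rw [← isEven_coeffs_iff] at hX
  rw [rotate_eq, Finset.sum_mul, Finset.mul_sum]
  refine Finset.sum_congr rfl fun S _ => ?_
  rw [smul_mul_assoc, orderedProd_mul_of_anticomm h, mul_smul_comm]
  by_cases h0 : coeffs X S = 0
  · rw [h0, zero_smul, zero_smul]
  · rw [(hX S h0).neg_one_pow, one_smul]

theorem majorana_eq_sum_rotated (O : SO n) (l : Fin (2 * n)) :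
    (majorana l : FockOp n) = ∑ j, (O.1 l j : ℂ) • rotatedMajorana O j := by
  simp only [rotatedMajorana, Finset.smul_sum, smul_smul]
  rw [Finset.sum_comm]
  simp only [← Finset.sum_smul]
  have h : ∀ k, ∑ j, (O.1 l j : ℂ) * O.1 k j = if l = k then 1 else 0 := by
    intro k
    have := congrFun (congrFun (SO_mul_transpose O) l) k
    rw [Matrix.mul_apply, Matrix.one_apply] at this
    have h2 : ∑ j, (O.1 l j : ℂ) * O.1 k j = ((∑ j, O.1 l j * O.1ᵀ j k : ℝ) : ℂ) := by
      push_cast; rfl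
    rw [h2, this]
    split_ifs <;> simp
  simp [h]

/-- The linear equation of a Gaussian state is covariant under rotations. -/
theorem GaussianEq.rotate {M : Matrix (Fin (2 * n)) (Fin (2 * n)) ℝ} {X : FockOp n}
    (h : GaussianEq M X) (O : SO n) : GaussianEq (O.1 * M * O.1ᵀ) (rotate O X) := by
  have h1 : ∀ j, rotatedMajorana O j * FreeFermion.rotate O X -
      FreeFermion.rotate O X * rotatedMajorana O j = Complex.I • ∑ k, (M j k : ℂ) •
        (rotatedMajorana O k * FreeFermion.rotate O X +
          FreeFermion.rotate O X * rotatedMajorana O k) := by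
    intro j
    have := congrArg (rotateLin O) (h j)
    simpa only [map_sub, map_smul, map_sum, map_add, rotateLin_apply, rotate_mul,
      rotate_majorana] using this
  intro l
  have h2 : majorana l * FreeFermion.rotate O X - FreeFermion.rotate O X * majorana l =
      ∑ j, (O.1 l j : ℂ) • (rotatedMajorana O j * FreeFermion.rotate O X -
        FreeFermion.rotate O X * rotatedMajorana O j) := by
    rw [majorana_eq_sum_rotated O l, Finset.sum_mul, Finset.mul_sum, ← Finset.sum_sub_distrib]
    simp only [smul_sub, smul_mul_assoc, mul_smul_comm]
  have h3 : ∀ k, rotatedMajorana O k * FreeFermion.rotate O X +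
      FreeFermion.rotate O X * rotatedMajorana O k = ∑ m, (O.1 m k : ℂ) •
        (majorana m * FreeFermion.rotate O X + FreeFermion.rotate O X * majorana m) := by
    intro k
    rw [rotatedMajorana, Finset.sum_mul, Finset.mul_sum, ← Finset.sum_add_distrib]
    simp only [smul_add, smul_mul_assoc, mul_smul_comm]
  rw [h2]
  simp only [h1, h3, Finset.smul_sum, smul_smul, Matrix.mul_apply, Matrix.transpose_apply,
    Complex.ofReal_sum, Complex.ofReal_mul, Finset.sum_mul, Finset.sum_smul]
  rw [Finset.sum_comm, Finset.sum_congr rfl fun k _ => Finset.sum_comm, Finset.sum_comm]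
  refine Finset.sum_congr rfl fun m _ => Finset.sum_congr rfl fun k _ =>
    Finset.sum_congr rfl fun j _ => ?_
  congr 1
  ring

theorem IsGaussian.gaussianEq {ρ : FockOp n} (h : IsGaussian ρ) : GaussianEq (corrMatrix ρ) ρ := by
  obtain ⟨-, htr, -, M, -, hM⟩ := (isGaussian_iff ρ).mp h
  rwa [hM.corrMatrix_eq htr]

theorem IsGaussian.transpose_corrMatrix {ρ : FockOp n} (h : IsGaussian ρ) :
    (corrMatrix ρ)ᵀ = -corrMatrix ρ := by
  obtain ⟨-, htr, -, M, hM', hM⟩ := (isGaussian_iff ρ).mp h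
  rwa [hM.corrMatrix_eq htr]

theorem transpose_conj_eq_neg {M : Matrix (Fin (2 * n)) (Fin (2 * n)) ℝ} (hM : Mᵀ = -M)
    (A : Matrix (Fin (2 * n)) (Fin (2 * n)) ℝ) : (A * M * Aᵀ)ᵀ = -(A * M * Aᵀ) := by
  rw [Matrix.transpose_mul, Matrix.transpose_mul, Matrix.transpose_transpose, hM]
  simp [mul_assoc]

theorem IsGaussian.rotate {ρ : FockOp n} (h : IsGaussian ρ) (O : SO n) :
    IsGaussian (rotate O ρ) := by
  obtain ⟨hpos, htr, hpar, M, hM', hM⟩ := (isGaussian_iff ρ).mp h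
  exact (isGaussian_iff _).mpr ⟨rotate_posSemidef O hpos, (rotate_trace O ρ).trans htr,
    rotate_parity O hpar, _, transpose_conj_eq_neg hM' O.1, hM.rotate O⟩

theorem IsGaussian.corrMatrix_rotate {ρ : FockOp n} (h : IsGaussian ρ) (O : SO n) :
    corrMatrix (FreeFermion.rotate O ρ) = O.1 * corrMatrix ρ * O.1ᵀ :=
  (h.gaussianEq.rotate O).corrMatrix_eq ((rotate_trace O ρ).trans h.2.1)

end Rotations

/-! ### The bound on the correlation matrix -/

section Covariance

variable {n : ℕ}

/-- The two-point functions are `⟨γ_j γ_k⟩ = δ_{jk} - i M_{jk}`. -/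
theorem GaussianEq.trace_mul_majorana {M : Matrix (Fin (2 * n)) (Fin (2 * n)) ℝ} {ρ : FockOp n}
    (h : GaussianEq M ρ) (htr : ρ.trace = 1) (j k : Fin (2 * n)) :
    (ρ * (majorana j * majorana k)).trace =
      (if j = k then 1 else 0) - Complex.I * M j k := by
  have hac : ∀ l k : Fin (2 * n), (ρ * (majorana l * majorana k)).trace +
      (ρ * (majorana k * majorana l)).trace = if l = k then (2 : ℂ) else 0 := by
    intro l k
    rw [← Matrix.trace_add, ← mul_add, majorana_anticommutator, mul_smul_comm, mul_one,
      Matrix.trace_smul, htr, smul_eq_mul, mul_one]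
  have h1 := congrArg (fun X => (X * majorana k).trace) (h j)
  have h2 : ∀ l : Fin (2 * n), ((majorana l * ρ + ρ * majorana l) * majorana k).trace =
      if l = k then (2 : ℂ) else 0 := by
    intro l
    rw [← hac, add_mul, Matrix.trace_add, mul_assoc, Matrix.trace_mul_comm (majorana l), mul_assoc,
      mul_assoc, add_comm]
  have h4 : ((majorana j * ρ - ρ * majorana j) * majorana k).trace =
      (ρ * (majorana k * majorana j)).trace - (ρ * (majorana j * majorana k)).trace := by
    rw [sub_mul, Matrix.trace_sub, mul_assoc, Matrix.trace_mul_comm (majorana j), mul_assoc,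
      mul_assoc]
  simp only [h4, smul_mul_assoc, Finset.sum_mul, Matrix.trace_smul, Matrix.trace_sum, h2,
    smul_eq_mul, mul_ite, mul_zero, Finset.sum_ite_eq', Finset.mem_univ, if_true] at h1
  have h5 := hac j k
  have h6 : (if j = k then (2 : ℂ) else 0) = 2 * if j = k then 1 else 0 := by split_ifs <;> simp
  rw [h6] at h5
  linear_combination (h5 - h1) / 2

/-- The expectation of `Γ†Γ` with `Γ = ∑_j (x_j + i (M x)_j) γ_j` is `|x|² - |M x|²`, so that `M` is
a contraction. -/
theorem GaussianEq.posSemidef {M : Matrix (Fin (2 * n)) (Fin (2 * n)) ℝ} {ρ : FockOp n}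
    (h : GaussianEq M ρ) (hM : Mᵀ = -M) (htr : ρ.trace = 1) (hρ : ρ.PosSemidef) :
    (1 + M * M).PosSemidef := by
  have hM' : ∀ a b, M b a = -M a b := fun a b => congrFun (congrFun hM a) b
  refine Matrix.PosSemidef.of_dotProduct_mulVec_nonneg ?_ fun x => ?_
  · rw [Matrix.IsHermitian, Matrix.conjTranspose_eq_transpose_of_trivial, Matrix.transpose_add,
      Matrix.transpose_mul, hM]
    simp
  set y := M *ᵥ x with hy
  let w : Fin (2 * n) → ℂ := fun j => x j + Complex.I * y j
  let G : FockOp n := ∑ j, w j • majorana j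
  have hpos : 0 ≤ (G * ρ * Gᴴ).trace := (hρ.mul_mul_conjTranspose_same G).trace_nonneg
  have hG : (G * ρ * Gᴴ).trace = ∑ j, ∑ k, star (w j) * w k *
      ((if j = k then 1 else 0) - Complex.I * M j k) := by
    have hGG : Gᴴ * G = ∑ j, ∑ k, (star (w j) * w k) • (majorana j * majorana k) := by
      simp only [G, Matrix.conjTranspose_sum, Matrix.conjTranspose_smul, majorana_conjTranspose]
      rw [Finset.sum_mul_sum]
      simp only [smul_mul_smul_comm]
    rw [mul_assoc, Matrix.trace_mul_comm, mul_assoc, hGG]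
    simp only [Finset.mul_sum, mul_smul_comm, Matrix.trace_sum, Matrix.trace_smul,
      h.trace_mul_majorana htr, smul_eq_mul]
  have hre := (Complex.le_def.mp hpos).1
  rw [hG] at hre
  have hterm : ∀ j k, (star (w j) * w k * ((if j = k then 1 else 0) - Complex.I * M j k)).re =
      (if j = k then x j * x k + y j * y k else 0) + x j * (M j k * y k) - y j * (M j k * x k) := by
    intro j k
    have : star (w j) * w k = ((x j * x k + y j * y k : ℝ) : ℂ) +
        Complex.I * ((x j * y k - y j * x k : ℝ) : ℂ) := by
      simp only [w, star_add, star_mul', Complex.star_def, Complex.conj_ofReal, Complex.conj_I]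
      push_cast
      linear_combination -(y j * y k : ℂ) * Complex.I_mul_I
    rw [this]
    split_ifs <;> simp <;> ring
  simp only [Complex.re_sum, hterm, Complex.zero_re, Finset.sum_add_distrib, Finset.sum_sub_distrib,
    Finset.sum_ite_eq, Finset.mem_univ, if_true, ← Finset.mul_sum] at hre
  have e1 : ∑ j, x j * ∑ k, M j k * y k = -∑ j, y j * y j := by
    have : ∑ j, x j * ∑ k, M j k * y k = ∑ k, y k * ∑ j, M j k * x j := by
      simp only [Finset.mul_sum]
      rw [Finset.sum_comm]
      exact Finset.sum_congr rfl fun _ _ => Finset.sum_congr rfl fun _ _ => by ring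
    rw [this, ← Finset.sum_neg_distrib]
    refine Finset.sum_congr rfl fun k _ => ?_
    rw [← mul_neg]
    congr 1
    rw [hy, Matrix.mulVec, dotProduct, ← Finset.sum_neg_distrib]
    exact Finset.sum_congr rfl fun j _ => by rw [hM' k j]; ring
  have e2 : ∑ j, y j * ∑ k, M j k * x k = ∑ j, y j * y j := rfl
  have e3 : star x ⬝ᵥ (1 + M * M) *ᵥ x = ∑ j, x j * x j + ∑ j, x j * ∑ k, M j k * y k := by
    rw [Matrix.add_mulVec, Matrix.one_mulVec, ← Matrix.mulVec_mulVec, dotProduct_add]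
    rfl
  rw [e3, e1]
  rw [e1, e2] at hre
  linarith

theorem IsGaussian.posSemidef_one_add {ρ : FockOp n} (h : IsGaussian ρ) :
    (1 + corrMatrix ρ * corrMatrix ρ).PosSemidef :=
  h.gaussianEq.posSemidef h.transpose_corrMatrix h.2.1 h.1

end Covariance

/-! ### The measurement -/

section MeasurementLemmas

variable {n : ℕ} [NeZero n]

/-- The sign of an outcome of the measurement. -/
def outcomeSign (b : Bool) : ℝ := if b then 1 else -1

theorem outcomeSign_mul_self (b : Bool) : outcomeSign b * outcomeSign b = 1 := by
  cases b <;> simp [outcomeSign]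

/-- The indices other than the first two. -/
def restIndices (n : ℕ) [NeZero n] : Finset (Fin (2 * n)) :=
  (Finset.univ.erase (fst n)).erase (snd n)

theorem fst_ne_snd : fst n ≠ snd n := by simp [fst, snd]

theorem mem_restIndices {k : Fin (2 * n)} : k ∈ restIndices n ↔ k ≠ fst n ∧ k ≠ snd n := by
  simp [restIndices, and_comm]

theorem sum_eq_rest {A : Type*} [AddCommMonoid A] (f : Fin (2 * n) → A) :
    ∑ k, f k = f (fst n) + (f (snd n) + ∑ k ∈ restIndices n, f k) := by
  rw [restIndices, Finset.add_sum_erase _ f (by simp [fst_ne_snd.symm]),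
    Finset.add_sum_erase _ f (Finset.mem_univ _)]

/-- The observable `i γ₁ γ₂`, multiplied by the sign of an outcome. -/
def signedObs (b : Bool) : FockOp n :=
  ((outcomeSign b : ℂ) * Complex.I) • (majorana (fst n) * majorana (snd n))

theorem outcomeProj_eq (b : Bool) :
    (outcomeProj b : FockOp n) = (1 / 2 : ℂ) • (1 + signedObs b) := by
  cases b <;> simp [outcomeProj, outcomeSign, signedObs]

theorem outcomeSign_sq_complex (b : Bool) : (outcomeSign b : ℂ) * outcomeSign b = 1 := by
  exact_mod_cast congrArg Complex.ofReal (outcomeSign_mul_self b)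

theorem sign_I_mul_self (b : Bool) :
    ((outcomeSign b : ℂ) * Complex.I) * ((outcomeSign b : ℂ) * Complex.I) = -1 := by
  linear_combination Complex.I * Complex.I * outcomeSign_sq_complex b + Complex.I_mul_I

theorem majorana_snd_mul_fst : (majorana (snd n) : FockOp n) * majorana (fst n) =
    -(majorana (fst n) * majorana (snd n)) :=
  majorana_anticomm _ _ fst_ne_snd.symm

theorem signedObs_mul_self (b : Bool) : (signedObs b : FockOp n) * signedObs b = 1 := by
  have : ((majorana (fst n) : FockOp n) * majorana (snd n)) *
      (majorana (fst n) * majorana (snd n)) = -1 := by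
    simp only [mul_assoc, ← mul_assoc (majorana (snd n)) (majorana (fst n)), majorana_snd_mul_fst,
      majorana_mul_self, neg_mul, mul_neg, mul_one]
  rw [signedObs, smul_mul_smul_comm, this, sign_I_mul_self]
  simp

theorem signedObs_mul_fst (b : Bool) : (signedObs b : FockOp n) * majorana (fst n) =
    -(((outcomeSign b : ℂ) * Complex.I) • majorana (snd n)) := by
  rw [signedObs, smul_mul_assoc, mul_assoc, majorana_snd_mul_fst, mul_neg, ← mul_assoc,
    majorana_mul_self, one_mul, smul_neg]

theorem fst_mul_signedObs (b : Bool) : majorana (fst n) * (signedObs b : FockOp n) =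
    ((outcomeSign b : ℂ) * Complex.I) • majorana (snd n) := by
  rw [signedObs, mul_smul_comm, ← mul_assoc, majorana_mul_self, one_mul]

theorem signedObs_mul_snd (b : Bool) : (signedObs b : FockOp n) * majorana (snd n) =
    ((outcomeSign b : ℂ) * Complex.I) • majorana (fst n) := by
  rw [signedObs, smul_mul_assoc, mul_assoc, majorana_mul_self, mul_one]

theorem snd_mul_signedObs (b : Bool) : majorana (snd n) * (signedObs b : FockOp n) =
    -(((outcomeSign b : ℂ) * Complex.I) • majorana (fst n)) := by
  rw [signedObs, mul_smul_comm, ← mul_assoc, majorana_snd_mul_fst, neg_mul, mul_assoc,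
    majorana_mul_self, mul_one, smul_neg]

theorem signedObs_commute {j : Fin (2 * n)} (hj : j ∈ restIndices n) (b : Bool) :
    (signedObs b : FockOp n) * majorana j = majorana j * signedObs b := by
  obtain ⟨h1, h2⟩ := mem_restIndices.mp hj
  rw [signedObs, smul_mul_assoc, mul_smul_comm, mul_assoc, majorana_anticomm _ _ h2.symm, mul_neg,
    ← mul_assoc, majorana_anticomm _ _ h1.symm, neg_mul, neg_neg, mul_assoc]

theorem signedObs_conjTranspose (b : Bool) : (signedObs b : FockOp n)ᴴ = signedObs b := by
  rw [signedObs, Matrix.conjTranspose_smul, Matrix.conjTranspose_mul, majorana_conjTranspose,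
    majorana_conjTranspose, majorana_snd_mul_fst, smul_neg, ← neg_smul]
  congr 1
  simp

theorem outcomeProj_mul_self (b : Bool) : (outcomeProj b : FockOp n) * outcomeProj b =
    outcomeProj b := by
  rw [outcomeProj_eq, smul_mul_smul_comm, add_mul, mul_add, mul_add, signedObs_mul_self]
  simp only [one_mul, mul_one]
  module

theorem outcomeProj_conjTranspose (b : Bool) : (outcomeProj b : FockOp n)ᴴ = outcomeProj b := by
  rw [outcomeProj_eq, Matrix.conjTranspose_smul, Matrix.conjTranspose_add,
    signedObs_conjTranspose, Matrix.conjTranspose_one]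
  simp

theorem outcomeProj_commute {j : Fin (2 * n)} (hj : j ∈ restIndices n) (b : Bool) :
    (outcomeProj b : FockOp n) * majorana j = majorana j * outcomeProj b := by
  rw [outcomeProj_eq, smul_mul_assoc, mul_smul_comm, add_mul, mul_add, signedObs_commute hj,
    one_mul, mul_one]

theorem outcomeProj_mul_snd (b : Bool) : (outcomeProj b : FockOp n) * majorana (snd n) =
    ((outcomeSign b : ℂ) * Complex.I) • (outcomeProj b * majorana (fst n)) := by
  have h := sign_I_mul_self b
  rw [outcomeProj_eq, smul_mul_assoc, smul_mul_assoc, add_mul, add_mul, signedObs_mul_fst,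
    signedObs_mul_snd, one_mul, one_mul]
  generalize (outcomeSign b : ℂ) * Complex.I = z at h
  linear_combination (norm := module) (1 / 2 : ℂ) • h • (majorana (snd n) : FockOp n)

theorem snd_mul_outcomeProj (b : Bool) : majorana (snd n) * (outcomeProj b : FockOp n) =
    -(((outcomeSign b : ℂ) * Complex.I) • (majorana (fst n) * outcomeProj b)) := by
  have h := sign_I_mul_self b
  rw [outcomeProj_eq, mul_smul_comm, mul_smul_comm, mul_add, mul_add, fst_mul_signedObs,
    snd_mul_signedObs, mul_one, mul_one]
  generalize (outcomeSign b : ℂ) * Complex.I = z at h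
  linear_combination (norm := module) (1 / 2 : ℂ) • h • (majorana (snd n) : FockOp n)

theorem outcomeProj_parity (b : Bool) :
    (outcomeProj b : FockOp n) * parityOp n = parityOp n * outcomeProj b := by
  rw [outcomeProj_eq, signedObs, smul_mul_assoc, mul_smul_comm, add_mul, mul_add, one_mul, mul_one,
    smul_mul_assoc, mul_smul_comm, mul_assoc, majorana_mul_parityOp, mul_neg, ← mul_assoc,
    majorana_mul_parityOp, neg_mul, neg_neg, mul_assoc]

theorem trace_outcomeProj_mul {M : Matrix (Fin (2 * n)) (Fin (2 * n)) ℝ} {ρ : FockOp n}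
    (h : GaussianEq M ρ) (htr : ρ.trace = 1) (b : Bool) :
    (outcomeProj b * ρ).trace = (((1 + outcomeSign b * M (fst n) (snd n)) / 2 : ℝ) : ℂ) := by
  rw [Matrix.trace_mul_comm, outcomeProj_eq, mul_smul_comm, mul_add, mul_one, signedObs,
    mul_smul_comm, Matrix.trace_smul, Matrix.trace_add, Matrix.trace_smul,
    h.trace_mul_majorana htr, htr, if_neg fst_ne_snd]
  simp only [smul_eq_mul]
  push_cast
  linear_combination -(outcomeSign b * M (fst n) (snd n) / 2 : ℂ) * Complex.I_mul_I

theorem outcomeProb_eq {M : Matrix (Fin (2 * n)) (Fin (2 * n)) ℝ} {ρ : FockOp n}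
    (h : GaussianEq M ρ) (htr : ρ.trace = 1) (b : Bool) :
    outcomeProb b ρ = (1 + outcomeSign b * M (fst n) (snd n)) / 2 := by
  rw [outcomeProb, trace_outcomeProj_mul h htr, Complex.ofReal_re]

/-- The correlation matrix after an outcome of sign `s`, as a function of that before the
measurement. -/
def measuredMatrix (s : ℝ) (M : Matrix (Fin (2 * n)) (Fin (2 * n)) ℝ) :
    Matrix (Fin (2 * n)) (Fin (2 * n)) ℝ := fun j k =>
  if j ∈ restIndices n ∧ k ∈ restIndices n then
    M j k + s * (M j (fst n) * M (snd n) k - M j (snd n) * M (fst n) k) /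
      (1 + s * M (fst n) (snd n))
  else if j = fst n ∧ k = snd n then s
  else if j = snd n ∧ k = fst n then -s
  else 0

theorem measuredMatrix_rest (s : ℝ) (M : Matrix (Fin (2 * n)) (Fin (2 * n)) ℝ)
    {j k : Fin (2 * n)} (hj : j ∈ restIndices n) (hk : k ∈ restIndices n) :
    measuredMatrix s M j k = M j k + s * (M j (fst n) * M (snd n) k - M j (snd n) * M (fst n) k) /
      (1 + s * M (fst n) (snd n)) := by
  simp [measuredMatrix, hj, hk]

theorem fst_notMem_rest : fst n ∉ restIndices n := fun h => (mem_restIndices.mp h).1 rfl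

theorem snd_notMem_rest : snd n ∉ restIndices n := fun h => (mem_restIndices.mp h).2 rfl

theorem measuredMatrix_fst (s : ℝ) (M : Matrix (Fin (2 * n)) (Fin (2 * n)) ℝ) (k : Fin (2 * n)) :
    measuredMatrix s M (fst n) k = if k = snd n then s else 0 := by
  simp [measuredMatrix, fst_notMem_rest, fst_ne_snd]

theorem measuredMatrix_snd (s : ℝ) (M : Matrix (Fin (2 * n)) (Fin (2 * n)) ℝ) (k : Fin (2 * n)) :
    measuredMatrix s M (snd n) k = if k = fst n then -s else 0 := by
  simp [measuredMatrix, snd_notMem_rest, fst_ne_snd.symm]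

theorem measuredMatrix_transpose (s : ℝ) {M : Matrix (Fin (2 * n)) (Fin (2 * n)) ℝ}
    (hM : Mᵀ = -M) : (measuredMatrix s M)ᵀ = -measuredMatrix s M := by
  have hM' : ∀ a b, M b a = -M a b := fun a b => congrFun (congrFun hM a) b
  ext j k
  rw [Matrix.transpose_apply, Matrix.neg_apply]
  by_cases h : j ∈ restIndices n ∧ k ∈ restIndices n
  · rw [measuredMatrix_rest s M h.1 h.2, measuredMatrix_rest s M h.2 h.1, hM' j k,
      hM' (fst n) k, hM' (snd n) k, hM' (fst n) j, hM' (snd n) j]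
    ring
  · have h' : ¬(k ∈ restIndices n ∧ j ∈ restIndices n) := fun h' => h ⟨h'.2, h'.1⟩
    have := fst_ne_snd (n := n)
    simp only [measuredMatrix, h, h', if_false]
    by_cases h1 : j = fst n ∧ k = snd n
    · simp [h1.1, h1.2, this, this.symm]
    · by_cases h2 : j = snd n ∧ k = fst n
      · simp [h2.1, h2.2, this, this.symm]
      · rw [if_neg h1, if_neg h2, if_neg (fun h => h2 ⟨h.2, h.1⟩), if_neg (fun h => h1 ⟨h.2, h.1⟩),
          neg_zero]

omit [NeZero n] in
theorem GaussianEq.smul {M : Matrix (Fin (2 * n)) (Fin (2 * n)) ℝ} {X : FockOp n}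
    (h : GaussianEq M X) (a : ℂ) : GaussianEq M (a • X) := by
  intro j
  rw [mul_smul_comm, smul_mul_assoc, ← smul_sub, h j, smul_comm a, Finset.smul_sum]
  congr 1
  refine Finset.sum_congr rfl fun k _ => ?_
  rw [mul_smul_comm, smul_mul_assoc, ← smul_add, smul_comm a]

/-- Compressing the linear equation of a Gaussian state by the projector of an outcome gives two
equations (for the first two generators) that can be solved for the terms in which a generator
stands between the state and the projector, and so a linear equation for the compressed state. -/
theorem GaussianEq.measure {M : Matrix (Fin (2 * n)) (Fin (2 * n)) ℝ} {ρ : FockOp n}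
    (h : GaussianEq M ρ) (hM : Mᵀ = -M) (b : Bool)
    (hb : 1 + outcomeSign b * M (fst n) (snd n) ≠ 0) :
    GaussianEq (measuredMatrix (outcomeSign b) M) (outcomeProj b * ρ * outcomeProj b) := by
  have hM' : ∀ a b, M b a = -M a b := fun a b => congrFun (congrFun hM a) b
  have hdiag : ∀ a, M a a = 0 := fun a => self_eq_neg.mp (hM' a a)
  set P : FockOp n := outcomeProj b with hP
  set s : ℂ := (outcomeSign b : ℂ) with hs
  have hss : s * s = 1 := outcomeSign_sq_complex b
  set q : ℂ := 1 + s * M (fst n) (snd n) with hqdef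
  have hq : q ≠ 0 := by rw [hqdef, hs]; exact_mod_cast hb
  set σ := P * ρ * P with hσ
  set X := P * majorana (fst n) * ρ * P with hX
  set Y := P * ρ * majorana (fst n) * P with hY
  let Z : Fin (2 * n) → FockOp n := fun k => P * (majorana k * ρ + ρ * majorana k) * P
  have hZ0 : Z (fst n) = X + Y := by
    simp only [Z, hX, hY, mul_add, add_mul, mul_assoc]
  have hsndP : majorana (snd n) * P = -((s * Complex.I) • (majorana (fst n) * P)) :=
    snd_mul_outcomeProj b
  have hPsnd : P * majorana (snd n) = (s * Complex.I) • (P * majorana (fst n)) :=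
    outcomeProj_mul_snd b
  have hX1 : P * (majorana (snd n) * ρ) * P = (s * Complex.I) • X := by
    rw [hX, ← mul_assoc, hPsnd, smul_mul_assoc, smul_mul_assoc]
  have hY1 : P * (ρ * majorana (snd n)) * P = -((s * Complex.I) • Y) := by
    rw [hY, ← mul_assoc, mul_assoc (P * ρ), hsndP, mul_neg, mul_smul_comm, mul_assoc (P * ρ)]
  have hZ1 : Z (snd n) = (s * Complex.I) • (X - Y) := by
    simp only [Z, mul_add, add_mul]
    rw [hX1, hY1, smul_sub, sub_eq_add_neg]
  have hPk : ∀ k ∈ restIndices n, P * majorana k = majorana k * P := fun k hk =>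
    outcomeProj_commute hk b
  have hLk : ∀ k ∈ restIndices n, P * (majorana k * ρ) * P = majorana k * σ := by
    intro k hk
    rw [hσ, ← mul_assoc, hPk k hk, mul_assoc, mul_assoc, mul_assoc]
  have hRk : ∀ k ∈ restIndices n, P * (ρ * majorana k) * P = σ * majorana k := by
    intro k hk
    rw [hσ, mul_assoc, mul_assoc, ← hPk k hk, mul_assoc, mul_assoc]
  have hZk : ∀ k ∈ restIndices n, Z k = majorana k * σ + σ * majorana k := by
    intro k hk
    simp only [Z, mul_add, add_mul]
    rw [hLk k hk, hRk k hk]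
  let R : Fin (2 * n) → FockOp n := fun j => ∑ k ∈ restIndices n, (M j k : ℂ) • Z k
  have hcomp : ∀ j, P * (majorana j * ρ) * P - P * (ρ * majorana j) * P =
      Complex.I • ((M j (fst n) : ℂ) • (X + Y) +
        ((M j (snd n) : ℂ) • ((s * Complex.I) • (X - Y)) + R j)) := by
    intro j
    rw [← sub_mul, ← mul_sub, h j, mul_smul_comm, smul_mul_assoc, Finset.mul_sum, Finset.sum_mul]
    congr 1
    simp only [mul_smul_comm, smul_mul_assoc]
    rw [sum_eq_rest, ← hZ0, ← hZ1]
  -- The equations of the first two generators determine `X` and `Y`, the terms in which `γ₁` stands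
  -- between the state and a projector.
  have h0 : X - Y = (Complex.I / q) • R (fst n) := by
    have h1 := hcomp (fst n)
    rw [hdiag, ← mul_assoc, ← mul_assoc, ← hX, ← hY, Complex.ofReal_zero, zero_smul, zero_add] at h1
    have h2 : q • (X - Y) = Complex.I • R (fst n) := by
      rw [hqdef]
      linear_combination (norm := module) h1 + (s * M (fst n) (snd n)) • Complex.I_mul_I • (X - Y)
    rw [div_eq_inv_mul, mul_smul, ← h2, inv_smul_smul₀ hq]
  have h1 : X + Y = (s / q) • R (snd n) := by
    have h1 := hcomp (snd n)
    rw [hdiag, hM' (fst n), hX1, hY1, Complex.ofReal_zero, zero_smul, zero_add] at h1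
    have h2 : q • (X + Y) = s • R (snd n) := by
      rw [hqdef]
      push_cast at h1
      linear_combination (norm := module) -(s * Complex.I) • h1 - hss • (X + Y) +
        (s * s + s * M (fst n) (snd n)) • Complex.I_mul_I • (X + Y) -
        s • Complex.I_mul_I • R (snd n)
    rw [div_eq_inv_mul, mul_smul, ← h2, inv_smul_smul₀ hq]
  -- In the compressed state `i γ₁ γ₂` is a number, so `γ₁` and `γ₂` act as multiples of each other.
  have hγσ : majorana (snd n) * σ = -((s * Complex.I) • (majorana (fst n) * σ)) := by
    rw [hσ, ← mul_assoc, ← mul_assoc, hsndP, neg_mul, neg_mul, smul_mul_assoc, smul_mul_assoc,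
      mul_assoc, mul_assoc, mul_assoc]
  have hσγ : σ * majorana (snd n) = (s * Complex.I) • (σ * majorana (fst n)) := by
    rw [hσ, mul_assoc, hPsnd, mul_smul_comm, mul_assoc _ P]
  intro j
  by_cases hj : j ∈ restIndices n
  · have h2 := hcomp j
    rw [hLk j hj, hRk j hj, h0, h1] at h2
    rw [h2, sum_eq_rest]
    have h3 : measuredMatrix (outcomeSign b) M j (fst n) = 0 := by
      simp [measuredMatrix, fst_notMem_rest, (mem_restIndices.mp hj).1, (mem_restIndices.mp hj).2]
    have h4 : measuredMatrix (outcomeSign b) M j (snd n) = 0 := by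
      simp [measuredMatrix, snd_notMem_rest, (mem_restIndices.mp hj).1, (mem_restIndices.mp hj).2]
    have h5 : ∑ k ∈ restIndices n, (measuredMatrix (outcomeSign b) M j k : ℂ) •
        (majorana k * σ + σ * majorana k) = R j + ((s / q * M j (fst n)) • R (snd n) -
          (s / q * M j (snd n)) • R (fst n)) := by
      simp only [R, Finset.smul_sum, ← Finset.sum_sub_distrib, ← Finset.sum_add_distrib, smul_smul,
        ← sub_smul, ← add_smul]
      refine Finset.sum_congr rfl fun k hk => ?_
      rw [hZk k hk, measuredMatrix_rest _ _ hj hk]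
      congr 1
      rw [hqdef, hs]
      push_cast
      ring
    rw [h5, h3, h4, Complex.ofReal_zero, zero_smul, zero_smul, zero_add, zero_add]
    linear_combination (norm := module)
      (Complex.I * M j (snd n) * s / q) • Complex.I_mul_I • R (fst n)
  · have h2 : j = fst n ∨ j = snd n := by
      rw [mem_restIndices] at hj
      tauto
    rcases h2 with rfl | rfl
    · simp only [measuredMatrix_fst, apply_ite Complex.ofReal, Complex.ofReal_zero, ite_smul,
        zero_smul, Finset.sum_ite_eq', Finset.mem_univ, if_true]
      rw [hγσ, hσγ]
      have h3 : Complex.I * s * (s * Complex.I) = -1 := by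
        linear_combination Complex.I * Complex.I * hss + Complex.I_mul_I
      linear_combination (norm := module) h3 • (majorana (fst n) * σ - σ * majorana (fst n))
    · simp only [measuredMatrix_snd, apply_ite Complex.ofReal, Complex.ofReal_zero, ite_smul,
        zero_smul, Finset.sum_ite_eq', Finset.mem_univ, if_true]
      rw [hγσ, hσγ]
      push_cast
      module

end MeasurementLemmas

/-! ### The entropy change in the measurement -/

section PostMeasurement

variable {n : ℕ}

/-- The matrix `1 + M²`. -/
def defect (M : Matrix (Fin (2 * n)) (Fin (2 * n)) ℝ) : Matrix (Fin (2 * n)) (Fin (2 * n)) ℝ :=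
  1 + M * M

/-- The principal `2 × 2` minor of a symmetric matrix on the indices `j` and `k`. -/
def minor (N : Matrix (Fin (2 * n)) (Fin (2 * n)) ℝ) (j k : Fin (2 * n)) : ℝ :=
  N j j * N k k - N j k ^ 2

/-- The correlation matrices of states: real antisymmetric contractions. -/
structure IsCorr (M : Matrix (Fin (2 * n)) (Fin (2 * n)) ℝ) : Prop where
  transpose : Mᵀ = -M
  posSemidef : (defect M).PosSemidef

namespace IsCorr

variable {M : Matrix (Fin (2 * n)) (Fin (2 * n)) ℝ}

theorem apply_swap (hM : IsCorr M) (j k : Fin (2 * n)) : M k j = -M j k :=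
  congrFun (congrFun hM.transpose j) k

theorem apply_self (hM : IsCorr M) (j : Fin (2 * n)) : M j j = 0 :=
  self_eq_neg.mp (hM.apply_swap j j)

theorem defect_apply (hM : IsCorr M) (j k : Fin (2 * n)) :
    defect M j k = (if j = k then 1 else 0) - ∑ l, M j l * M k l := by
  rw [defect, Matrix.add_apply, Matrix.one_apply, Matrix.mul_apply, sub_eq_add_neg,
    ← Finset.sum_neg_distrib]
  congr 1
  exact Finset.sum_congr rfl fun l _ => by rw [hM.apply_swap k l]; ring

theorem defect_swap (hM : IsCorr M) (j k : Fin (2 * n)) : defect M k j = defect M j k := by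
  rw [hM.defect_apply, hM.defect_apply]
  simp only [eq_comm, mul_comm]

theorem defect_self_nonneg (hM : IsCorr M) (j : Fin (2 * n)) : 0 ≤ defect M j j :=
  hM.posSemidef.diag_nonneg

theorem defect_self (hM : IsCorr M) (j : Fin (2 * n)) : defect M j j = 1 - ∑ l, M j l ^ 2 := by
  rw [hM.defect_apply, if_pos rfl]
  simp only [sq]

theorem defect_self_le (hM : IsCorr M) (j k : Fin (2 * n)) :
    defect M j j ≤ 1 - M j k ^ 2 := by
  rw [hM.defect_self]
  have : M j k ^ 2 ≤ ∑ l, M j l ^ 2 :=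
    Finset.single_le_sum (f := fun l => M j l ^ 2) (fun l _ => sq_nonneg _) (Finset.mem_univ k)
  linarith

theorem sq_le_one (hM : IsCorr M) (j k : Fin (2 * n)) : M j k ^ 2 ≤ 1 := by
  have h1 := hM.defect_self_nonneg j
  have h2 := hM.defect_self_le j k
  linarith

theorem minor_nonneg (hM : IsCorr M) (j k : Fin (2 * n)) : 0 ≤ minor (defect M) j k := by
  have h := (hM.posSemidef.submatrix ![j, k]).det_nonneg
  rw [Matrix.det_fin_two] at h
  simp only [Matrix.submatrix_apply, Matrix.cons_val_zero, Matrix.cons_val_one] at h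
  rw [hM.defect_swap j k] at h
  rw [minor]
  linarith

theorem minor_le (hM : IsCorr M) (j k : Fin (2 * n)) :
    minor (defect M) j k ≤ (1 - M j k ^ 2) ^ 2 := by
  have h1 := hM.defect_self_nonneg j
  have h2 := hM.defect_self_le j k
  have h3 := hM.defect_self_nonneg k
  have h4 := hM.defect_self_le k j
  rw [hM.apply_swap j k, neg_sq] at h4
  have := mul_le_mul h2 h4 h3 (h1.trans h2)
  rw [minor]
  nlinarith [sq_nonneg (defect M j k)]

end IsCorr

theorem IsGaussian.isCorr {ρ : FockOp n} (h : IsGaussian ρ) : IsCorr (corrMatrix ρ) :=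
  ⟨h.transpose_corrMatrix, h.posSemidef_one_add⟩

theorem trace_mul_self_of_transpose {M : Matrix (Fin (2 * n)) (Fin (2 * n)) ℝ} (hM : Mᵀ = -M) :
    (M * M).trace = -∑ j, ∑ k, M j k ^ 2 := by
  have hM' : ∀ a b, M b a = -M a b := fun a b => congrFun (congrFun hM a) b
  rw [Matrix.trace, ← Finset.sum_neg_distrib]
  refine Finset.sum_congr rfl fun j _ => ?_
  rw [Matrix.diag_apply, Matrix.mul_apply, ← Finset.sum_neg_distrib]
  exact Finset.sum_congr rfl fun k _ => by rw [hM' j k]; ring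

theorem IsGaussian.proxyEntropy_eq {ρ : FockOp n} (h : IsGaussian ρ) :
    proxyEntropy ρ = Real.log 2 * (n - (∑ j, ∑ k, corrMatrix ρ j k ^ 2) / 2) := by
  rw [proxyEntropy, trace_mul_self_of_transpose h.transpose_corrMatrix]
  ring

/-- Lagrange's identity. -/
theorem sum_cross_sq {ι : Type*} (t : Finset ι) (a b : ι → ℝ) :
    ∑ j ∈ t, ∑ k ∈ t, (b j * a k - a j * b k) ^ 2 =
      2 * ((∑ k ∈ t, a k ^ 2) * ∑ k ∈ t, b k ^ 2) - 2 * (∑ k ∈ t, a k * b k) ^ 2 := by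
  have : ∀ j k, (b j * a k - a j * b k) ^ 2 =
      b j ^ 2 * a k ^ 2 + a j ^ 2 * b k ^ 2 - 2 * ((a j * b j) * (a k * b k)) := fun j k => by ring
  simp only [this, Finset.sum_sub_distrib, Finset.sum_add_distrib, ← Finset.mul_sum,
    ← Finset.sum_mul]
  ring

variable [NeZero n]

theorem IsGaussian.outcomeProb_eq {ρ : FockOp n} (h : IsGaussian ρ) (b : Bool) :
    outcomeProb b ρ = (1 + outcomeSign b * corrMatrix ρ (fst n) (snd n)) / 2 :=
  FreeFermion.outcomeProb_eq h.gaussianEq h.2.1 b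

theorem IsGaussian.outcomeProb_nonneg {ρ : FockOp n} (h : IsGaussian ρ) (b : Bool) :
    0 ≤ outcomeProb b ρ := by
  rw [h.outcomeProb_eq]
  have := abs_le.mp ((sq_le_one_iff_abs_le_one _).mp (h.isCorr.sq_le_one (fst n) (snd n)))
  cases b <;> simp [outcomeSign] <;> linarith

theorem IsGaussian.sum_outcomeProb {ρ : FockOp n} (h : IsGaussian ρ) :
    ∑ b, outcomeProb b ρ = 1 := by
  rw [Fintype.sum_bool, h.outcomeProb_eq, h.outcomeProb_eq]
  simp only [outcomeSign, if_true, Bool.false_eq_true, if_false]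
  ring

theorem postState_gaussianEq {ρ : FockOp n} (h : IsGaussian ρ) {b : Bool}
    (hb : outcomeProb b ρ ≠ 0) :
    GaussianEq (measuredMatrix (outcomeSign b) (corrMatrix ρ)) (postState b ρ) := by
  refine (h.gaussianEq.measure h.transpose_corrMatrix b fun h0 => hb ?_).smul _
  rw [h.outcomeProb_eq, h0, zero_div]

theorem postState_trace {ρ : FockOp n} (h : IsGaussian ρ) {b : Bool}
    (hb : outcomeProb b ρ ≠ 0) : (postState b ρ).trace = 1 := by
  rw [postState, Matrix.trace_smul, mul_assoc, Matrix.trace_mul_comm, mul_assoc,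
    outcomeProj_mul_self, Matrix.trace_mul_comm, trace_outcomeProj_mul h.gaussianEq h.2.1,
    ← h.outcomeProb_eq, smul_eq_mul, inv_mul_cancel₀]
  exact_mod_cast hb

theorem IsGaussian.postState {ρ : FockOp n} (h : IsGaussian ρ) {b : Bool}
    (hb : outcomeProb b ρ ≠ 0) : IsGaussian (postState b ρ) := by
  refine (isGaussian_iff _).mpr ⟨?_, postState_trace h hb, ?_, _,
    measuredMatrix_transpose _ h.transpose_corrMatrix, postState_gaussianEq h hb⟩
  · have h1 : (outcomeProj b * ρ * outcomeProj b).PosSemidef := by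
      have := h.1.mul_mul_conjTranspose_same (outcomeProj b)
      rwa [outcomeProj_conjTranspose] at this
    refine h1.smul ?_
    rw [← Complex.ofReal_inv]
    exact_mod_cast inv_nonneg.mpr (h.outcomeProb_nonneg b)
  · have h1 := ((isGaussian_iff ρ).mp h).2.2.1
    rw [FreeFermion.postState, smul_mul_assoc, mul_smul_comm, mul_assoc, outcomeProj_parity,
      ← mul_assoc, mul_assoc _ ρ, h1, ← mul_assoc, outcomeProj_parity]
    simp only [mul_assoc]

theorem IsGaussian.corrMatrix_postState {ρ : FockOp n} (h : IsGaussian ρ) {b : Bool}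
    (hb : outcomeProb b ρ ≠ 0) :
    corrMatrix (FreeFermion.postState b ρ) = measuredMatrix (outcomeSign b) (corrMatrix ρ) :=
  (postState_gaussianEq h hb).corrMatrix_eq (postState_trace h hb)

theorem sum_sum_eq_rest (f : Fin (2 * n) → Fin (2 * n) → ℝ) (hf : ∀ j k, f j k = f k j)
    (hf0 : ∀ j, f j j = 0) :
    ∑ j, ∑ k, f j k = 2 * f (fst n) (snd n) + 2 * ∑ k ∈ restIndices n, f (fst n) k +
      2 * ∑ k ∈ restIndices n, f (snd n) k +
      ∑ j ∈ restIndices n, ∑ k ∈ restIndices n, f j k := by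
  rw [sum_eq_rest]
  simp only [sum_eq_rest (fun k => f _ k), Finset.sum_add_distrib, hf0]
  rw [hf (snd n) (fst n), Finset.sum_congr rfl fun j _ => hf j (fst n),
    Finset.sum_congr rfl fun j _ => hf j (snd n)]
  ring

/-- The entropy change is minus the `2 × 2` minor of `1 + M²`, divided by `1 - M₁₂²`; both sides
vanish when `M₁₂² = 1`, where the quotient is zero by convention. -/
theorem IsGaussian.entropyChange_eq {ρ : FockOp n} (h : IsGaussian ρ) :
    entropyChange ρ = -(Real.log 2 * (minor (defect (corrMatrix ρ)) (fst n) (snd n) /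
      (1 - corrMatrix ρ (fst n) (snd n) ^ 2))) := by
  have hC := h.isCorr
  have hS := h.proxyEntropy_eq
  have hp := fun b => h.outcomeProb_eq b
  have hpost : ∀ b, outcomeProb b ρ ≠ 0 → proxyEntropy (FreeFermion.postState b ρ) =
      Real.log 2 * (n - (∑ j, ∑ k, measuredMatrix (outcomeSign b) (corrMatrix ρ) j k ^ 2) / 2) := by
    intro b hb
    rw [(h.postState hb).proxyEntropy_eq, h.corrMatrix_postState hb]
  -- `α`, `A`, `B`, `C` come from the first two rows of `M`, `R` and `W` from the remaining block and
  -- its change in the measurement.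
  set M := corrMatrix ρ with hMdef
  set α := M (fst n) (snd n) with hα
  set A := ∑ k ∈ restIndices n, M (fst n) k ^ 2 with hA
  set B := ∑ k ∈ restIndices n, M (snd n) k ^ 2 with hB
  set C := ∑ k ∈ restIndices n, M (fst n) k * M (snd n) k with hCd
  set R := ∑ j ∈ restIndices n, ∑ k ∈ restIndices n, M j k ^ 2 with hR
  set W := ∑ j ∈ restIndices n, ∑ k ∈ restIndices n,
    M j k * (M (snd n) j * M (fst n) k - M (fst n) j * M (snd n) k) with hW
  have hF : ∑ j, ∑ k, M j k ^ 2 = 2 * α ^ 2 + 2 * A + 2 * B + R :=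
    sum_sum_eq_rest (fun j k => M j k ^ 2) (fun j k => by rw [hC.apply_swap k j, neg_sq])
      (fun j => by rw [hC.apply_self, zero_pow two_ne_zero])
  have hF' : ∀ s : ℝ, s * s = 1 → ∑ j, ∑ k, measuredMatrix s M j k ^ 2 =
      2 + R + 2 * s * W / (1 + s * α) + 2 * (A * B - C ^ 2) / (1 + s * α) ^ 2 := by
    intro s hs
    have hT := measuredMatrix_transpose s hC.transpose
    have hT' : ∀ a b, measuredMatrix s M b a = -measuredMatrix s M a b :=
      fun a b => congrFun (congrFun hT a) b
    rw [sum_sum_eq_rest (fun j k => measuredMatrix s M j k ^ 2)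
      (fun j k => by rw [hT' k j, neg_sq])
      (fun j => by rw [self_eq_neg.mp (hT' j j), zero_pow two_ne_zero])]
    have e1 : ∑ k ∈ restIndices n, measuredMatrix s M (fst n) k ^ 2 = 0 :=
      Finset.sum_eq_zero fun k hk => by
        rw [measuredMatrix_fst, if_neg (mem_restIndices.mp hk).2, zero_pow two_ne_zero]
    have e2 : ∑ k ∈ restIndices n, measuredMatrix s M (snd n) k ^ 2 = 0 :=
      Finset.sum_eq_zero fun k hk => by
        rw [measuredMatrix_snd, if_neg (mem_restIndices.mp hk).1, zero_pow two_ne_zero]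
    have e3 : ∑ j ∈ restIndices n, ∑ k ∈ restIndices n, measuredMatrix s M j k ^ 2 =
        R + 2 * s / (1 + s * α) * W + 1 / (1 + s * α) ^ 2 * (2 * (A * B) - 2 * C ^ 2) := by
      rw [← sum_cross_sq, hR, hW]
      simp only [Finset.mul_sum, ← Finset.sum_add_distrib]
      refine Finset.sum_congr rfl fun j hj => Finset.sum_congr rfl fun k hk => ?_
      rw [measuredMatrix_rest s M hj hk, hC.apply_swap (fst n) j, hC.apply_swap (snd n) j]
      have : s * s / (1 + s * α) ^ 2 = 1 / (1 + s * α) ^ 2 := by rw [hs]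
      rw [← hα]
      generalize 1 + s * α = q at this ⊢
      linear_combination (M (snd n) j * M (fst n) k - M (fst n) j * M (snd n) k) ^ 2 * this
    rw [e1, e2, e3, measuredMatrix_fst, if_pos rfl]
    linear_combination 2 * hs
  have h00 : defect M (fst n) (fst n) = 1 - α ^ 2 - A := by
    rw [hC.defect_self, sum_eq_rest, hC.apply_self]
    ring
  have h11 : defect M (snd n) (snd n) = 1 - α ^ 2 - B := by
    rw [hC.defect_self, sum_eq_rest, hC.apply_self, hC.apply_swap (fst n) (snd n)]
    ring
  have h01 : defect M (fst n) (snd n) = -C := by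
    rw [hC.defect_apply, sum_eq_rest, hC.apply_self, hC.apply_self, if_neg fst_ne_snd]
    ring
  have hα1 := hC.sq_le_one (fst n) (snd n)
  rw [← hα] at hα1
  rw [minor, h00, h11, h01, entropyChange, Fintype.sum_bool]
  rw [hS, hF]
  by_cases hα2 : α ^ 2 = 1
  · -- The outcome is certain, and the first two rows of `M` vanish outside of their own block.
    have hA0 : A = 0 := by
      have h1 := hC.defect_self_nonneg (fst n)
      have h2 : 0 ≤ A := Finset.sum_nonneg fun k _ => sq_nonneg _
      linarith
    have hB0 : B = 0 := by
      have h1 := hC.defect_self_nonneg (snd n)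
      have h2 : 0 ≤ B := Finset.sum_nonneg fun k _ => sq_nonneg _
      linarith
    have ha0 : ∀ k ∈ restIndices n, M (fst n) k = 0 := fun k hk =>
      pow_eq_zero_iff two_ne_zero |>.mp
        ((Finset.sum_eq_zero_iff_of_nonneg fun k _ => sq_nonneg _).mp hA0 k hk)
    have hb0 : ∀ k ∈ restIndices n, M (snd n) k = 0 := fun k hk =>
      pow_eq_zero_iff two_ne_zero |>.mp
        ((Finset.sum_eq_zero_iff_of_nonneg fun k _ => sq_nonneg _).mp hB0 k hk)
    have hC0 : C = 0 := Finset.sum_eq_zero fun k hk => by rw [ha0 k hk, zero_mul]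
    have hW0 : W = 0 := Finset.sum_eq_zero fun j hj => Finset.sum_eq_zero fun k hk => by
      rw [ha0 k hk, hb0 k hk]; ring
    rw [hα2, sub_self, div_zero, mul_zero, neg_zero, hA0, hB0]
    have key : ∀ b, outcomeProb b ρ * proxyEntropy (FreeFermion.postState b ρ) =
        outcomeProb b ρ * (Real.log 2 * (n - (2 + R) / 2)) := by
      intro b
      by_cases hb : outcomeProb b ρ = 0
      · rw [hb, zero_mul, zero_mul]
      · rw [hpost b hb, hF' _ (outcomeSign_mul_self b), hW0, hA0, hB0, hC0]
        simp
    rw [key, key, ← add_mul]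
    have := h.sum_outcomeProb
    rw [Fintype.sum_bool] at this
    rw [this]
    ring
  · have h1 : (1 + α) ≠ 0 := fun h => hα2 (by nlinarith)
    have h2 : (1 - α) ≠ 0 := fun h => hα2 (by nlinarith)
    have hpt : outcomeProb true ρ = (1 + α) / 2 := by rw [hp]; simp [outcomeSign]
    have hpf : outcomeProb false ρ = (1 - α) / 2 := by rw [hp]; simp [outcomeSign, sub_eq_add_neg]
    rw [hpost true (by rw [hpt]; exact div_ne_zero h1 two_ne_zero),
      hpost false (by rw [hpf]; exact div_ne_zero h2 two_ne_zero), hpt, hpf,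
      hF' _ (outcomeSign_mul_self true), hF' _ (outcomeSign_mul_self false)]
    have h3 : 1 - α ^ 2 = (1 + α) * (1 - α) := by ring
    have e1 : 1 + outcomeSign true * α = 1 + α := by simp [outcomeSign]
    have e2 : 1 + outcomeSign false * α = 1 - α := by simp [outcomeSign, sub_eq_add_neg]
    rw [e1, e2, h3]
    simp only [outcomeSign, if_true, Bool.false_eq_true, if_false]
    field_simp
    ring

theorem IsGaussian.entropyChange_nonpos {ρ : FockOp n} (h : IsGaussian ρ) :
    entropyChange ρ ≤ 0 := by
  rw [h.entropyChange_eq, neg_nonpos]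
  exact mul_nonneg (Real.log_nonneg one_le_two) (div_nonneg (h.isCorr.minor_nonneg _ _)
    (sub_nonneg.mpr (h.isCorr.sq_le_one _ _)))

theorem det_upperLeftBlock {M : Matrix (Fin (2 * n)) (Fin (2 * n)) ℝ} (hM : IsCorr M) :
    (upperLeftBlock (firstTwoProj n * (1 + M * M) * firstTwoProj n)).det =
      minor (defect M) (fst n) (snd n) := by
  have h : ∀ j k : Fin (2 * n), j.1 < 2 → k.1 < 2 →
      (firstTwoProj n * (1 + M * M) * firstTwoProj n) j k = defect M j k := by
    intro j k hj hk
    rw [firstTwoProj, Matrix.mul_diagonal, Matrix.diagonal_mul, if_pos hj, if_pos hk, one_mul,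
      mul_one, defect]
  have h0 : (fst n).1 < 2 := by simp [fst]
  have h1 : (snd n).1 < 2 := by simp [snd]
  rw [Matrix.det_fin_two]
  simp only [upperLeftBlock, Matrix.submatrix_apply, Matrix.cons_val_zero, Matrix.cons_val_one]
  rw [h _ _ h0 h0, h _ _ h0 h1, h _ _ h1 h0, h _ _ h1 h1, hM.defect_swap (fst n) (snd n), minor]
  ring

end PostMeasurement

/-! ### Purity -/

section Purity

variable {n : ℕ}

/-- The trace of the Gram matrix of the derivatives is the expectation of the number operator. -/
theorem sum_norm_sq_lower {m : ℕ} (c : Finset (Fin m) → ℂ) :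
    ∑ j, ∑ S, ‖lower j c S‖ ^ 2 = ∑ S, (S.card : ℝ) * ‖c S‖ ^ 2 := by
  have h : ∀ j, ∑ S, ‖lower j c S‖ ^ 2 = ∑ S, if j ∈ S then ‖c S‖ ^ 2 else 0 := by
    intro j
    rw [← sum_toggle j]
    refine Finset.sum_congr rfl fun S _ => ?_
    rw [lower_apply, toggle_toggle]
    have h1 : ‖sgn j (toggle j S)‖ = 1 := by
      have := congrArg norm (sgn_mul_self j (toggle j S))
      rw [norm_mul, norm_one] at this
      nlinarith [norm_nonneg (sgn j (toggle j S))]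
    by_cases hj : j ∈ S <;> simp [hj, h1, mem_toggle_self]
  simp only [h]
  rw [Finset.sum_comm]
  refine Finset.sum_congr rfl fun S _ => ?_
  rw [Finset.sum_ite_mem, Finset.univ_inter, Finset.sum_const, nsmul_eq_mul]

/-- The Gram matrices of the multiples `θ_j c` and of the derivatives `∂_j c` add up to a multiple of
the identity. -/
theorem sum_star_raise_raise {m : ℕ} (j k : Fin m) (c : Finset (Fin m) → ℂ) :
    ∑ S, star (raise j c S) * raise k c S =
      (if j = k then ∑ S, star (c S) * c S else 0) - ∑ S, star (lower k c S) * lower j c S := by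
  rw [sum_star_raise_mul, lower_raise]
  have h : ∑ S, star (c S) * raise k (lower j c) S = ∑ S, star (lower k c S) * lower j c S := by
    have := congrArg star (sum_star_raise_mul k (lower j c) c)
    simp only [star_sum, star_mul', star_star] at this
    simpa only [mul_comm] using this
  rw [← h]
  split_ifs with hjk
  · rw [← Finset.sum_sub_distrib]
    exact Finset.sum_congr rfl fun S _ => by rw [Pi.sub_apply, mul_sub]
  · rw [zero_sub, zero_sub, ← Finset.sum_neg_distrib]
    exact Finset.sum_congr rfl fun S _ => by rw [Pi.neg_apply, mul_neg]

theorem re_sum_posSemidef_nonneg {ι : Type*} [Fintype ι] {N : Matrix ι ι ℝ} (hN : N.PosSemidef)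
    (v : ι → ℂ) : 0 ≤ (∑ k, ∑ l, (N k l : ℂ) * (star (v l) * v k)).re := by
  have h : ∀ x : ι → ℝ, 0 ≤ ∑ k, ∑ l, x k * (N k l * x l) := by
    intro x
    have := hN.dotProduct_mulVec_nonneg x
    simp only [dotProduct, Matrix.mulVec, Finset.mul_sum] at this
    exact this
  have h1 := h fun k => (v k).re
  have h2 := h fun k => (v k).im
  have : (∑ k, ∑ l, (N k l : ℂ) * (star (v l) * v k)).re =
      ∑ k, ∑ l, (v k).re * (N k l * (v l).re) + ∑ k, ∑ l, (v k).im * (N k l * (v l).im) := by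
    simp only [Complex.re_sum, ← Finset.sum_add_distrib]
    refine Finset.sum_congr rfl fun k _ => Finset.sum_congr rfl fun l _ => ?_
    rw [Complex.re_ofReal_mul]
    simp only [Complex.star_def, Complex.mul_re, Complex.conj_re, Complex.conj_im]
    ring
  rw [this]
  exact add_nonneg h1 h2

/-- The Gram matrix `G` of the derivatives of `c` satisfies `G = s² M (P - Gᵀ) Mᵀ` with `P = |c|²`;
taking the trace bounds `tr G` from below, since `M` is a contraction. -/
theorem sum_norm_sq_lower_ge {M : Matrix (Fin (2 * n)) (Fin (2 * n)) ℝ} (hM : IsCorr M)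
    {s : ℝ} {c : Finset (Fin (2 * n)) → ℂ} (hc : CoeffEq (s • M) c) :
    s ^ 2 * ((∑ j, ∑ k, M j k ^ 2) * ∑ S, ‖c S‖ ^ 2) ≤
      (1 + s ^ 2) * ∑ j, ∑ S, ‖lower j c S‖ ^ 2 := by
  have hnorm : ∀ z : ℂ, ‖z‖ ^ 2 = (star z * z).re := by
    intro z
    rw [Complex.star_def, ← Complex.normSq_eq_conj_mul_self, Complex.ofReal_re,
      Complex.normSq_eq_norm_sq]
  -- the trace of the equation for the Gram matrix
  have h1 : ∑ j, ∑ S, star (lower j c S) * lower j c S =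
      (s : ℂ) ^ 2 * ((∑ j, ∑ k, (M j k : ℂ) ^ 2) * ∑ S, star (c S) * c S -
        ∑ k, ∑ l, (∑ j, (M j k : ℂ) * M j l) * ∑ S, star (lower l c S) * lower k c S) := by
    have h2 : ∀ j, ∑ S, star (lower j c S) * lower j c S =
        (s : ℂ) ^ 2 * ∑ k, ∑ l, (M j k : ℂ) * M j l * ∑ S, star (raise k c S) * raise l c S := by
      intro j
      have hl : ∀ S, lower j c S = ∑ k, (Complex.I * s * M j k) * raise k c S := by
        intro S
        simp only [hc j, Pi.smul_apply, Finset.sum_apply, smul_eq_mul, Matrix.smul_apply,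
          Finset.mul_sum]
        exact Finset.sum_congr rfl fun k _ => by push_cast; ring
      have hll : ∀ S, star (lower j c S) * lower j c S = ∑ k, ∑ l,
          ((s : ℂ) ^ 2 * M j k * M j l) * (star (raise k c S) * raise l c S) := by
        intro S
        rw [hl, star_sum, Finset.sum_mul_sum]
        refine Finset.sum_congr rfl fun k _ => Finset.sum_congr rfl fun l _ => ?_
        simp only [star_mul', Complex.star_def, Complex.conj_I, Complex.conj_ofReal]
        linear_combination -((s : ℂ) ^ 2 * M j k * M j l * (starRingEnd ℂ) (raise k c S) *
          raise l c S) * Complex.I_mul_I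
      simp only [hll]
      rw [Finset.sum_comm, Finset.mul_sum]
      refine Finset.sum_congr rfl fun k _ => ?_
      rw [Finset.sum_comm, Finset.mul_sum]
      refine Finset.sum_congr rfl fun l _ => ?_
      rw [← Finset.mul_sum]
      ring
    simp only [h2, sum_star_raise_raise, ← Finset.mul_sum]
    congr 1
    simp only [mul_sub, mul_ite, mul_zero, Finset.sum_sub_distrib, Finset.sum_ite_eq,
      Finset.mem_univ, if_true]
    congr 1
    · rw [Finset.sum_mul]
      refine Finset.sum_congr rfl fun j _ => ?_
      rw [Finset.sum_mul]
      exact Finset.sum_congr rfl fun k _ => by ring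
    · rw [Finset.sum_comm]
      refine Finset.sum_congr rfl fun k _ => ?_
      rw [Finset.sum_comm]
      exact Finset.sum_congr rfl fun l _ => by rw [Finset.sum_mul]
  have h3 : ∀ k l, (∑ j, (M j k : ℂ) * M j l) =
      ((if k = l then 1 else 0 : ℝ) : ℂ) - ((defect M k l : ℝ) : ℂ) := by
    intro k l
    rw [hM.defect_apply]
    push_cast
    rw [sub_sub_cancel]
    exact Finset.sum_congr rfl fun j _ => by
      rw [hM.apply_swap k j, hM.apply_swap l j]; push_cast; ring
  have h4 : 0 ≤ (∑ S, ∑ k, ∑ l, (defect M k l : ℂ) *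
      (star (lower l c S) * lower k c S)).re := by
    rw [Complex.re_sum]
    exact Finset.sum_nonneg fun S _ =>
      re_sum_posSemidef_nonneg hM.posSemidef fun k => lower k c S
  have h5 : ∑ k, ∑ l, (∑ j, (M j k : ℂ) * M j l) * ∑ S, star (lower l c S) * lower k c S =
      ∑ j, ∑ S, star (lower j c S) * lower j c S -
        ∑ S, ∑ k, ∑ l, (defect M k l : ℂ) * (star (lower l c S) * lower k c S) := by
    simp only [h3, sub_mul, Finset.sum_sub_distrib]
    congr 1
    · refine Finset.sum_congr rfl fun k _ => ?_
      rw [Finset.sum_eq_single k]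
      · simp
      · intro l _ hl
        rw [if_neg hl.symm, Complex.ofReal_zero, zero_mul]
      · simp
    · rw [Finset.sum_comm (s := (Finset.univ : Finset (Finset (Fin (2 * n)))))]
      refine Finset.sum_congr rfl fun k _ => ?_
      rw [Finset.sum_comm (s := (Finset.univ : Finset (Finset (Fin (2 * n)))))]
      exact Finset.sum_congr rfl fun l _ => by rw [Finset.mul_sum]
  rw [h5] at h1
  have h6 := congrArg Complex.re h1
  have hs : ((s : ℂ) ^ 2) = ((s ^ 2 : ℝ) : ℂ) := by push_cast; rfl
  have hK : (∑ j, ∑ k, (M j k : ℂ) ^ 2) = ((∑ j, ∑ k, M j k ^ 2 : ℝ) : ℂ) := by push_cast; rfl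
  rw [hs, hK, Complex.re_ofReal_mul, Complex.sub_re, Complex.sub_re, Complex.re_ofReal_mul] at h6
  simp only [hnorm, ← Complex.re_sum]
  nlinarith [sq_nonneg s, mul_nonneg (sq_nonneg s) h4]

/-- Rescaling the generators by `r` maps solutions for `M` to solutions for `r² M`. -/
theorem CoeffEq.scale {M : Matrix (Fin (2 * n)) (Fin (2 * n)) ℝ}
    {c : Finset (Fin (2 * n)) → ℂ} (hc : CoeffEq M c) (r : ℝ) :
    CoeffEq (r ^ 2 • M) fun S => (r : ℂ) ^ S.card * c S := by
  have hl : ∀ j S, lower j (fun S => (r : ℂ) ^ S.card * c S) S =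
      (r : ℂ) ^ (S.card + 1) * lower j c S := by
    intro j S
    rw [lower_apply, lower_apply]
    split_ifs with h
    · rw [mul_zero]
    · rw [toggle_of_notMem h, Finset.card_insert_of_notMem h]; ring
  have hr : ∀ j S, (r : ℂ) ^ 2 * raise j (fun S => (r : ℂ) ^ S.card * c S) S =
      (r : ℂ) ^ (S.card + 1) * raise j c S := by
    intro j S
    rw [raise_apply, raise_apply]
    split_ifs with h
    · rw [toggle_of_mem h, ← Finset.card_erase_add_one h]; ring
    · rw [mul_zero, mul_zero]
  intro j
  funext S
  have := congrFun (hc j) S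
  rw [hl, this]
  simp only [Pi.smul_apply, Finset.sum_apply, smul_eq_mul, Matrix.smul_apply, Finset.mul_sum]
  refine Finset.sum_congr rfl fun k _ => ?_
  push_cast
  linear_combination -(Complex.I * M j k) * hr k S

/-- The squared norm of the coefficients of a Gaussian state with correlation matrix `M` is at least
`2 ^ (|M|² / 2)` times the square of the constant coefficient. Its logarithmic derivative along the
states with correlation matrices `r² M`, `0 ≤ r ≤ 1`, is bounded by `sum_norm_sq_lower_ge`. -/
theorem CoeffEq.log_sum_norm_sq_ge {M : Matrix (Fin (2 * n)) (Fin (2 * n)) ℝ} (hM : IsCorr M)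
    {c : Finset (Fin (2 * n)) → ℂ} (hc : CoeffEq M c) (h0 : c ∅ ≠ 0) :
    Real.log (‖c ∅‖ ^ 2) + (∑ j, ∑ k, M j k ^ 2) / 2 * Real.log 2 ≤
      Real.log (∑ S, ‖c S‖ ^ 2) := by
  set K := ∑ j, ∑ k, M j k ^ 2 with hK
  let P : ℝ → ℝ := fun r => ∑ S : Finset (Fin (2 * n)), r ^ (2 * S.card) * ‖c S‖ ^ 2
  let P' : ℝ → ℝ := fun r =>
    ∑ S : Finset (Fin (2 * n)), ((2 * S.card : ℕ) : ℝ) * r ^ (2 * S.card - 1) * ‖c S‖ ^ 2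
  have hP : ∀ r, HasDerivAt P (P' r) r := by
    intro r
    exact HasDerivAt.fun_sum fun S _ => (hasDerivAt_pow (2 * S.card) r).mul_const _
  have hPpos : ∀ r, 0 < P r := by
    intro r
    have h1 : ‖c ∅‖ ^ 2 ≤ P r := by
      have := Finset.single_le_sum (f := fun S : Finset (Fin (2 * n)) =>
        r ^ (2 * S.card) * ‖c S‖ ^ 2)
        (fun S _ => mul_nonneg (by rw [pow_mul]; positivity) (sq_nonneg _)) (Finset.mem_univ ∅)
      simpa using this
    exact lt_of_lt_of_le (by positivity) h1
  have hineq : ∀ r, 0 < r → 2 * r ^ 3 * K * P r ≤ (1 + r ^ 4) * P' r := by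
    intro r hr
    have h1 := sum_norm_sq_lower_ge hM (hc.scale r)
    rw [sum_norm_sq_lower] at h1
    have h2 : ∀ S : Finset (Fin (2 * n)), ‖(r : ℂ) ^ S.card * c S‖ ^ 2 =
        r ^ (2 * S.card) * ‖c S‖ ^ 2 := by
      intro S
      rw [norm_mul, norm_pow, Complex.norm_real, mul_pow, ← pow_mul, mul_comm S.card, pow_mul,
        Real.norm_eq_abs, sq_abs, ← pow_mul]
    simp only [h2] at h1
    have h3 : r * P' r =
        2 * ∑ S : Finset (Fin (2 * n)), (S.card : ℝ) * (r ^ (2 * S.card) * ‖c S‖ ^ 2) := by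
      simp only [P', Finset.mul_sum]
      refine Finset.sum_congr rfl fun S _ => ?_
      rcases Nat.eq_zero_or_pos S.card with h | h
      · simp [h]
      · have : r ^ (2 * S.card) = r * r ^ (2 * S.card - 1) := by
          rw [← pow_succ']; congr 1; omega
        rw [this]; push_cast; ring
    have h4 : r * (2 * r ^ 3 * K * P r) ≤ r * ((1 + r ^ 4) * P' r) := by
      have : r * ((1 + r ^ 4) * P' r) = (1 + r ^ 4) * (r * P' r) := by ring
      rw [this, h3]
      have h5 : P r = ∑ S : Finset (Fin (2 * n)), r ^ (2 * S.card) * ‖c S‖ ^ 2 := rfl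
      rw [← h5] at h1
      nlinarith [h1]
    exact le_of_mul_le_mul_left h4 hr
  let f : ℝ → ℝ := fun r => Real.log (P r) - K / 2 * Real.log (1 + r ^ 4)
  have hf : ∀ r, HasDerivAt f (P' r / P r - K / 2 * (((4 : ℕ) : ℝ) * r ^ 3 / (1 + r ^ 4))) r := by
    intro r
    have h1 : (1 + r ^ 4) ≠ 0 := by positivity
    exact ((hP r).log (hPpos r).ne').sub
      ((((hasDerivAt_pow 4 r).const_add 1).log h1).const_mul (K / 2))
  have hmono : MonotoneOn f (Set.Icc 0 1) := by
    refine monotoneOn_of_deriv_nonneg (convex_Icc 0 1)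
      (fun r _ => (hf r).continuousAt.continuousWithinAt)
      (fun r _ => (hf r).differentiableAt.differentiableWithinAt) fun r hr => ?_
    rw [interior_Icc] at hr
    rw [(hf r).deriv, sub_nonneg, ← mul_div_assoc, div_le_div_iff₀ (by positivity) (hPpos r)]
    have := hineq r hr.1
    push_cast
    linarith
  have h01 := hmono (Set.left_mem_Icc.mpr zero_le_one) (Set.right_mem_Icc.mpr zero_le_one)
    zero_le_one
  have hP0 : P 0 = ‖c ∅‖ ^ 2 := by
    simp only [P]
    rw [Finset.sum_eq_single ∅]
    · simp
    · intro S _ hS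
      have : 2 * S.card ≠ 0 := by simpa using hS
      rw [zero_pow this, zero_mul]
    · simp
  have hP1 : P 1 = ∑ S, ‖c S‖ ^ 2 := by simp [P]
  simp only [f, hP0, hP1] at h01
  norm_num at h01
  have h2 : Real.log (‖c ∅‖ ^ 2) = 2 * Real.log ‖c ∅‖ := by rw [Real.log_pow]; norm_num
  linarith

/-- Parseval's identity for the ordered products of Majorana operators. -/
theorem trace_conjTranspose_mul_self_eq (X : FockOp n) :
    (Xᴴ * X).trace = (2 : ℂ) ^ n * ((∑ S, ‖coeffs X S‖ ^ 2 : ℝ) : ℂ) := by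
  conv_lhs => rw [← sum_coeffs X]
  rw [Matrix.conjTranspose_sum, Finset.sum_mul_sum]
  simp only [Matrix.conjTranspose_smul, smul_mul_smul_comm, Matrix.trace_sum, Matrix.trace_smul,
    isMajoranaFamily_majorana.trace_orderedProd, smul_eq_mul, mul_ite, mul_zero, Finset.sum_ite_eq,
    Finset.mem_univ, if_true]
  push_cast
  rw [Finset.mul_sum]
  refine Finset.sum_congr rfl fun S _ => ?_
  rw [Complex.star_def, Complex.conj_mul']
  ring

/-- The purity of a Gaussian state is bounded by its proxy entropy. -/
theorem IsGaussian.exp_neg_proxyEntropy_le_purity {ρ : FockOp n} (h : IsGaussian ρ) :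
    Real.exp (-proxyEntropy ρ) ≤ purity ρ := by
  have heven := (isEven_coeffs_iff ρ).mpr ((isGaussian_iff ρ).mp h).2.2.1
  have hc := (gaussianEq_iff_coeffEq _ heven).mp h.gaussianEq
  have h0 : coeffs ρ ∅ = ((2 : ℂ) ^ n)⁻¹ := by rw [coeffs_empty, h.2.1, mul_one]
  have h0' : coeffs ρ ∅ ≠ 0 := by rw [h0]; positivity
  have h1 := hc.log_sum_norm_sq_ge h.isCorr h0'
  have hpur : purity ρ = 2 ^ n * ∑ S, ‖coeffs ρ S‖ ^ 2 := by
    have := trace_conjTranspose_mul_self_eq ρ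
    rw [h.1.isHermitian.eq] at this
    rw [purity, this]
    have h2 : ((2 : ℂ) ^ n) = ((2 ^ n : ℝ) : ℂ) := by push_cast; rfl
    rw [h2, ← Complex.ofReal_mul, Complex.ofReal_re]
  have hpos : 0 < ∑ S, ‖coeffs ρ S‖ ^ 2 := by
    refine lt_of_lt_of_le (b := ‖coeffs ρ ∅‖ ^ 2) (by positivity) ?_
    exact Finset.single_le_sum (f := fun S => ‖coeffs ρ S‖ ^ 2) (fun S _ => sq_nonneg _)
      (Finset.mem_univ ∅)
  rw [hpur, ← Real.exp_log (mul_pos (pow_pos two_pos n) hpos), Real.exp_le_exp,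
    Real.log_mul (by positivity) hpos.ne', Real.log_pow, h.proxyEntropy_eq]
  have h3 : Real.log (‖coeffs ρ ∅‖ ^ 2) = -(2 * n * Real.log 2) := by
    rw [h0, norm_inv, norm_pow, Real.log_pow, Real.log_inv, Real.log_pow]
    norm_num
    ring
  rw [h3] at h1
  linarith

/-- The entries of a positive semidefinite matrix satisfy `|ρ x y|² ≤ ρ x x ρ y y`. -/
theorem purity_le_one_of_posSemidef {ρ : FockOp n} (h : ρ.PosSemidef) (htr : ρ.trace = 1) :
    purity ρ ≤ 1 := by
  have hH : ∀ x y, ρ y x = star (ρ x y) := fun x y => (h.isHermitian.apply y x).symm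
  have hdiag : ∀ x, (ρ x x).im = 0 := by
    intro x
    have := congrArg Complex.im (hH x x)
    simp only [Complex.star_def, Complex.conj_im] at this
    linarith
  have hent : ∀ x y, (ρ x y * ρ y x).re ≤ (ρ x x).re * (ρ y y).re := by
    intro x y
    have h1 := (h.submatrix ![x, y]).det_nonneg
    rw [Matrix.det_fin_two] at h1
    simp only [Matrix.submatrix_apply, Matrix.cons_val_zero, Matrix.cons_val_one] at h1
    have h2 := (Complex.le_def.mp h1).1
    rw [Complex.sub_re, Complex.mul_re (ρ x x), hdiag x] at h2
    simp only [Complex.zero_re, zero_mul, sub_zero] at h2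
    linarith
  have htr' : ∑ x, (ρ x x).re = 1 := by
    have := congrArg Complex.re htr
    rwa [Matrix.trace, Complex.re_sum, Complex.one_re] at this
  calc purity ρ = ∑ x, ∑ y, (ρ x y * ρ y x).re := by
        simp only [purity, Matrix.trace, Matrix.diag_apply, Matrix.mul_apply, Complex.re_sum]
    _ ≤ ∑ x, ∑ y, (ρ x x).re * (ρ y y).re :=
        Finset.sum_le_sum fun x _ => Finset.sum_le_sum fun y _ => hent x y
    _ = 1 := by rw [← Finset.sum_mul_sum, htr', one_mul]

end Purity

/-! ### The Haar measure and plane rotations -/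

section Haar

instance instSecondCountableMatrix {ι κ α : Type*} [Countable ι] [Countable κ]
    [TopologicalSpace α] [SecondCountableTopology α] : SecondCountableTopology (Matrix ι κ α) :=
  inferInstanceAs (SecondCountableTopology (ι → κ → α))

instance instIsMulLeftInvariantHaarSO (n : ℕ) : (haarSO n).IsMulLeftInvariant :=
  inferInstanceAs (Measure.haarMeasure ⊤).IsMulLeftInvariant

instance instIsProbabilityMeasureHaarSO (n : ℕ) : IsProbabilityMeasure (haarSO n) :=
  ⟨Measure.haarMeasure_self⟩

variable {n : ℕ}

/-- The rotation by the angle `θ` in the plane of the coordinates `j` and `k`. -/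
def planeMat (j k : Fin (2 * n)) (θ : ℝ) : Matrix (Fin (2 * n)) (Fin (2 * n)) ℝ := fun a b =>
  if a = j then (if b = j then Real.cos θ else if b = k then Real.sin θ else 0)
  else if a = k then (if b = j then -Real.sin θ else if b = k then Real.cos θ else 0)
  else if a = b then 1 else 0

/-- The action of `planeMat` on vectors. -/
def planeVec (j k : Fin (2 * n)) (θ : ℝ) (v : Fin (2 * n) → ℝ) : Fin (2 * n) → ℝ := fun a =>
  if a = j then Real.cos θ * v j + Real.sin θ * v k
  else if a = k then -Real.sin θ * v j + Real.cos θ * v k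
  else v a

theorem planeVec_left (j k : Fin (2 * n)) (θ : ℝ) (v : Fin (2 * n) → ℝ) :
    planeVec j k θ v j = Real.cos θ * v j + Real.sin θ * v k := by simp [planeVec]

theorem planeVec_right {j k : Fin (2 * n)} (h : j ≠ k) (θ : ℝ) (v : Fin (2 * n) → ℝ) :
    planeVec j k θ v k = -Real.sin θ * v j + Real.cos θ * v k := by simp [planeVec, h.symm]

theorem planeVec_of_ne {j k a : Fin (2 * n)} (hj : a ≠ j) (hk : a ≠ k) (θ : ℝ)
    (v : Fin (2 * n) → ℝ) : planeVec j k θ v a = v a := by simp [planeVec, hj, hk]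

theorem sum_planeMat_mul {j k : Fin (2 * n)} (h : j ≠ k) (θ : ℝ) (v : Fin (2 * n) → ℝ)
    (a : Fin (2 * n)) : ∑ b, planeMat j k θ a b * v b = planeVec j k θ v a := by
  have hs : ∀ x y : ℝ, ∑ b, (if b = j then x else if b = k then y else 0) * v b =
      x * v j + y * v k := by
    intro x y
    have : ∀ b, (if b = j then x else if b = k then y else 0) * v b =
        (if b = j then x * v b else 0) + (if b = k then y * v b else 0) := by
      intro b
      by_cases hb : b = j
      · have : b ≠ k := fun h' => h (hb.symm.trans h')
        simp [hb, h]
      · simp [hb]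
    simp [this, Finset.sum_add_distrib]
  simp only [planeMat, planeVec]
  split_ifs
  · exact hs _ _
  · exact hs _ _
  · simp

theorem planeMat_mul {j k : Fin (2 * n)} (h : j ≠ k) (θ φ : ℝ) :
    planeMat j k θ * planeMat j k φ = planeMat j k (θ + φ) := by
  ext a b
  rw [Matrix.mul_apply, sum_planeMat_mul h]
  simp only [planeVec, planeMat, if_true, if_neg h.symm, Real.cos_add, Real.sin_add]
  split_ifs <;> ring

theorem planeMat_zero (j k : Fin (2 * n)) : planeMat j k 0 = 1 := by
  ext a b
  simp only [planeMat, Real.cos_zero, Real.sin_zero, neg_zero, Matrix.one_apply]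
  split_ifs <;> simp_all

theorem planeMat_transpose (j k : Fin (2 * n)) (θ : ℝ) :
    (planeMat j k θ)ᵀ = planeMat j k (-θ) := by
  ext a b
  simp only [planeMat, Matrix.transpose_apply, Real.cos_neg, Real.sin_neg, neg_neg]
  grind

theorem planeMat_transpose_mul {j k : Fin (2 * n)} (h : j ≠ k) (θ : ℝ) :
    (planeMat j k θ)ᵀ * planeMat j k θ = 1 := by
  rw [planeMat_transpose, planeMat_mul h, neg_add_cancel, planeMat_zero]

theorem planeMat_det {j k : Fin (2 * n)} (h : j ≠ k) (θ : ℝ) : (planeMat j k θ).det = 1 := by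
  -- A plane rotation is the square of the rotation by half the angle.
  rw [← add_halves θ, ← planeMat_mul h, Matrix.det_mul]
  have := congrArg Matrix.det (planeMat_transpose_mul h (θ / 2))
  rwa [Matrix.det_mul, Matrix.det_transpose, Matrix.det_one] at this

/-- A plane rotation as an element of `SO(2n)`. -/
def planeRot {j k : Fin (2 * n)} (h : j ≠ k) (θ : ℝ) : SO n :=
  ⟨planeMat j k θ, (mem_SO_iff _).mpr ⟨planeMat_transpose_mul h θ, planeMat_det h θ⟩⟩

theorem planeRot_mul {j k : Fin (2 * n)} (h : j ≠ k) (θ φ : ℝ) :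
    planeRot h θ * planeRot h φ = planeRot h (θ + φ) :=
  Subtype.ext (planeMat_mul h θ φ)

theorem planeRot_zero {j k : Fin (2 * n)} (h : j ≠ k) : planeRot h 0 = 1 :=
  Subtype.ext (planeMat_zero j k)

/-- The matrix `Y` in the frame rotated by `O`. -/
def cov (Y : Matrix (Fin (2 * n)) (Fin (2 * n)) ℝ) (O : SO n) :
    Matrix (Fin (2 * n)) (Fin (2 * n)) ℝ := O.1 * Y * O.1ᵀ

theorem cov_mul_cov (Y Z : Matrix (Fin (2 * n)) (Fin (2 * n)) ℝ) (O : SO n) :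
    cov Y O * cov Z O = cov (Y * Z) O := by
  have h := SO_transpose_mul O
  simp only [cov]
  calc O.1 * Y * O.1ᵀ * (O.1 * Z * O.1ᵀ) = O.1 * Y * (O.1ᵀ * O.1) * Z * O.1ᵀ := by
        simp only [mul_assoc]
    _ = O.1 * (Y * Z) * O.1ᵀ := by rw [h, mul_one, mul_assoc O.1 Y Z]

theorem cov_one (O : SO n) : cov 1 O = 1 := by rw [cov, mul_one, SO_mul_transpose]

theorem cov_add (Y Z : Matrix (Fin (2 * n)) (Fin (2 * n)) ℝ) (O : SO n) :
    cov (Y + Z) O = cov Y O + cov Z O := by simp only [cov, mul_add, add_mul]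

theorem cov_trace (Y : Matrix (Fin (2 * n)) (Fin (2 * n)) ℝ) (O : SO n) :
    (cov Y O).trace = Y.trace := by
  rw [cov, Matrix.trace_mul_comm, ← mul_assoc, SO_transpose_mul, one_mul]

theorem cov_defect (M : Matrix (Fin (2 * n)) (Fin (2 * n)) ℝ) (O : SO n) :
    defect (cov M O) = cov (defect M) O := by
  rw [defect, defect, cov_add, cov_one, cov_mul_cov]

theorem cov_mul_left (Y : Matrix (Fin (2 * n)) (Fin (2 * n)) ℝ) (R O : SO n) :
    cov Y (R * O) = R.1 * cov Y O * R.1ᵀ := by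
  have : (R * O).1 = R.1 * O.1 := rfl
  simp only [cov, this, Matrix.transpose_mul, mul_assoc]

theorem IsCorr.cov {M : Matrix (Fin (2 * n)) (Fin (2 * n)) ℝ} (hM : IsCorr M) (O : SO n) :
    IsCorr (cov M O) := by
  refine ⟨transpose_conj_eq_neg hM.transpose O.1, ?_⟩
  rw [cov_defect, FreeFermion.cov]
  have := hM.posSemidef.mul_mul_conjTranspose_same O.1
  rwa [Matrix.conjTranspose_eq_transpose_of_trivial] at this

theorem continuous_cov (Y : Matrix (Fin (2 * n)) (Fin (2 * n)) ℝ) :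
    Continuous fun O : SO n => cov Y O :=
  (continuous_subtype_val.matrix_mul continuous_const).matrix_mul
    continuous_subtype_val.matrix_transpose

@[fun_prop]
theorem continuous_cov_apply (Y : Matrix (Fin (2 * n)) (Fin (2 * n)) ℝ) (a b : Fin (2 * n)) :
    Continuous fun O : SO n => cov Y O a b :=
  (continuous_cov Y).matrix_elem a b

theorem cov_planeRot_apply (Y : Matrix (Fin (2 * n)) (Fin (2 * n)) ℝ) {j k : Fin (2 * n)}
    (h : j ≠ k) (θ : ℝ) (O : SO n) (a b : Fin (2 * n)) :
    cov Y (planeRot h θ * O) a b =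
      planeVec j k θ (fun l => planeVec j k θ (cov Y O l) b) a := by
  rw [cov_mul_left, mul_assoc, Matrix.mul_apply, ← sum_planeMat_mul h]
  refine Finset.sum_congr rfl fun l _ => ?_
  congr 1
  rw [Matrix.mul_apply, ← sum_planeMat_mul h]
  exact Finset.sum_congr rfl fun m _ => mul_comm _ _

theorem cov_planeRot_row (Y : Matrix (Fin (2 * n)) (Fin (2 * n)) ℝ) {i j k : Fin (2 * n)}
    (h : j ≠ k) (hj : i ≠ j) (hk : i ≠ k) (θ : ℝ) (O : SO n) (b : Fin (2 * n)) :
    cov Y (planeRot h θ * O) i b = planeVec j k θ (cov Y O i) b := by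
  rw [cov_planeRot_apply, planeVec_of_ne hj hk]

theorem cov_planeRot_self (Y : Matrix (Fin (2 * n)) (Fin (2 * n)) ℝ) {i j k : Fin (2 * n)}
    (h : j ≠ k) (hj : i ≠ j) (hk : i ≠ k) (θ : ℝ) (O : SO n) :
    cov Y (planeRot h θ * O) i i = cov Y O i i := by
  rw [cov_planeRot_row Y h hj hk, planeVec_of_ne hj hk]

theorem cov_planeRot_left (Y : Matrix (Fin (2 * n)) (Fin (2 * n)) ℝ) {j k : Fin (2 * n)}
    (h : j ≠ k) (θ : ℝ) (O : SO n) :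
    cov Y (planeRot h θ * O) j j =
      Real.cos θ * (Real.cos θ * cov Y O j j + Real.sin θ * cov Y O j k) +
      Real.sin θ * (Real.cos θ * cov Y O k j + Real.sin θ * cov Y O k k) := by
  rw [cov_planeRot_apply, planeVec_left, planeVec_left, planeVec_left]

theorem integrable_of_continuous {f : SO n → ℝ} (hf : Continuous f) :
    Integrable f (haarSO n) :=
  hf.integrable_of_hasCompactSupport (HasCompactSupport.of_compactSpace f)

theorem integral_left_mul (f : SO n → ℝ) (R : SO n) :
    ∫ O, f (R * O) ∂(haarSO n) = ∫ O, f O ∂(haarSO n) :=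
  integral_mul_left_eq_self f R

/-- The Haar average of a derivative along plane rotations vanishes. -/
theorem integral_deriv_planeRot {j k : Fin (2 * n)} (h : j ≠ k) {f f' : SO n → ℝ}
    (hf : Continuous f) (hf' : Continuous f')
    (hderiv : ∀ O, HasDerivAt (fun θ => f (planeRot h θ * O)) (f' O) 0) :
    ∫ O, f' O ∂(haarSO n) = 0 := by
  have hd : ∀ O θ, HasDerivAt (fun θ => f (planeRot h θ * O)) (f' (planeRot h θ * O)) θ := by
    intro O θ
    have h1 := hderiv (planeRot h θ * O)
    rw [← sub_self θ] at h1
    have h2 := h1.comp_sub_const θ θ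
    simpa only [← mul_assoc, planeRot_mul, sub_add_cancel] using h2
  obtain ⟨C, hC⟩ := isCompact_univ.exists_bound_of_continuousOn hf'.continuousOn
  have h3 := (hasDerivAt_integral_of_dominated_loc_of_deriv_le (μ := haarSO n)
    (F := fun θ O => f (planeRot h θ * O)) (F' := fun θ O => f' (planeRot h θ * O)) (x₀ := 0)
    (bound := fun _ => C) (Filter.univ_mem)
    (Filter.Eventually.of_forall fun θ =>
      (hf.comp (continuous_const.mul continuous_id)).aestronglyMeasurable)
    (integrable_of_continuous (hf.comp (continuous_const.mul continuous_id)))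
    (hf'.comp (continuous_const.mul continuous_id)).aestronglyMeasurable
    (Filter.Eventually.of_forall fun O θ _ => hC _ (Set.mem_univ _))
    (integrable_const C)
    (Filter.Eventually.of_forall fun O θ _ => hd O θ)).2
  simp only [integral_left_mul] at h3
  exact h3.unique (hasDerivAt_const 0 _)

end Haar

/-! ### Moments of the first row of a randomly rotated correlation matrix -/

section Moments

variable {n : ℕ}

/-- A positive semidefinite form satisfies the Cauchy-Schwarz inequality for a basis vector and a
combination of two others. -/
theorem posSemidef_schur {N : Matrix (Fin (2 * n)) (Fin (2 * n)) ℝ} (hN : N.PosSemidef)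
    (i j k : Fin (2 * n)) (a b : ℝ) :
    (a * N i j + b * N i k) ^ 2 ≤ N i i * (a ^ 2 * N j j + 2 * a * b * N j k + b ^ 2 * N k k) := by
  have hsymm : ∀ x y, N y x = N x y := fun x y => by
    have := hN.isHermitian.apply x y
    simpa using this
  have h : ∀ t : ℝ, 0 ≤ N i i * (t * t) + 2 * (a * N i j + b * N i k) * t +
      (a ^ 2 * N j j + 2 * a * b * N j k + b ^ 2 * N k k) := by
    intro t
    have h1 := (hN.submatrix ![i, j, k]).dotProduct_mulVec_nonneg ![t, a, b]
    simp only [dotProduct, Matrix.mulVec, Fin.sum_univ_three, Matrix.submatrix_apply,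
      star_trivial, Matrix.cons_val_zero, Matrix.cons_val_one, Matrix.cons_val] at h1
    rw [hsymm i j, hsymm i k, hsymm j k] at h1
    nlinarith [h1]
  have h2 := discrim_le_zero h
  rw [discrim] at h2
  nlinarith [h2]

variable [NeZero n]

/-- The entries of the matrix `N₁₁ N - N e₁ e₁ᵀ N` for `N = 1 + M²` in the rotated frame; its
diagonal consists of the `2 × 2` minors of `N` with the first index. -/
def schur (M : Matrix (Fin (2 * n)) (Fin (2 * n)) ℝ) (j k : Fin (2 * n)) (O : SO n) : ℝ :=
  cov (defect M) O (fst n) (fst n) * cov (defect M) O j k -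
    cov (defect M) O (fst n) j * cov (defect M) O (fst n) k

/-- The trace of the matrix with the entries `schur`, in a form that shows that it depends on the
rotation through the first axis only. -/
def schurTrace (M : Matrix (Fin (2 * n)) (Fin (2 * n)) ℝ) (O : SO n) : ℝ :=
  cov (defect M) O (fst n) (fst n) * (defect M).trace -
    cov (defect M * defect M) O (fst n) (fst n)

/-- The matrix with the entries `schur`, applied to the first row of the correlation matrix; see
`IsCorr.sum_schur_mul`. -/
def schurVec (M : Matrix (Fin (2 * n)) (Fin (2 * n)) ℝ) (j : Fin (2 * n)) (O : SO n) : ℝ :=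
  cov (defect M) O (fst n) (fst n) * cov (M * defect M) O (fst n) j

@[fun_prop]
theorem continuous_schur (M : Matrix (Fin (2 * n)) (Fin (2 * n)) ℝ) (j k : Fin (2 * n)) :
    Continuous (schur M j k) := by unfold schur; fun_prop

@[fun_prop]
theorem continuous_schurTrace (M : Matrix (Fin (2 * n)) (Fin (2 * n)) ℝ) :
    Continuous (schurTrace M) := by unfold schurTrace; fun_prop

@[fun_prop]
theorem continuous_schurVec (M : Matrix (Fin (2 * n)) (Fin (2 * n)) ℝ) (j : Fin (2 * n)) :
    Continuous (schurVec M j) := by unfold schurVec; fun_prop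

namespace IsCorr

variable {M : Matrix (Fin (2 * n)) (Fin (2 * n)) ℝ} (hM : IsCorr M)

include hM

omit [NeZero n] in
theorem cov_defect_swap (O : SO n) (j k : Fin (2 * n)) :
    FreeFermion.cov (defect M) O k j = FreeFermion.cov (defect M) O j k := by
  rw [← cov_defect]; exact (hM.cov O).defect_swap j k

/-- `schurTrace` is the trace of the matrix with the entries `schur`. -/
theorem sum_schur (O : SO n) : ∑ k, schur M k k O = schurTrace M O := by
  simp only [schur, schurTrace, Finset.sum_sub_distrib, ← Finset.mul_sum]
  congr 1
  · rw [← cov_trace (defect M) O]; rfl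
  · rw [← cov_mul_cov, Matrix.mul_apply]
    exact Finset.sum_congr rfl fun k _ => by rw [hM.cov_defect_swap O (fst n) k]

omit hM in
theorem schur_fst (O : SO n) (k : Fin (2 * n)) : schur M (fst n) k O = 0 := by
  rw [schur, sub_self]

theorem schur_self_nonneg (O : SO n) (k : Fin (2 * n)) : 0 ≤ schur M k k O := by
  have := (hM.cov O).minor_nonneg (fst n) k
  rw [minor, cov_defect, sq] at this
  exact this

theorem schurTrace_nonneg (O : SO n) : 0 ≤ schurTrace M O := by
  rw [← hM.sum_schur]
  exact Finset.sum_nonneg fun k _ => hM.schur_self_nonneg O k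

theorem schur_self_le_schurTrace (O : SO n) (k : Fin (2 * n)) :
    schur M k k O ≤ schurTrace M O := by
  rw [← hM.sum_schur]
  exact Finset.single_le_sum (f := fun k => schur M k k O)
    (fun k _ => hM.schur_self_nonneg O k) (Finset.mem_univ k)

theorem sum_row_sq (O : SO n) :
    ∑ k, FreeFermion.cov M O (fst n) k ^ 2 = 1 - FreeFermion.cov (defect M) O (fst n) (fst n) := by
  rw [← cov_defect, (hM.cov O).defect_self, sub_sub_cancel]

/-- The matrix with the entries `schur` maps the first row of `M` to a multiple of the first row of
`M (1 + M²)`: the rank one part drops out because `M (1 + M²)` is antisymmetric. -/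
theorem sum_schur_mul (O : SO n) (j : Fin (2 * n)) :
    ∑ k, schur M j k O * FreeFermion.cov M O (fst n) k = schurVec M j O := by
  have h1 : ∀ j, ∑ k, FreeFermion.cov (defect M) O j k * FreeFermion.cov M O (fst n) k =
      FreeFermion.cov (M * defect M) O (fst n) j := by
    intro j
    rw [← cov_mul_cov, Matrix.mul_apply]
    exact Finset.sum_congr rfl fun k _ => by rw [hM.cov_defect_swap O j k, mul_comm]
  have h2 : (M * defect M)ᵀ = -(M * defect M) := by
    rw [defect, mul_add, mul_one, Matrix.transpose_add, Matrix.transpose_mul,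
      Matrix.transpose_mul, hM.transpose]
    simp only [neg_mul, mul_neg, neg_neg, mul_assoc]
    abel
  have h3 : FreeFermion.cov (M * defect M) O (fst n) (fst n) = 0 :=
    self_eq_neg.mp (congrFun (congrFun (transpose_conj_eq_neg h2 O.1) (fst n)) (fst n))
  simp only [schur, schurVec, sub_mul, mul_assoc, Finset.sum_sub_distrib, ← Finset.mul_sum, h1, h3]
  ring

/-- The form `x ↦ xᵀ A x` of a positive semidefinite `A` is at most `(tr A) |x|²`, here for the first
row `x` of the correlation matrix, which has length at most one. -/
theorem sum_schurVec_mul_le (O : SO n) :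
    ∑ k, schurVec M k O * FreeFermion.cov M O (fst n) k ≤ schurTrace M O := by
  set x := FreeFermion.cov M O (fst n) with hx
  have hpair : ∀ j k, schur M j k O * x k * x j ≤
      (schur M j j O * x k ^ 2 + schur M k k O * x j ^ 2) / 2 := by
    intro j k
    have h1 := posSemidef_schur (hM.cov O).posSemidef (fst n) j k (x k) (-x j)
    rw [cov_defect] at h1
    simp only [schur]
    nlinarith [h1]
  have h2 : ∑ k, x k ^ 2 ≤ 1 := by
    rw [hx, hM.sum_row_sq, ← cov_defect]
    linarith [(hM.cov O).defect_self_nonneg (fst n)]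
  calc ∑ j, schurVec M j O * x j = ∑ j, ∑ k, schur M j k O * x k * x j := by
        refine Finset.sum_congr rfl fun j _ => ?_
        rw [← hM.sum_schur_mul, Finset.sum_mul]
    _ ≤ ∑ j, ∑ k, (schur M j j O * x k ^ 2 + schur M k k O * x j ^ 2) / 2 :=
        Finset.sum_le_sum fun j _ => Finset.sum_le_sum fun k _ => hpair j k
    _ = schurTrace M O * ∑ k, x k ^ 2 := by
        rw [← hM.sum_schur]
        simp only [← Finset.sum_div, Finset.sum_add_distrib, ← Finset.mul_sum, ← Finset.sum_mul]
        ring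
    _ ≤ schurTrace M O * 1 := mul_le_mul_of_nonneg_left h2 (hM.schurTrace_nonneg O)
    _ = schurTrace M O := mul_one _

end IsCorr

omit [NeZero n] in
/-- The Haar averages of quantities that are permuted by plane rotations by a right angle agree with
the average over the index. -/
theorem integral_eq_of_right_angle {φ : Fin (2 * n) → SO n → ℝ} (i : Fin (2 * n))
    {s : Finset (Fin (2 * n))} (hφ : ∀ k, Continuous (φ k))
    (h : ∀ k ∈ s, ∀ hk : i ≠ k, ∀ O, φ i (planeRot hk (Real.pi / 2) * O) = φ k O) :
    (s.card : ℝ) * ∫ O, φ i O ∂(haarSO n) = ∫ O, ∑ k ∈ s, φ k O ∂(haarSO n) := by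
  rw [integral_finsetSum s fun k _ => integrable_of_continuous (hφ k)]
  have : ∀ k ∈ s, ∫ O, φ k O ∂(haarSO n) = ∫ O, φ i O ∂(haarSO n) := by
    intro k hk
    by_cases hik : i = k
    · rw [hik]
    · rw [← integral_left_mul (φ i) (planeRot hik (Real.pi / 2))]
      simp only [h k hk hik]
  rw [Finset.sum_congr rfl this, Finset.sum_const, nsmul_eq_mul]

omit [NeZero n] in
theorem planeVec_right_angle_left (j k : Fin (2 * n)) (v : Fin (2 * n) → ℝ) :
    planeVec j k (Real.pi / 2) v j = v k := by
  rw [planeVec_left, Real.cos_pi_div_two, Real.sin_pi_div_two]; ring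

omit [NeZero n] in
theorem cov_right_angle_row (Y : Matrix (Fin (2 * n)) (Fin (2 * n)) ℝ) {i j k : Fin (2 * n)}
    (h : j ≠ k) (hj : i ≠ j) (hk : i ≠ k) (O : SO n) :
    cov Y (planeRot h (Real.pi / 2) * O) i j = cov Y O i k := by
  rw [cov_planeRot_row Y h hj hk, planeVec_right_angle_left]

omit [NeZero n] in
theorem cov_right_angle_left (Y : Matrix (Fin (2 * n)) (Fin (2 * n)) ℝ) {j k : Fin (2 * n)}
    (h : j ≠ k) (O : SO n) : cov Y (planeRot h (Real.pi / 2) * O) j j = cov Y O k k := by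
  rw [cov_planeRot_left, Real.cos_pi_div_two, Real.sin_pi_div_two]; ring

variable {M : Matrix (Fin (2 * n)) (Fin (2 * n)) ℝ}

theorem schurTrace_planeRot {j k : Fin (2 * n)} (h : j ≠ k) (hj : fst n ≠ j) (hk : fst n ≠ k)
    (θ : ℝ) (O : SO n) : schurTrace M (planeRot h θ * O) = schurTrace M O := by
  rw [schurTrace, schurTrace, cov_planeRot_self _ h hj hk, cov_planeRot_self _ h hj hk]

theorem schur_right_angle {j k : Fin (2 * n)} (h : j ≠ k) (hj : fst n ≠ j) (hk : fst n ≠ k)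
    (O : SO n) : schur M j j (planeRot h (Real.pi / 2) * O) = schur M k k O := by
  rw [schur, schur, cov_planeRot_self _ h hj hk, cov_right_angle_left,
    cov_right_angle_row _ h hj hk]

theorem schurVec_right_angle {j k : Fin (2 * n)} (h : j ≠ k) (hj : fst n ≠ j) (hk : fst n ≠ k)
    (O : SO n) : schurVec M j (planeRot h (Real.pi / 2) * O) = schurVec M k O := by
  rw [schurVec, schurVec, cov_planeRot_self _ h hj hk, cov_right_angle_row _ h hj hk]

theorem card_erase_fst : ((Finset.univ.erase (fst n)).card : ℝ) = 2 * n - 1 := by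
  rw [Finset.card_erase_of_mem (Finset.mem_univ _), Finset.card_univ, Fintype.card_fin]
  have : 1 ≤ 2 * n := by have := Nat.pos_of_ne_zero (NeZero.ne n); omega
  push_cast [Nat.cast_sub this]
  ring

theorem card_restIndices : ((restIndices n).card : ℝ) = 2 * n - 2 := by
  rw [restIndices, Finset.card_erase_of_mem (by simp [fst_ne_snd.symm]),
    Finset.card_erase_of_mem (Finset.mem_univ _), Finset.card_univ, Fintype.card_fin]
  have : 1 ≤ n := Nat.pos_of_ne_zero (NeZero.ne n)
  rw [Nat.cast_sub (by omega), Nat.cast_sub (by omega)]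
  push_cast
  ring

theorem fst_ne_of_mem_erase {k : Fin (2 * n)} (h : k ∈ Finset.univ.erase (fst n)) : fst n ≠ k :=
  (Finset.ne_of_mem_erase h).symm

/-- The average of the `2 × 2` minor of `1 + M²` on the first two indices. -/
theorem integral_schur (hM : IsCorr M) :
    (2 * n - 1) * ∫ O, schur M (snd n) (snd n) O ∂(haarSO n) = ∫ O, schurTrace M O ∂(haarSO n) := by
  rw [← card_erase_fst, integral_eq_of_right_angle (φ := fun k => schur M k k) (snd n)
    (fun k => continuous_schur M k k)
    (fun k hk h O => schur_right_angle h fst_ne_snd (fst_ne_of_mem_erase hk) O)]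
  refine integral_congr_ae (Filter.Eventually.of_forall fun O => ?_)
  simp only
  rw [← hM.sum_schur, ← Finset.add_sum_erase _ _ (Finset.mem_univ (fst n)), IsCorr.schur_fst,
    zero_add]

theorem integral_schurTrace (M : Matrix (Fin (2 * n)) (Fin (2 * n)) ℝ) :
    2 * n * ∫ O, schurTrace M O ∂(haarSO n) =
      (defect M).trace ^ 2 - (defect M * defect M).trace := by
  let φ : Fin (2 * n) → SO n → ℝ := fun i O =>
    cov (defect M) O i i * (defect M).trace - cov (defect M * defect M) O i i
  have h := integral_eq_of_right_angle (φ := φ) (fst n) (s := Finset.univ)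
    (fun k => by simp only [φ]; fun_prop)
    (fun k _ hk O => by simp only [φ]; rw [cov_right_angle_left, cov_right_angle_left])
  rw [Finset.card_univ, Fintype.card_fin] at h
  push_cast at h
  refine Eq.trans h ?_
  have h2 : ∀ O : SO n, ∑ k, φ k O = (defect M).trace ^ 2 - (defect M * defect M).trace := by
    intro O
    simp only [φ, Finset.sum_sub_distrib, ← Finset.sum_mul]
    rw [← cov_trace (defect M * defect M) O, sq]
    nth_rewrite 2 [← cov_trace (defect M) O]
    rfl
  simp only [h2]
  simp

/-- The trace of `A` is invariant under rotations that fix the first axis, so `α²` may be averaged over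
the first row of `M`. -/
theorem integral_schurTrace_mul_row_sq_le (hM : IsCorr M) :
    (2 * n - 1) * ∫ O, schurTrace M O * cov M O (fst n) (snd n) ^ 2 ∂(haarSO n) ≤
      ∫ O, schurTrace M O ∂(haarSO n) := by
  rw [← card_erase_fst, integral_eq_of_right_angle
    (φ := fun k O => schurTrace M O * cov M O (fst n) k ^ 2) (snd n)
    (fun k => by fun_prop)
    (fun k hk h O => by
      rw [schurTrace_planeRot h fst_ne_snd (fst_ne_of_mem_erase hk),
        cov_right_angle_row _ h fst_ne_snd (fst_ne_of_mem_erase hk)])]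
  refine integral_mono (integrable_of_continuous (by fun_prop))
    (integrable_of_continuous (by fun_prop)) fun O => ?_
  simp only
  rw [← Finset.mul_sum]
  refine mul_le_of_le_one_right (hM.schurTrace_nonneg O) ?_
  refine (Finset.sum_le_univ_sum_of_nonneg fun k => sq_nonneg _).trans ?_
  rw [hM.sum_row_sq, ← cov_defect]
  linarith [(hM.cov O).defect_self_nonneg (fst n)]

/-- By invariance the index `2` may be replaced by the average over the indices other than the first,
which gives the form `xᵀ A x` at the first row `x` of the correlation matrix. -/
theorem integral_schurVec_mul_le (hM : IsCorr M) :
    (2 * n - 1) * ∫ O, schurVec M (snd n) O * cov M O (fst n) (snd n) ∂(haarSO n) ≤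
      ∫ O, schurTrace M O ∂(haarSO n) := by
  rw [← card_erase_fst, integral_eq_of_right_angle
    (φ := fun k O => schurVec M k O * cov M O (fst n) k) (snd n)
    (fun k => by fun_prop)
    (fun k hk h O => by
      rw [schurVec_right_angle h fst_ne_snd (fst_ne_of_mem_erase hk),
        cov_right_angle_row _ h fst_ne_snd (fst_ne_of_mem_erase hk)])]
  refine integral_mono (integrable_of_continuous (by fun_prop))
    (integrable_of_continuous (by fun_prop)) fun O => ?_
  have h := hM.sum_schurVec_mul_le O
  rw [← Finset.add_sum_erase _ _ (Finset.mem_univ (fst n)), (hM.cov O).apply_self, mul_zero,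
    zero_add] at h
  exact h

omit [NeZero n] in
theorem hasDerivAt_planeVec_left (j k : Fin (2 * n)) (v : Fin (2 * n) → ℝ) :
    HasDerivAt (fun θ => planeVec j k θ v j) (v k) 0 := by
  simp only [planeVec_left]
  refine (((Real.hasDerivAt_cos 0).mul_const (v j)).add
    ((Real.hasDerivAt_sin 0).mul_const (v k))).congr_deriv ?_
  simp

omit [NeZero n] in
theorem hasDerivAt_planeVec_right {j k : Fin (2 * n)} (h : j ≠ k) (v : Fin (2 * n) → ℝ) :
    HasDerivAt (fun θ => planeVec j k θ v k) (-v j) 0 := by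
  simp only [planeVec_right h]
  refine (((Real.hasDerivAt_sin 0).neg.mul_const (v j)).add
    ((Real.hasDerivAt_cos 0).mul_const (v k))).congr_deriv ?_
  simp

omit [NeZero n] in
theorem hasDerivAt_cov_left (Y : Matrix (Fin (2 * n)) (Fin (2 * n)) ℝ) {i j k : Fin (2 * n)}
    (h : j ≠ k) (hj : i ≠ j) (hk : i ≠ k) (O : SO n) :
    HasDerivAt (fun θ => cov Y (planeRot h θ * O) i j) (cov Y O i k) 0 := by
  simp only [cov_planeRot_row Y h hj hk]
  exact hasDerivAt_planeVec_left j k _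

omit [NeZero n] in
theorem hasDerivAt_cov_right (Y : Matrix (Fin (2 * n)) (Fin (2 * n)) ℝ) {i j k : Fin (2 * n)}
    (h : j ≠ k) (hj : i ≠ j) (hk : i ≠ k) (O : SO n) :
    HasDerivAt (fun θ => cov Y (planeRot h θ * O) i k) (-cov Y O i j) 0 := by
  simp only [cov_planeRot_row Y h hj hk]
  exact hasDerivAt_planeVec_right h _

omit [NeZero n] in
theorem hasDerivAt_cov_diag (Y : Matrix (Fin (2 * n)) (Fin (2 * n)) ℝ) {j k : Fin (2 * n)}
    (h : j ≠ k) (O : SO n) :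
    HasDerivAt (fun θ => cov Y (planeRot h θ * O) j j) (cov Y O j k + cov Y O k j) 0 := by
  simp only [cov_planeRot_left]
  have h1 := ((Real.hasDerivAt_cos 0).mul_const (cov Y O j j)).add
    ((Real.hasDerivAt_sin 0).mul_const (cov Y O j k))
  have h2 := ((Real.hasDerivAt_cos 0).mul_const (cov Y O k j)).add
    ((Real.hasDerivAt_sin 0).mul_const (cov Y O k k))
  have := ((Real.hasDerivAt_cos 0).mul h1).add ((Real.hasDerivAt_sin 0).mul h2)
  refine this.congr_deriv ?_
  simp

theorem hasDerivAt_schur (hM : IsCorr M) {j k : Fin (2 * n)} (h : j ≠ k) (hj : fst n ≠ j)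
    (hk : fst n ≠ k) (O : SO n) :
    HasDerivAt (fun θ => schur M j j (planeRot h θ * O)) (2 * schur M j k O) 0 := by
  simp only [schur, cov_planeRot_self _ h hj hk]
  have h1 := hasDerivAt_cov_left (defect M) h hj hk O
  have h2 := ((hasDerivAt_cov_diag (defect M) h O).const_mul
    (cov (defect M) O (fst n) (fst n))).sub (h1.mul h1)
  refine h2.congr_deriv ?_
  simp only [planeRot_zero, one_mul]
  rw [hM.cov_defect_swap O j k]
  ring

/-- The fourth moment, from the vanishing of the average derivative of `A₂₂ α_k α₂`. -/
theorem integral_schur_mul_row_sq (hM : IsCorr M) :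
    (2 * n + 1) * ∫ O, schur M (snd n) (snd n) O * cov M O (fst n) (snd n) ^ 2 ∂(haarSO n) =
      2 * (∫ O, schurVec M (snd n) O * cov M O (fst n) (snd n) ∂(haarSO n)) +
      ∫ O, schur M (snd n) (snd n) O * (1 - cov (defect M) O (fst n) (fst n)) ∂(haarSO n) := by
  have h0 : ∀ k ∈ restIndices n, ∫ O, (2 * schur M (snd n) k O *
      (cov M O (fst n) k * cov M O (fst n) (snd n)) + schur M (snd n) (snd n) O *
        (-cov M O (fst n) (snd n) * cov M O (fst n) (snd n) +
          cov M O (fst n) k * cov M O (fst n) k)) ∂(haarSO n) = 0 := by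
    intro k hk
    obtain ⟨h1, h2⟩ := mem_restIndices.mp hk
    refine integral_deriv_planeRot (h2.symm : snd n ≠ k)
      (f := fun O => schur M (snd n) (snd n) O * (cov M O (fst n) k * cov M O (fst n) (snd n)))
      (by fun_prop) (by fun_prop) fun O => ?_
    have e1 := hasDerivAt_schur hM h2.symm fst_ne_snd h1.symm O
    have e2 := hasDerivAt_cov_right M h2.symm fst_ne_snd h1.symm O
    have e3 := hasDerivAt_cov_left M h2.symm fst_ne_snd h1.symm O
    refine (e1.mul (e2.fun_mul e3)).congr_deriv ?_
    simp only [planeRot_zero, one_mul]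
  have h1 := Finset.sum_eq_zero h0
  rw [← integral_finsetSum _ fun k _ => integrable_of_continuous (by fun_prop)] at h1
  rw [← integral_const_mul, ← integral_const_mul, ← integral_add
    (integrable_of_continuous (by fun_prop)) (integrable_of_continuous (by fun_prop)),
    ← sub_eq_zero, ← integral_sub (integrable_of_continuous (by fun_prop))
    (integrable_of_continuous (by fun_prop)), ← neg_eq_zero, ← integral_neg, ← h1]
  refine integral_congr_ae (Filter.Eventually.of_forall fun O => ?_)
  simp only
  have e1 : ∑ k ∈ restIndices n, schur M (snd n) k O * cov M O (fst n) k =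
      schurVec M (snd n) O - schur M (snd n) (snd n) O * cov M O (fst n) (snd n) := by
    have := hM.sum_schur_mul O (snd n)
    rw [sum_eq_rest, (hM.cov O).apply_self] at this
    linarith
  have e2 : ∑ k ∈ restIndices n, cov M O (fst n) k ^ 2 =
      1 - cov (defect M) O (fst n) (fst n) - cov M O (fst n) (snd n) ^ 2 := by
    have := hM.sum_row_sq O
    rw [sum_eq_rest, (hM.cov O).apply_self] at this
    linarith
  have e3 : ∑ k ∈ restIndices n, (2 * schur M (snd n) k O *
      (cov M O (fst n) k * cov M O (fst n) (snd n)) + schur M (snd n) (snd n) O *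
        (-cov M O (fst n) (snd n) * cov M O (fst n) (snd n) +
          cov M O (fst n) k * cov M O (fst n) k)) =
      2 * cov M O (fst n) (snd n) *
        (∑ k ∈ restIndices n, schur M (snd n) k O * cov M O (fst n) k) +
      schur M (snd n) (snd n) O * (∑ k ∈ restIndices n, cov M O (fst n) k ^ 2) -
      (restIndices n).card * (schur M (snd n) (snd n) O * cov M O (fst n) (snd n) ^ 2) := by
    rw [Finset.mul_sum, Finset.mul_sum, ← nsmul_eq_mul, ← Finset.sum_const,
      ← Finset.sum_add_distrib, ← Finset.sum_sub_distrib]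
    exact Finset.sum_congr rfl fun k _ => by ring
  rw [e3, e1, e2, card_restIndices]
  ring

/-- The average of `α² D` is smaller than that of `D` by a factor of order `1 / n`. -/
theorem integral_schur_mul_row_sq_le (hM : IsCorr M) :
    (2 * n + 1) * ∫ O, schur M (snd n) (snd n) O * cov M O (fst n) (snd n) ^ 2 ∂(haarSO n) ≤
      3 * ∫ O, schur M (snd n) (snd n) O ∂(haarSO n) := by
  have h1 := integral_schur_mul_row_sq hM
  have h2 := integral_schurVec_mul_le hM
  rw [← integral_schur hM] at h2
  have hn : (0 : ℝ) < 2 * n - 1 := by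
    have : (1 : ℝ) ≤ n := by exact_mod_cast Nat.pos_of_ne_zero (NeZero.ne n)
    linarith
  have h3 := le_of_mul_le_mul_left h2 hn
  have h4 : ∫ O, schur M (snd n) (snd n) O * (1 - cov (defect M) O (fst n) (fst n)) ∂(haarSO n) ≤
      ∫ O, schur M (snd n) (snd n) O ∂(haarSO n) := by
    refine integral_mono (integrable_of_continuous (by fun_prop))
      (integrable_of_continuous (by fun_prop)) fun O => ?_
    refine mul_le_of_le_one_right (hM.schur_self_nonneg O _) ?_
    rw [← cov_defect]
    linarith [(hM.cov O).defect_self_nonneg (fst n)]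
  linarith

/-- The bound on the average of `α⁴ / (1 + δ - α²)` that follows from the vanishing of the average
derivative of `α_k α₂³ / (1 + δ - α₂²)`. It is uniform in `δ`, which removes the singularity. -/
theorem integral_schurTrace_mul_le (hM : IsCorr M) {δ : ℝ} (hδ : 0 < δ) :
    (2 * n - 4) * ∫ O, schurTrace M O * (cov M O (fst n) (snd n) ^ 4 /
        (1 + δ - cov M O (fst n) (snd n) ^ 2)) ∂(haarSO n) ≤
      3 * ∫ O, schurTrace M O * cov M O (fst n) (snd n) ^ 2 ∂(haarSO n) := by
  set c := 1 + δ with hc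
  have hpos : ∀ O : SO n, 0 < c - cov M O (fst n) (snd n) ^ 2 := fun O => by
    linarith [(hM.cov O).sq_le_one (fst n) (snd n)]
  have hne : ∀ O : SO n, c - cov M O (fst n) (snd n) ^ 2 ≠ 0 := fun O => (hpos O).ne'
  have hne2 : ∀ O : SO n, (c - cov M O (fst n) (snd n) ^ 2) ^ 2 ≠ 0 := fun O =>
    pow_ne_zero _ (hne O)
  let x : SO n → ℝ := fun O => cov M O (fst n) (snd n)
  let g : SO n → ℝ := fun O => x O ^ 3 / (c - x O ^ 2)
  let g' : SO n → ℝ := fun O => (3 * x O ^ 2 * c - x O ^ 4) / (c - x O ^ 2) ^ 2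
  have hx : Continuous x := continuous_cov_apply M _ _
  have hg : Continuous g := (hx.pow 3).div (continuous_const.sub (hx.pow 2)) hne
  have hg' : Continuous g' := by
    refine Continuous.div ?_ ((continuous_const.sub (hx.pow 2)).pow 2) hne2
    fun_prop
  have hh : Continuous fun O : SO n => x O ^ 4 / (c - x O ^ 2) :=
    (hx.pow 4).div (continuous_const.sub (hx.pow 2)) hne
  have h0 : ∀ k ∈ restIndices n, ∫ O, (schurTrace M O * (-x O * g O +
      cov M O (fst n) k * (g' O * cov M O (fst n) k))) ∂(haarSO n) = 0 := by
    intro k hk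
    obtain ⟨h1, h2⟩ := mem_restIndices.mp hk
    refine integral_deriv_planeRot (h2.symm : snd n ≠ k)
      (f := fun O => schurTrace M O * (cov M O (fst n) k * g O))
      (by fun_prop) (by fun_prop) fun O => ?_
    simp only [schurTrace_planeRot h2.symm fst_ne_snd h1.symm]
    have e2 := hasDerivAt_cov_right M h2.symm fst_ne_snd h1.symm O
    have e3 := hasDerivAt_cov_left M h2.symm fst_ne_snd h1.symm O
    have e4 : HasDerivAt (fun θ => g (planeRot (h2.symm : snd n ≠ k) θ * O))
        (g' O * cov M O (fst n) k) 0 := by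
      have := (e3.fun_pow 3).fun_div ((e3.fun_pow 2).const_sub c) (hne _)
      refine this.congr_deriv ?_
      simp only [planeRot_zero, one_mul, g', x]
      have := hne O
      field_simp
      push_cast
      ring
    refine ((e2.mul e4).const_mul (schurTrace M O)).congr_deriv ?_
    simp only [planeRot_zero, one_mul, x]
  have h1 := Finset.sum_eq_zero h0
  rw [← integral_finsetSum _ fun k _ => integrable_of_continuous (by fun_prop)] at h1
  have h2 : ∀ O : SO n, ∑ k ∈ restIndices n, schurTrace M O * (-x O * g O +
      cov M O (fst n) k * (g' O * cov M O (fst n) k)) ≤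
      3 * (schurTrace M O * x O ^ 2) -
        (2 * n - 4) * (schurTrace M O * (x O ^ 4 / (c - x O ^ 2))) := by
    intro O
    have e2 : ∑ k ∈ restIndices n, cov M O (fst n) k ^ 2 ≤ c - x O ^ 2 := by
      have := hM.sum_row_sq O
      rw [sum_eq_rest, (hM.cov O).apply_self] at this
      have h3 := (hM.cov O).defect_self_nonneg (fst n)
      rw [cov_defect] at h3
      simp only [x, hc]
      linarith
    have e3 : ∑ k ∈ restIndices n, schurTrace M O * (-x O * g O +
        cov M O (fst n) k * (g' O * cov M O (fst n) k)) =
        schurTrace M O * (-((restIndices n).card * (x O * g O)) +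
          g' O * ∑ k ∈ restIndices n, cov M O (fst n) k ^ 2) := by
      rw [Finset.mul_sum, ← nsmul_eq_mul, ← Finset.sum_const, ← Finset.sum_neg_distrib,
        ← Finset.sum_add_distrib, Finset.mul_sum]
      exact Finset.sum_congr rfl fun k _ => by ring
    have hx1 : x O ^ 2 ≤ 1 := (hM.cov O).sq_le_one (fst n) (snd n)
    have e4 : 0 ≤ g' O := by
      refine div_nonneg ?_ (sq_nonneg _)
      nlinarith [sq_nonneg (x O), mul_nonneg (sq_nonneg (x O)) hδ.le]
    have e5 : g' O * (c - x O ^ 2) = 3 * x O ^ 2 + 2 * (x O ^ 4 / (c - x O ^ 2)) := by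
      have : c - x O ^ 2 ≠ 0 := hne O
      simp only [g']
      field_simp
      ring
    have e6 : x O * g O = x O ^ 4 / (c - x O ^ 2) := by simp only [g]; ring
    rw [e3, card_restIndices, e6]
    have e7 := mul_le_mul_of_nonneg_left e2 e4
    rw [e5] at e7
    have e8 := mul_le_mul_of_nonneg_left e7 (hM.schurTrace_nonneg O)
    linarith
  have h3 : 0 ≤ ∫ O, (3 * (schurTrace M O * x O ^ 2) -
      (2 * n - 4) * (schurTrace M O * (x O ^ 4 / (c - x O ^ 2)))) ∂(haarSO n) := by
    rw [← h1]
    exact integral_mono (integrable_of_continuous (by fun_prop))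
      (integrable_of_continuous (by fun_prop)) h2
  rw [integral_sub (integrable_of_continuous (by fun_prop))
    (integrable_of_continuous (by fun_prop)), integral_const_mul, integral_const_mul] at h3
  exact sub_nonneg.mp h3

end Moments

/-! ### The Haar average of the entropy change -/

section HaarAverage

variable {n : ℕ}

theorem IsCorr.trace_defect_mul_self_le {M : Matrix (Fin (2 * n)) (Fin (2 * n)) ℝ}
    (hM : IsCorr M) : (defect M * defect M).trace ≤ (defect M).trace := by
  -- The difference is the trace of `Mᵀ (1 + M²) M`.
  have h := (hM.posSemidef.conjTranspose_mul_mul_same M).trace_nonneg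
  rw [Matrix.conjTranspose_eq_transpose_of_trivial, hM.transpose] at h
  have h2 : -M * defect M * M = defect M - defect M * defect M := by
    simp only [defect]
    noncomm_ring
  rw [h2, Matrix.trace_sub] at h
  exact sub_nonneg.mp h

theorem proxyEntropy_eq_trace_defect (ρ : FockOp n) :
    proxyEntropy ρ = Real.log 2 * ((defect (corrMatrix ρ)).trace / 2) := by
  rw [proxyEntropy, defect, Matrix.trace_add, Matrix.trace_one, Fintype.card_fin]
  push_cast
  ring

theorem IsGaussian.proxyEntropy_nonneg {ρ : FockOp n} (h : IsGaussian ρ) : 0 ≤ proxyEntropy ρ := by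
  rw [proxyEntropy_eq_trace_defect]
  exact mul_nonneg (Real.log_nonneg one_le_two)
    (div_nonneg h.isCorr.posSemidef.trace_nonneg zero_le_two)

theorem IsGaussian.proxyEntropy_le {ρ : FockOp n} (h : IsGaussian ρ) :
    proxyEntropy ρ ≤ n * Real.log 2 := by
  rw [h.proxyEntropy_eq, mul_comm]
  refine mul_le_mul_of_nonneg_right ?_ (Real.log_nonneg one_le_two)
  have : 0 ≤ ∑ j, ∑ k, corrMatrix ρ j k ^ 2 :=
    Finset.sum_nonneg fun j _ => Finset.sum_nonneg fun k _ => sq_nonneg _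
  linarith

theorem IsGaussian.proxyEntropy_rotate {ρ : FockOp n} (h : IsGaussian ρ) (O : SO n) :
    proxyEntropy (FreeFermion.rotate O ρ) = proxyEntropy ρ := by
  rw [proxyEntropy, proxyEntropy, h.corrMatrix_rotate O]
  change _ * (_ + (cov _ O * cov _ O).trace / 2) = _
  rw [cov_mul_cov, cov_trace]

variable [NeZero n]

theorem one_le_cast : (1 : ℝ) ≤ n := by exact_mod_cast Nat.pos_of_ne_zero (NeZero.ne n)

/-- The decrease of the proxy entropy, in units of `log 2`, as a function of the rotation. -/
def entropyLoss (M : Matrix (Fin (2 * n)) (Fin (2 * n)) ℝ) (O : SO n) : ℝ :=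
  schur M (snd n) (snd n) O / (1 - cov M O (fst n) (snd n) ^ 2)

theorem IsGaussian.entropyChange_rotate {ρ : FockOp n} (h : IsGaussian ρ) (O : SO n) :
    entropyChange (FreeFermion.rotate O ρ) = -(Real.log 2 * entropyLoss (corrMatrix ρ) O) := by
  rw [(h.rotate O).entropyChange_eq, h.corrMatrix_rotate O]
  change -(_ * (minor (defect (cov _ O)) _ _ / (1 - cov _ O _ _ ^ 2))) = _
  rw [cov_defect, minor, sq (cov _ O _ _)]
  rfl

variable {M : Matrix (Fin (2 * n)) (Fin (2 * n)) ℝ}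

theorem IsCorr.schur_snd_le (hM : IsCorr M) (O : SO n) :
    schur M (snd n) (snd n) O ≤ (1 - FreeFermion.cov M O (fst n) (snd n) ^ 2) ^ 2 := by
  have := (hM.cov O).minor_le (fst n) (snd n)
  rw [minor, cov_defect, sq (FreeFermion.cov (defect M) O _ _)] at this
  exact this

theorem div_one_sub_bounds {x d : ℝ} (hx0 : 0 ≤ x) (hx1 : x ≤ 1) (hd0 : 0 ≤ d)
    (hd : d ≤ (1 - x) ^ 2) : d ≤ d / (1 - x) ∧ d / (1 - x) ≤ 1 := by
  rcases hx1.eq_or_lt with rfl | hx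
  · have : d = 0 := le_antisymm (by simpa using hd) hd0
    simp [this]
  · have h1 : 0 < 1 - x := sub_pos.mpr hx
    rw [le_div_iff₀ h1, div_le_one h1]
    constructor <;> nlinarith

/-- A geometric expansion of `d / (1 - x)` to second order, with the remainder regularized at
`x = 1` at the cost of `δ`. -/
theorem div_one_sub_le {x d t δ : ℝ} (hx0 : 0 ≤ x) (hx1 : x ≤ 1) (hd0 : 0 ≤ d)
    (hd : d ≤ (1 - x) ^ 2) (hdt : d ≤ t) (hδ : 0 < δ) :
    d / (1 - x) ≤ d + d * x + t * (x ^ 2 / (1 + δ - x)) + δ := by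
  have h2 : 0 < 1 + δ - x := by linarith
  have h3 : 0 ≤ x ^ 2 / (1 + δ - x) := by positivity
  have h4 := mul_le_mul_of_nonneg_right hdt h3
  rcases hx1.eq_or_lt with rfl | hx
  · rw [sub_self, div_zero]
    nlinarith
  · have h1 : 0 < 1 - x := sub_pos.mpr hx
    have h5 : d / (1 - x) = d + d * x + d * (x ^ 2 / (1 + δ - x)) +
        δ * (x ^ 2 * (d / ((1 - x) * (1 + δ - x)))) := by
      field_simp
      ring
    have h6 : d / ((1 - x) * (1 + δ - x)) ≤ 1 := by
      rw [div_le_one (mul_pos h1 h2)]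
      nlinarith
    have h7 : x ^ 2 * (d / ((1 - x) * (1 + δ - x))) ≤ 1 :=
      mul_le_one₀ (by nlinarith) (by positivity) h6
    have h8 := mul_le_mul_of_nonneg_left h7 hδ.le
    rw [h5]
    linarith

theorem measurable_entropyLoss (M : Matrix (Fin (2 * n)) (Fin (2 * n)) ℝ) :
    Measurable (entropyLoss M) := by
  refine Measurable.div (Continuous.measurable (by fun_prop)) (Continuous.measurable ?_)
  fun_prop

theorem IsCorr.entropyLoss_bounds (hM : IsCorr M) (O : SO n) :
    schur M (snd n) (snd n) O ≤ entropyLoss M O ∧ entropyLoss M O ≤ 1 :=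
  div_one_sub_bounds (sq_nonneg _) ((hM.cov O).sq_le_one _ _) (hM.schur_self_nonneg O _)
    (hM.schur_snd_le O)

theorem IsCorr.entropyLoss_nonneg (hM : IsCorr M) (O : SO n) : 0 ≤ entropyLoss M O :=
  (hM.schur_self_nonneg O _).trans (hM.entropyLoss_bounds O).1

theorem integrable_entropyLoss (hM : IsCorr M) : Integrable (entropyLoss M) (haarSO n) := by
  refine Integrable.of_bound (measurable_entropyLoss M).aestronglyMeasurable 1
    (Filter.Eventually.of_forall fun O => ?_)
  rw [Real.norm_of_nonneg (hM.entropyLoss_nonneg O)]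
  exact (hM.entropyLoss_bounds O).2

theorem integral_schur_le (hM : IsCorr M) :
    ∫ O, schur M (snd n) (snd n) O ∂(haarSO n) ≤ ∫ O, entropyLoss M O ∂(haarSO n) :=
  integral_mono (integrable_of_continuous (by fun_prop)) (integrable_entropyLoss hM)
    fun O => (hM.entropyLoss_bounds O).1

theorem integral_schur_nonneg (hM : IsCorr M) :
    0 ≤ ∫ O, schur M (snd n) (snd n) O ∂(haarSO n) :=
  integral_nonneg fun O => hM.schur_self_nonneg O _

theorem integral_entropyLoss_nonneg (hM : IsCorr M) : 0 ≤ ∫ O, entropyLoss M O ∂(haarSO n) :=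
  integral_nonneg fun O => hM.entropyLoss_nonneg O

theorem integral_entropyLoss_le_one (hM : IsCorr M) : ∫ O, entropyLoss M O ∂(haarSO n) ≤ 1 := by
  have := integral_mono (integrable_entropyLoss hM) (integrable_const (1 : ℝ))
    fun O => (hM.entropyLoss_bounds O).2
  simpa using this

/-- The factor collects `3 / (2n + 1) + 3 / (2n - 4) ≤ 6 / n`, from the second moment and from the
remainder. -/
theorem integral_entropyLoss_le (hM : IsCorr M) (hn : 3 ≤ n) :
    ∫ O, entropyLoss M O ∂(haarSO n) ≤
      (1 + 6 / n) * ∫ O, schur M (snd n) (snd n) O ∂(haarSO n) := by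
  set d := ∫ O, schur M (snd n) (snd n) O ∂(haarSO n) with hd
  have hd0 : 0 ≤ d := integral_schur_nonneg hM
  have hn' : (3 : ℝ) ≤ n := by exact_mod_cast hn
  refine le_of_forall_pos_le_add fun δ hδ => ?_
  have hc : Continuous fun O : SO n => cov M O (fst n) (snd n) ^ 4 /
      (1 + δ - cov M O (fst n) (snd n) ^ 2) := by
    refine Continuous.div (by fun_prop) (by fun_prop) fun O => ?_
    have := (hM.cov O).sq_le_one (fst n) (snd n)
    have h : 0 < 1 + δ - cov M O (fst n) (snd n) ^ 2 := by linarith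
    exact h.ne'
  have h1 := integral_mono (integrable_entropyLoss hM)
    (integrable_of_continuous (f := fun O => schur M (snd n) (snd n) O +
      schur M (snd n) (snd n) O * cov M O (fst n) (snd n) ^ 2 +
      schurTrace M O * (cov M O (fst n) (snd n) ^ 4 /
        (1 + δ - cov M O (fst n) (snd n) ^ 2)) + δ) (by fun_prop))
    fun O => by
      have := div_one_sub_le (sq_nonneg _) ((hM.cov O).sq_le_one (fst n) (snd n))
        (hM.schur_self_nonneg O (snd n)) (hM.schur_snd_le O)
        (hM.schur_self_le_schurTrace O (snd n)) hδ
      rw [← pow_mul] at this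
      exact this
  rw [integral_add (integrable_of_continuous (by fun_prop)) (integrable_const _),
    integral_add (integrable_of_continuous (by fun_prop)) (integrable_of_continuous (by fun_prop)),
    integral_add (integrable_of_continuous (by fun_prop))
      (integrable_of_continuous (by fun_prop)), integral_const, ← hd] at h1
  simp only [probReal_univ, one_smul] at h1
  have h2 := integral_schur_mul_row_sq_le hM
  have h3 := integral_schurTrace_mul_le hM hδ
  have h4 := integral_schurTrace_mul_row_sq_le hM
  rw [← integral_schur hM] at h4
  rw [← hd] at h2 h4
  have h5 := le_of_mul_le_mul_left h4 (by linarith)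
  set X := ∫ O, schur M (snd n) (snd n) O * cov M O (fst n) (snd n) ^ 2 ∂(haarSO n)
  set Y := ∫ O, schurTrace M O * (cov M O (fst n) (snd n) ^ 4 /
    (1 + δ - cov M O (fst n) (snd n) ^ 2)) ∂(haarSO n)
  have hX : X ≤ 3 / 2 / n * d := by
    rw [div_mul_eq_mul_div, le_div_iff₀ (by linarith)]
    by_cases hX0 : 0 ≤ X
    · nlinarith
    · push Not at hX0
      nlinarith
  have hY : Y ≤ 9 / 2 / n * d := by
    rw [div_mul_eq_mul_div, le_div_iff₀ (by linarith)]
    by_cases hY0 : 0 ≤ Y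
    · nlinarith
    · push Not at hY0
      nlinarith
  have h6 : (1 + 6 / (n : ℝ)) * d = d + 3 / 2 / n * d + 9 / 2 / n * d := by
    field_simp
    ring
  rw [h6]
  linarith

theorem IsGaussian.haarEntropyChange_eq {ρ : FockOp n} (h : IsGaussian ρ) :
    haarEntropyChange ρ = -(Real.log 2 * ∫ O, entropyLoss (corrMatrix ρ) O ∂(haarSO n)) := by
  rw [haarEntropyChange, ← integral_const_mul, ← integral_neg]
  exact integral_congr_ae (Filter.Eventually.of_forall fun O => h.entropyChange_rotate O)

theorem IsGaussian.integrable_entropyChange_rotate {ρ : FockOp n} (h : IsGaussian ρ) :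
    Integrable (fun O => entropyChange (FreeFermion.rotate O ρ)) (haarSO n) := by
  simp only [h.entropyChange_rotate]
  exact ((integrable_entropyLoss h.isCorr).const_mul _).neg

theorem IsGaussian.leadingTerm_eq {ρ : FockOp n} (h : IsGaussian ρ) :
    leadingTerm ρ = (1 - 1 / (2 * n)) *
      (Real.log 2 * ∫ O, schur (corrMatrix ρ) (snd n) (snd n) O ∂(haarSO n)) := by
  have h1 := integral_schurTrace (corrMatrix ρ)
  rw [← integral_schur h.isCorr] at h1
  have hn : (n : ℝ) ≠ 0 := by have := one_le_cast (n := n); positivity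
  change Real.log 2 / (4 * (n : ℝ) ^ 2) *
    ((defect (corrMatrix ρ)).trace ^ 2 - (defect (corrMatrix ρ) * defect (corrMatrix ρ)).trace) = _
  rw [← h1]
  field_simp
  ring

theorem IsGaussian.leadingTerm_nonneg {ρ : FockOp n} (h : IsGaussian ρ) : 0 ≤ leadingTerm ρ := by
  rw [h.leadingTerm_eq]
  refine mul_nonneg ?_ (mul_nonneg (Real.log_nonneg one_le_two) (integral_schur_nonneg h.isCorr))
  rw [sub_nonneg, div_le_one] <;> linarith [one_le_cast (n := n)]

theorem IsGaussian.haarEntropyChange_nonpos {ρ : FockOp n} (h : IsGaussian ρ) :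
    haarEntropyChange ρ ≤ 0 := by
  rw [h.haarEntropyChange_eq, neg_nonpos]
  exact mul_nonneg (Real.log_nonneg one_le_two) (integral_entropyLoss_nonneg h.isCorr)

theorem IsGaussian.neg_log_two_le_haarEntropyChange {ρ : FockOp n} (h : IsGaussian ρ) :
    -Real.log 2 ≤ haarEntropyChange ρ := by
  rw [h.haarEntropyChange_eq, neg_le_neg_iff]
  exact mul_le_of_le_one_right (Real.log_nonneg one_le_two) (integral_entropyLoss_le_one h.isCorr)

/-- The decrease is at least the leading term, with a factor that makes the bound effective for a
single mode too. -/
theorem IsGaussian.leadingTerm_le {ρ : FockOp n} (h : IsGaussian ρ) :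
    leadingTerm ρ ≤ (1 - 1 / (2 * n)) * -haarEntropyChange ρ := by
  rw [h.leadingTerm_eq, h.haarEntropyChange_eq, neg_neg]
  refine mul_le_mul_of_nonneg_left (mul_le_mul_of_nonneg_left (integral_schur_le h.isCorr)
    (Real.log_nonneg one_le_two)) ?_
  rw [sub_nonneg, div_le_one] <;> linarith [one_le_cast (n := n)]

theorem IsGaussian.leadingTerm_le_neg_haarEntropyChange {ρ : FockOp n} (h : IsGaussian ρ) :
    leadingTerm ρ ≤ -haarEntropyChange ρ := by
  refine h.leadingTerm_le.trans (mul_le_of_le_one_left ?_ ?_)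
  · linarith [h.haarEntropyChange_nonpos]
  · have : (0 : ℝ) ≤ 1 / (2 * n) := by positivity
    linarith

/-- The constant collects the `6 / n` of `integral_entropyLoss_le` and the ratio `1 - 1 / (2n)` of the
leading term to the average of the minor. -/
theorem IsGaussian.abs_haarEntropyChange_sub_le {ρ : FockOp n} (h : IsGaussian ρ) (hn : 3 ≤ n) :
    |(|haarEntropyChange ρ|) - leadingTerm ρ| ≤ 13 / n * leadingTerm ρ := by
  have hn' : (3 : ℝ) ≤ n := by exact_mod_cast hn
  have hlog : 0 ≤ Real.log 2 := Real.log_nonneg one_le_two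
  rw [abs_of_nonpos h.haarEntropyChange_nonpos,
    abs_of_nonneg (sub_nonneg.mpr h.leadingTerm_le_neg_haarEntropyChange), h.haarEntropyChange_eq,
    neg_neg, h.leadingTerm_eq]
  set d := ∫ O, schur (corrMatrix ρ) (snd n) (snd n) O ∂(haarSO n)
  have hd : 0 ≤ Real.log 2 * d := mul_nonneg hlog (integral_schur_nonneg h.isCorr)
  have h1 := mul_le_mul_of_nonneg_left (integral_entropyLoss_le h.isCorr hn) hlog
  have h2 : 0 ≤ (13 / n * (1 - 1 / (2 * n)) - (6 / n + 1 / (2 * n)) : ℝ) * (Real.log 2 * d) := by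
    refine mul_nonneg ?_ hd
    have : (13 / n * (1 - 1 / (2 * n)) - (6 / n + 1 / (2 * n)) : ℝ) =
        13 / 2 * (n - 1) / (n : ℝ) ^ 2 := by
      field_simp
      ring
    rw [this]
    exact div_nonneg (by linarith) (sq_nonneg _)
  nlinarith [h1, h2]

/-- The leading term in terms of the entropy density `proxyEntropy ρ / (n log 2)`. -/
theorem IsGaussian.le_leadingTerm {ρ : FockOp n} (h : IsGaussian ρ) :
    Real.log 2 * ((proxyEntropy ρ / (n * Real.log 2)) ^ 2 -
      proxyEntropy ρ / (n * Real.log 2) / (2 * n)) ≤ leadingTerm ρ := by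
  have hn : (0 : ℝ) < n := by linarith [one_le_cast (n := n)]
  have hlog : 0 < Real.log 2 := Real.log_pos one_lt_two
  have h1 := h.isCorr.trace_defect_mul_self_le
  have h2 : proxyEntropy ρ / (n * Real.log 2) = (defect (corrMatrix ρ)).trace / (2 * n) := by
    rw [proxyEntropy_eq_trace_defect]
    field_simp
  rw [h2]
  change _ ≤ Real.log 2 / (4 * (n : ℝ) ^ 2) *
    ((defect (corrMatrix ρ)).trace ^ 2 - (defect (corrMatrix ρ) * defect (corrMatrix ρ)).trace)
  have h3 : Real.log 2 * (((defect (corrMatrix ρ)).trace / (2 * n)) ^ 2 -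
      (defect (corrMatrix ρ)).trace / (2 * n) / (2 * n)) =
      Real.log 2 / (4 * (n : ℝ) ^ 2) *
        ((defect (corrMatrix ρ)).trace ^ 2 - (defect (corrMatrix ρ)).trace) := by
    field_simp
    ring
  rw [h3]
  exact mul_le_mul_of_nonneg_left (by linarith) (by positivity)

end HaarAverage

/-! ### Measurability -/

section Measurability

variable {n : ℕ}

@[fun_prop]
theorem continuous_corrMatrix : Continuous (corrMatrix : FockOp n → _) :=
  continuous_matrix fun _ _ => Complex.continuous_re.comp (continuous_const.mul
    ((continuous_id.matrix_mul continuous_const).matrix_trace))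

theorem continuous_proxyEntropy : Continuous (proxyEntropy : FockOp n → ℝ) :=
  continuous_const.mul (continuous_const.add
    (((continuous_corrMatrix.matrix_mul continuous_corrMatrix).matrix_trace).div_const 2))

theorem continuous_leadingTerm : Continuous (leadingTerm : FockOp n → ℝ) := by
  have h : Continuous fun ρ : FockOp n => 1 + corrMatrix ρ * corrMatrix ρ :=
    continuous_const.add (continuous_corrMatrix.matrix_mul continuous_corrMatrix)
  exact continuous_const.mul ((h.matrix_trace.pow 2).sub (h.matrix_mul h).matrix_trace)

theorem continuous_purity : Continuous (purity : FockOp n → ℝ) :=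
  Complex.continuous_re.comp (continuous_id.matrix_mul continuous_id).matrix_trace

/-- Rotations depend jointly continuously on the state and the rotation: the substituted products are
polynomials in the entries of the rotation. -/
theorem continuous_rotate : Continuous fun x : FockOp n × SO n => rotate x.2 x.1 := by
  have hr : ∀ S : Finset (Fin (2 * n)), Continuous fun x : FockOp n × SO n =>
      orderedProd (fun j => ∑ k, (x.2.1 k j : ℂ) • (majorana k : FockOp n)) S := by
    intro S
    refine continuous_list_prod _ fun j _ => continuous_finsetSum _ fun k _ => ?_
    exact (Complex.continuous_ofReal.comp
      ((continuous_subtype_val.comp continuous_snd).matrix_elem k j)).smul continuous_const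
  refine continuous_finsetSum _ fun S _ => Continuous.fun_smul ?_ (hr S)
  exact continuous_const.mul (continuous_const.matrix_mul continuous_fst).matrix_trace

/-- The Gaussian states form a closed set: the correlation matrix is a continuous function of the
state, and it determines the linear equation that characterizes Gaussian states. -/
theorem isClosed_isGaussian : IsClosed {ρ : FockOp n | IsGaussian ρ} := by
  have h : {ρ : FockOp n | IsGaussian ρ} =
      (⋂ v, {ρ : FockOp n | 0 ≤ star v ⬝ᵥ (ρ *ᵥ v)}) ∩ ({ρ | ρᴴ = ρ} ∩ ({ρ | ρ.trace = 1} ∩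
        ({ρ | ρ * parityOp n = parityOp n * ρ} ∩ ({ρ | (corrMatrix ρ)ᵀ = -corrMatrix ρ} ∩
          ⋂ j, {ρ | majorana j * ρ - ρ * majorana j =
            Complex.I • ∑ k, (corrMatrix ρ j k : ℂ) • (majorana k * ρ + ρ * majorana k)})))) := by
    ext ρ
    simp only [Set.mem_ofPred_eq, Set.mem_inter_iff, Set.mem_iInter]
    constructor
    · intro hρ
      have h2 := (isGaussian_iff ρ).mp hρ
      exact ⟨h2.1.dotProduct_mulVec_nonneg, h2.1.isHermitian, h2.2.1, h2.2.2.1,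
        hρ.transpose_corrMatrix, hρ.gaussianEq⟩
    · rintro ⟨h1, h2, h3, h4, h5, h6⟩
      exact (isGaussian_iff ρ).mpr ⟨Matrix.PosSemidef.of_dotProduct_mulVec_nonneg h2 h1, h3, h4, _,
        h5, h6⟩
  rw [h]
  refine IsClosed.inter (isClosed_iInter fun v => ?_) (IsClosed.inter ?_ (IsClosed.inter ?_
    (IsClosed.inter ?_ (IsClosed.inter ?_ (isClosed_iInter fun j => ?_)))))
  · exact isClosed_Ici.preimage (continuous_const.dotProduct
      (continuous_id.matrix_mulVec continuous_const))
  · exact isClosed_eq continuous_id.matrix_conjTranspose continuous_id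
  · exact isClosed_eq continuous_id.matrix_trace continuous_const
  · exact isClosed_eq (continuous_id.matrix_mul continuous_const)
      (continuous_const.matrix_mul continuous_id)
  · exact isClosed_eq continuous_corrMatrix.matrix_transpose continuous_corrMatrix.neg
  · refine isClosed_eq ((continuous_const.matrix_mul continuous_id).sub
      (continuous_id.matrix_mul continuous_const)) (Continuous.fun_const_smul
        (continuous_finsetSum _ fun k _ => Continuous.fun_smul ?_ ?_) _)
    · exact Complex.continuous_ofReal.comp (continuous_corrMatrix.matrix_elem j k)
    · exact (continuous_const.matrix_mul continuous_id).add
        (continuous_id.matrix_mul continuous_const)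

variable [NeZero n]

theorem continuous_outcomeProb (b : Bool) : Continuous (outcomeProb b : FockOp n → ℝ) :=
  Complex.continuous_re.comp (continuous_const.matrix_mul continuous_id).matrix_trace

theorem measurable_postState (b : Bool) : Measurable (postState b : FockOp n → FockOp n) := by
  refine measurable_pi_iff.mpr fun x => measurable_pi_iff.mpr fun y => ?_
  refine Measurable.mul (f := fun ρ => (outcomeProb b ρ : ℂ)⁻¹)
    (g := fun ρ : FockOp n => (outcomeProj b * ρ * outcomeProj b : FockOp n) x y) ?_ ?_
  · exact (Complex.measurable_ofReal.comp (continuous_outcomeProb b).measurable).inv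
  · exact (((continuous_const.matrix_mul continuous_id).matrix_mul
      continuous_const).matrix_elem x y).measurable

theorem measurable_entropyChange : Measurable (entropyChange : FockOp n → ℝ) := by
  refine Measurable.sub (Finset.measurable_sum _ fun b _ => ?_) continuous_proxyEntropy.measurable
  exact (continuous_outcomeProb b).measurable.mul
    (continuous_proxyEntropy.measurable.comp (measurable_postState b))

theorem measurable_haarEntropyChange : Measurable (haarEntropyChange : FockOp n → ℝ) :=
  (StronglyMeasurable.integral_prod_right (ν := haarSO n)
    (f := fun ρ O => entropyChange (rotate O ρ))
    (measurable_entropyChange.comp continuous_rotate.measurable).stronglyMeasurable).measurable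

end Measurability

/-! ### Ensembles of Gaussian states -/

section Ensembles

variable {n : ℕ}

theorem integrable_proxyEntropy {μ : Measure (FockOp n)} [IsFiniteMeasure μ]
    (hμ : ∀ᵐ ρ ∂μ, IsGaussian ρ) : Integrable (fun ρ : FockOp n => proxyEntropy ρ) μ := by
  refine Integrable.of_bound continuous_proxyEntropy.measurable.aestronglyMeasurable
    (n * Real.log 2) ?_
  filter_upwards [hμ] with ρ hρ
  rw [Real.norm_of_nonneg hρ.proxyEntropy_nonneg]
  exact hρ.proxyEntropy_le

theorem integrable_purity {μ : Measure (FockOp n)} [IsFiniteMeasure μ]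
    (hμ : ∀ᵐ ρ ∂μ, IsGaussian ρ) : Integrable (fun ρ : FockOp n => purity ρ) μ := by
  refine Integrable.of_bound continuous_purity.measurable.aestronglyMeasurable 1 ?_
  filter_upwards [hμ] with ρ hρ
  rw [Real.norm_of_nonneg ((Real.exp_pos _).le.trans hρ.exp_neg_proxyEntropy_le_purity)]
  exact purity_le_one_of_posSemidef hρ.1 hρ.2.1

/-- By the convexity of the exponential function, the average purity is at least the exponential of
minus any bound on the average proxy entropy. -/
theorem exp_neg_le_integral_purity {μ : Measure (FockOp n)} [IsProbabilityMeasure μ]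
    (hμ : ∀ᵐ ρ ∂μ, IsGaussian ρ) {B : ℝ} (hB : ∫ ρ, proxyEntropy ρ ∂μ ≤ B) :
    Real.exp (-B) ≤ ∫ ρ, purity ρ ∂μ := by
  have hS := integrable_proxyEntropy hμ
  have h1 : ∫ ρ, Real.exp (-B) * (1 + B - proxyEntropy ρ) ∂μ ≤ ∫ ρ, purity ρ ∂μ := by
    refine integral_mono_ae (((integrable_const _).sub hS).const_mul _) (integrable_purity hμ) ?_
    filter_upwards [hμ] with ρ hρ
    refine le_trans ?_ hρ.exp_neg_proxyEntropy_le_purity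
    -- The graph of the exponential function lies above its tangent at `-B`.
    have h2 := Real.add_one_le_exp (B - proxyEntropy ρ)
    calc Real.exp (-B) * (1 + B - proxyEntropy ρ)
        ≤ Real.exp (-B) * Real.exp (B - proxyEntropy ρ) :=
          mul_le_mul_of_nonneg_left (by linarith) (Real.exp_pos _).le
      _ = Real.exp (-proxyEntropy ρ) := by rw [← Real.exp_add]; congr 1; ring
  rw [integral_const_mul, integral_sub (integrable_const _) hS, integral_const, probReal_univ,
    one_smul] at h1
  nlinarith [Real.exp_pos (-B)]

variable [NeZero n]

theorem integrable_haarEntropyChange {μ : Measure (FockOp n)} [IsFiniteMeasure μ]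
    (hμ : ∀ᵐ ρ ∂μ, IsGaussian ρ) : Integrable (fun ρ : FockOp n => haarEntropyChange ρ) μ := by
  refine Integrable.of_bound measurable_haarEntropyChange.aestronglyMeasurable (Real.log 2) ?_
  filter_upwards [hμ] with ρ hρ
  rw [Real.norm_of_nonpos hρ.haarEntropyChange_nonpos]
  linarith [hρ.neg_log_two_le_haarEntropyChange]

theorem integrable_leadingTerm {μ : Measure (FockOp n)} [IsFiniteMeasure μ]
    (hμ : ∀ᵐ ρ ∂μ, IsGaussian ρ) : Integrable (fun ρ : FockOp n => leadingTerm ρ) μ := by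
  refine Integrable.of_bound continuous_leadingTerm.measurable.aestronglyMeasurable
    (Real.log 2) ?_
  filter_upwards [hμ] with ρ hρ
  rw [Real.norm_of_nonneg hρ.leadingTerm_nonneg]
  linarith [hρ.leadingTerm_le_neg_haarEntropyChange, hρ.neg_log_two_le_haarEntropyChange]

/-- The lower bound on the ensemble average of the leading term is Jensen's inequality for the
square function. -/
theorem le_integral_leadingTerm {μ : Measure (FockOp n)} [IsProbabilityMeasure μ]
    (hμ : ∀ᵐ ρ ∂μ, IsGaussian ρ) :
    Real.log 2 * (((∫ ρ, proxyEntropy ρ ∂μ) / (n * Real.log 2)) ^ 2 -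
      (∫ ρ, proxyEntropy ρ ∂μ) / (n * Real.log 2) / (2 * n)) ≤ ∫ ρ, leadingTerm ρ ∂μ := by
  set s := (∫ ρ, proxyEntropy ρ ∂μ) / (n * Real.log 2) with hs
  have hS := (integrable_proxyEntropy hμ).div_const (n * Real.log 2)
  have h1 : ∫ ρ, Real.log 2 * ((2 * s - 1 / (2 * n)) * (proxyEntropy ρ / (n * Real.log 2)) -
      s ^ 2) ∂μ ≤ ∫ ρ, leadingTerm ρ ∂μ := by
    refine integral_mono_ae (((hS.const_mul _).sub (integrable_const _)).const_mul _)
      (integrable_leadingTerm hμ) ?_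
    filter_upwards [hμ] with ρ hρ
    refine le_trans (mul_le_mul_of_nonneg_left ?_ (Real.log_nonneg one_le_two)) hρ.le_leadingTerm
    have h2 := sq_nonneg (proxyEntropy ρ / (n * Real.log 2) - s)
    have h3 : proxyEntropy ρ / (n * Real.log 2) / (2 * n) =
      1 / (2 * n) * (proxyEntropy ρ / (n * Real.log 2)) := by ring
    rw [h3]
    nlinarith [h2]
  rw [integral_const_mul, integral_sub (hS.const_mul _) (integrable_const _), integral_const_mul,
    integral_div, ← hs, integral_const, probReal_univ, one_smul] at h1
  refine le_trans (le_of_eq ?_) h1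
  ring

theorem integral_leadingTerm_le {μ : Measure (FockOp n)} [IsProbabilityMeasure μ]
    (hμ : ∀ᵐ ρ ∂μ, IsGaussian ρ) :
    ∫ ρ, leadingTerm ρ ∂μ ≤ (1 - 1 / (2 * n)) * -∫ ρ, haarEntropyChange ρ ∂μ := by
  rw [← integral_neg, ← integral_const_mul]
  refine integral_mono_ae (integrable_leadingTerm hμ)
    ((integrable_haarEntropyChange hμ).neg.const_mul _) ?_
  filter_upwards [hμ] with ρ hρ
  exact hρ.leadingTerm_le

theorem integral_haarEntropyChange_nonpos {μ : Measure (FockOp n)}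
    (hμ : ∀ᵐ ρ ∂μ, IsGaussian ρ) : ∫ ρ, haarEntropyChange ρ ∂μ ≤ 0 :=
  integral_nonpos_of_ae (by filter_upwards [hμ] with ρ hρ using hρ.haarEntropyChange_nonpos)

theorem integral_leadingTerm_le_abs {μ : Measure (FockOp n)} [IsProbabilityMeasure μ]
    (hμ : ∀ᵐ ρ ∂μ, IsGaussian ρ) :
    ∫ ρ, leadingTerm ρ ∂μ ≤ |∫ ρ, haarEntropyChange ρ ∂μ| := by
  have h := integral_haarEntropyChange_nonpos hμ
  rw [abs_of_nonpos h]
  refine (integral_leadingTerm_le hμ).trans (mul_le_of_le_one_left (by linarith) ?_)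
  have : (0 : ℝ) ≤ 1 / (2 * n) := by positivity
  linarith

end Ensembles

/-! ### The maximally mixed state -/

section MaximallyMixed

variable {n : ℕ}

theorem maximallyMixed_isGaussian : IsGaussian (maximallyMixed n) := by
  refine (isGaussian_iff _).mpr ⟨?_, ?_, ?_, 0, by simp, fun j => ?_⟩
  · refine Matrix.PosSemidef.one.smul ?_
    rw [← Complex.ofReal_ofNat, ← Complex.ofReal_pow, ← Complex.ofReal_inv]
    exact Complex.zero_le_real.mpr (by positivity)
  · rw [maximallyMixed, Matrix.trace_smul, Matrix.trace_one]
    simp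
  · simp [maximallyMixed]
  · simp [maximallyMixed]

theorem proxyEntropy_maximallyMixed : proxyEntropy (maximallyMixed n) = n * Real.log 2 := by
  have h : corrMatrix (maximallyMixed n) = 0 := by
    ext j k
    rw [corrMatrix, maximallyMixed, smul_mul_assoc, one_mul, Matrix.trace_smul, Matrix.trace_sub,
      Matrix.trace_mul_comm, sub_self]
    simp
  rw [proxyEntropy, h]
  simp [mul_comm]

end MaximallyMixed

/-! ### The circuit -/

section Circuit

variable {n : ℕ} [NeZero n]

omit [NeZero n] in
theorem ae_prod_isGaussian_rotate {μ : Measure (FockOp n)} (hμ : ∀ᵐ ρ ∂μ, IsGaussian ρ) :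
    ∀ᵐ x ∂(μ.prod (haarSO n)), IsGaussian (rotate x.2 x.1) := by
  filter_upwards [Measure.quasiMeasurePreserving_fst.ae hμ] with x hx using hx.rotate x.2

theorem measurable_outcomeProb_rotate (b : Bool) :
    Measurable fun x : FockOp n × SO n => ENNReal.ofReal (outcomeProb b (rotate x.2 x.1)) :=
  ENNReal.measurable_ofReal.comp
    ((continuous_outcomeProb b).measurable.comp continuous_rotate.measurable)

theorem measurable_postState_rotate (b : Bool) :
    Measurable fun x : FockOp n × SO n => postState b (rotate x.2 x.1) :=
  (measurable_postState b).comp continuous_rotate.measurable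

/-- The Born probabilities of a Gaussian state are nonnegative and add up to one. -/
theorem isProbabilityMeasure_circuitStep {μ : Measure (FockOp n)} [IsProbabilityMeasure μ]
    (hμ : ∀ᵐ ρ ∂μ, IsGaussian ρ) : IsProbabilityMeasure (circuitStep μ) := by
  constructor
  rw [circuitStep, Measure.finsetSum_apply]
  have h : ∀ b : Bool, (((μ.prod (haarSO n)).withDensity fun x =>
      ENNReal.ofReal (outcomeProb b (rotate x.2 x.1))).map
      fun x => postState b (rotate x.2 x.1)) Set.univ =
      ∫⁻ x, ENNReal.ofReal (outcomeProb b (rotate x.2 x.1)) ∂(μ.prod (haarSO n)) := by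
    intro b
    rw [Measure.map_apply (measurable_postState_rotate b) MeasurableSet.univ, Set.preimage_univ,
      withDensity_apply _ MeasurableSet.univ, Measure.restrict_univ]
  simp only [h]
  rw [← lintegral_finsetSum _ fun b _ => measurable_outcomeProb_rotate b]
  have h1 : ∀ᵐ x ∂(μ.prod (haarSO n)),
      ∑ b, ENNReal.ofReal (outcomeProb b (rotate x.2 x.1)) = 1 := by
    filter_upwards [ae_prod_isGaussian_rotate hμ] with x hx
    rw [← ENNReal.ofReal_sum_of_nonneg fun b _ => hx.outcomeProb_nonneg b, hx.sum_outcomeProb,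
      ENNReal.ofReal_one]
  rw [lintegral_congr_ae h1, lintegral_one, measure_univ]

/-- Outcomes of probability zero, whose conventional state is not Gaussian, carry no weight. -/
theorem ae_circuitStep_isGaussian {μ : Measure (FockOp n)}
    (hμ : ∀ᵐ ρ ∂μ, IsGaussian ρ) : ∀ᵐ ρ ∂(circuitStep μ), IsGaussian ρ := by
  rw [circuitStep, ← Measure.sum_fintype, Measure.ae_sum_iff]
  intro b
  rw [ae_map_iff (measurable_postState_rotate b).aemeasurable isClosed_isGaussian.measurableSet,
    ae_withDensity_iff (measurable_outcomeProb_rotate b)]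
  filter_upwards [ae_prod_isGaussian_rotate hμ] with x hx hb
  refine hx.postState fun h0 => hb ?_
  rw [h0, ENNReal.ofReal_zero]

/-- The average of an observable after a step is its average over the measurement outcomes and the
rotations. -/
theorem integral_circuitStep {μ : Measure (FockOp n)} [IsProbabilityMeasure μ]
    (hμ : ∀ᵐ ρ ∂μ, IsGaussian ρ) {f : FockOp n → ℝ} (hf : Measurable f)
    (hint : Integrable f (circuitStep μ)) :
    Integrable (fun x => ∑ b, outcomeProb b (rotate x.2 x.1) * f (postState b (rotate x.2 x.1)))
      (μ.prod (haarSO n)) ∧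
    ∫ ρ, f ρ ∂(circuitStep μ) =
      ∫ x, ∑ b, outcomeProb b (rotate x.2 x.1) * f (postState b (rotate x.2 x.1))
        ∂(μ.prod (haarSO n)) := by
  rw [circuitStep, integrable_finsetSum_measure] at hint
  have h0 : ∀ b : Bool, (fun x : FockOp n × SO n =>
      (ENNReal.ofReal (outcomeProb b (rotate x.2 x.1))).toReal • f (postState b (rotate x.2 x.1)))
      =ᵐ[μ.prod (haarSO n)]
      fun x => outcomeProb b (rotate x.2 x.1) * f (postState b (rotate x.2 x.1)) := by
    intro b
    filter_upwards [ae_prod_isGaussian_rotate hμ] with x hx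
    rw [ENNReal.toReal_ofReal (hx.outcomeProb_nonneg b), smul_eq_mul]
  have h1 : ∀ b : Bool, Integrable (fun x : FockOp n × SO n =>
      outcomeProb b (rotate x.2 x.1) * f (postState b (rotate x.2 x.1))) (μ.prod (haarSO n)) := by
    intro b
    have := (integrable_map_measure hf.aestronglyMeasurable
      (measurable_postState_rotate b).aemeasurable).mp (hint b (Finset.mem_univ b))
    rw [integrable_withDensity_iff_integrable_smul' (measurable_outcomeProb_rotate b)
      (Filter.Eventually.of_forall fun _ => ENNReal.ofReal_lt_top)] at this
    exact this.congr (h0 b)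
  refine ⟨integrable_finsetSum _ fun b _ => h1 b, ?_⟩
  rw [circuitStep, integral_finsetSum_measure hint, integral_finsetSum _ fun b _ => h1 b]
  refine Finset.sum_congr rfl fun b _ => ?_
  rw [integral_map (measurable_postState_rotate b).aemeasurable hf.aestronglyMeasurable,
    integral_withDensity_eq_integral_toReal_smul (measurable_outcomeProb_rotate b)
      (Filter.Eventually.of_forall fun _ => ENNReal.ofReal_lt_top)]
  exact integral_congr_ae (h0 b)

/-- A step changes the average proxy entropy by the average entropy change, as rotations preserve the
proxy entropy. -/
theorem integral_proxyEntropy_circuitStep {μ : Measure (FockOp n)} [IsProbabilityMeasure μ]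
    (hμ : ∀ᵐ ρ ∂μ, IsGaussian ρ) :
    ∫ ρ, proxyEntropy ρ ∂(circuitStep μ) =
      ∫ ρ, proxyEntropy ρ ∂μ + ∫ ρ, haarEntropyChange ρ ∂μ := by
  have := isProbabilityMeasure_circuitStep hμ
  obtain ⟨h1, h2⟩ := integral_circuitStep hμ continuous_proxyEntropy.measurable
    (integrable_proxyEntropy (ae_circuitStep_isGaussian hμ))
  rw [h2, integral_prod _ h1, ← integral_add (integrable_proxyEntropy hμ)
    (integrable_haarEntropyChange hμ)]
  refine integral_congr_ae ?_
  filter_upwards [hμ] with ρ hρ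
  have h3 : ∀ O : SO n, ∑ b, outcomeProb b (rotate O ρ) * proxyEntropy (postState b (rotate O ρ)) =
      proxyEntropy ρ + entropyChange (rotate O ρ) := by
    intro O
    rw [entropyChange, hρ.proxyEntropy_rotate]
    ring
  simp only [h3]
  rw [integral_add (integrable_const _) hρ.integrable_entropyChange_rotate, integral_const,
    probReal_univ, one_smul]
  rfl

theorem circuitLaw_succ (ρ₀ : FockOp n) (t : ℕ) :
    circuitLaw ρ₀ (t + 1) = circuitStep (circuitLaw ρ₀ t) :=
  Function.iterate_succ_apply' _ _ _

theorem circuitLaw_properties {ρ₀ : FockOp n} (h : IsGaussian ρ₀) (t : ℕ) :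
    IsProbabilityMeasure (circuitLaw ρ₀ t) ∧ ∀ᵐ ρ ∂(circuitLaw ρ₀ t), IsGaussian ρ := by
  induction t with
  | zero =>
    change IsProbabilityMeasure (Measure.dirac ρ₀) ∧ ∀ᵐ ρ ∂(Measure.dirac ρ₀), IsGaussian ρ
    exact ⟨inferInstance, (ae_dirac_iff isClosed_isGaussian.measurableSet).mpr h⟩
  | succ t ih =>
    have := ih.1
    rw [circuitLaw_succ]
    exact ⟨isProbabilityMeasure_circuitStep ih.2, ae_circuitStep_isGaussian ih.2⟩

/-- The average of the entropy density `S_proxy / (n log 2)` after `t` steps. -/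
def entropyDensity (ρ₀ : FockOp n) (t : ℕ) : ℝ :=
  (∫ ρ, proxyEntropy ρ ∂(circuitLaw ρ₀ t)) / (n * Real.log 2)

theorem integral_proxyEntropy_eq (ρ₀ : FockOp n) (t : ℕ) :
    ∫ ρ, proxyEntropy ρ ∂(circuitLaw ρ₀ t) = entropyDensity ρ₀ t * (n * Real.log 2) := by
  have hn : (0 : ℝ) < n := by linarith [one_le_cast (n := n)]
  have hlog : 0 < Real.log 2 := Real.log_pos one_lt_two
  rw [entropyDensity, div_mul_cancel₀ _ (by positivity)]

theorem entropyDensity_bounds {ρ₀ : FockOp n} (h : IsGaussian ρ₀) (t : ℕ) :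
    0 ≤ entropyDensity ρ₀ t ∧ entropyDensity ρ₀ t ≤ 1 := by
  obtain ⟨h1, h2⟩ := circuitLaw_properties h t
  have hn : (0 : ℝ) < n := by linarith [one_le_cast (n := n)]
  have hlog : 0 < Real.log 2 := Real.log_pos one_lt_two
  constructor
  · refine div_nonneg (integral_nonneg_of_ae ?_) (by positivity)
    filter_upwards [h2] with ρ hρ using hρ.proxyEntropy_nonneg
  · rw [entropyDensity, div_le_one (by positivity)]
    have : ∫ ρ, proxyEntropy ρ ∂(circuitLaw ρ₀ t) ≤
        ∫ _, n * Real.log 2 ∂(circuitLaw ρ₀ t) :=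
      integral_mono_ae (integrable_proxyEntropy h2) (integrable_const _)
        (by filter_upwards [h2] with ρ hρ using hρ.proxyEntropy_le)
    simpa using this

theorem entropyDensity_succ {ρ₀ : FockOp n} (h : IsGaussian ρ₀) (t : ℕ) :
    entropyDensity ρ₀ (t + 1) ≤ entropyDensity ρ₀ t ∧
    entropyDensity ρ₀ (t + 1) ≤ entropyDensity ρ₀ t -
      2 / (2 * n - 1) * (entropyDensity ρ₀ t ^ 2 - entropyDensity ρ₀ t / (2 * n)) := by
  obtain ⟨h1, h2⟩ := circuitLaw_properties h t
  have hn1 := one_le_cast (n := n)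
  have hn : (0 : ℝ) < n := by linarith
  have hlog : 0 < Real.log 2 := Real.log_pos one_lt_two
  have h3 := integral_haarEntropyChange_nonpos h2
  have h4 := (le_integral_leadingTerm h2).trans (integral_leadingTerm_le h2)
  have h5 : entropyDensity ρ₀ (t + 1) = entropyDensity ρ₀ t +
      (∫ ρ, haarEntropyChange ρ ∂(circuitLaw ρ₀ t)) / (n * Real.log 2) := by
    rw [entropyDensity, circuitLaw_succ, integral_proxyEntropy_circuitStep h2, add_div]
    rfl
  change Real.log 2 * (entropyDensity ρ₀ t ^ 2 - entropyDensity ρ₀ t / (2 * n)) ≤ _ at h4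
  set x := ∫ ρ, haarEntropyChange ρ ∂(circuitLaw ρ₀ t)
  set s := entropyDensity ρ₀ t
  rw [h5]
  constructor
  · linarith [div_nonpos_of_nonpos_of_nonneg h3 (by positivity : 0 ≤ n * Real.log 2)]
  · have h6 : 2 / (2 * n - 1) * (s ^ 2 - s / (2 * n)) ≤ -x / (n * Real.log 2) := by
      rw [le_div_iff₀ (by positivity), div_mul_eq_mul_div, div_mul_eq_mul_div,
        div_le_iff₀ (by linarith)]
      have h7 : (1 - 1 / (2 * n)) * -x * (2 * n) = -x * (2 * n - 1) := by field_simp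
      have h8 := mul_le_mul_of_nonneg_right h4 (by linarith : (0 : ℝ) ≤ 2 * n)
      rw [h7] at h8
      refine le_trans (le_of_eq ?_) h8
      ring
    rw [neg_div] at h6
    linarith

end Circuit

/-- A decreasing sequence that obeys the recursion of the entropy density falls below one half in a
time of order `n`, and below `1 / n` in a time of order `n ^ 2`. -/
theorem entropy_recursion {n : ℕ} (hn : 1 ≤ n) {s : ℕ → ℝ} (h0 : ∀ t, 0 ≤ s t)
    (h1 : ∀ t, s t ≤ 1) (hanti : ∀ t, s (t + 1) ≤ s t)
    (hrec : ∀ t, s (t + 1) ≤ s t - 2 / (2 * n - 1) * (s t ^ 2 - s t / (2 * n))) (t : ℕ) :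
    (4 * (n : ℝ) ≤ t → s t ≤ 1 / 2) ∧ (4 * (n : ℝ) ^ 2 ≤ t → s t ≤ 1 / n) := by
  have hn1 : (1 : ℝ) ≤ n := by exact_mod_cast hn
  have hn0 : (0 : ℝ) < n := by linarith
  have hrec' : ∀ t, s t / (2 * n) ≤ s t ^ 2 →
      s (t + 1) ≤ s t - 1 / n * (s t ^ 2 - s t / (2 * n)) := by
    intro t ht
    refine (hrec t).trans (sub_le_sub_left (mul_le_mul_of_nonneg_right ?_ (sub_nonneg.mpr ht)) _)
    rw [div_le_div_iff₀ hn0 (by linarith)]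
    linarith
  constructor
  · intro ht
    rcases hn.eq_or_lt with rfl | hn2
    · -- For a single mode one step suffices.
      obtain ⟨u, rfl⟩ : ∃ u, t = u + 1 := by
        refine Nat.exists_eq_succ_of_ne_zero ?_
        rintro rfl
        norm_num at ht
      have := hrec u
      norm_num at this
      nlinarith [sq_nonneg (2 * s u - 1)]
    · have hn2' : (2 : ℝ) ≤ n := by exact_mod_cast hn2
      -- As long as `s` exceeds one half, it decreases by at least `1 / (8 n)` in each step.
      have key : ∀ t : ℕ, s t ≤ 1 / 2 ∨ s t ≤ 1 - t / (8 * n) := by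
        intro t
        induction t with
        | zero => right; simpa using h1 0
        | succ t ih =>
          by_cases hs : s t ≤ 1 / 2
          · exact Or.inl ((hanti t).trans hs)
          right
          have ih := ih.resolve_left hs
          push Not at hs
          have h2 : s t / (2 * n) ≤ s t / 4 := by
            refine div_le_div_of_nonneg_left (h0 t) (by norm_num) (by linarith)
          have h3 : 1 / 8 ≤ s t ^ 2 - s t / (2 * n) := by nlinarith
          have h4 := hrec' t (by linarith)
          have h5 := mul_le_mul_of_nonneg_left h3 (by positivity : (0 : ℝ) ≤ 1 / n)
          have h6 : ((t + 1 : ℕ) : ℝ) / (8 * n) = t / (8 * n) + 1 / n * (1 / 8) := by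
            push_cast
            field_simp
          rw [h6]
          linarith
      rcases key t with h | h
      · exact h
      · refine h.trans ?_
        have : 1 / 2 ≤ (t : ℝ) / (8 * n) := by
          rw [le_div_iff₀ (by positivity)]
          linarith
        linarith
  · -- As long as `s` exceeds `1 / n`, its inverse grows by at least `1 / (2 n)` in each step.
    intro ht
    have key : ∀ t : ℕ, s t ≤ 1 / n ∨ s t ≤ 2 * n / (2 * n + t) := by
      intro t
      induction t with
      | zero =>
        right
        rw [Nat.cast_zero, add_zero, div_self (by positivity)]
        exact h1 0
      | succ t ih =>
        by_cases hs : s t ≤ 1 / n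
        · exact Or.inl ((hanti t).trans hs)
        right
        have ih := ih.resolve_left hs
        push Not at hs
        have ht0 : (0 : ℝ) ≤ t := Nat.cast_nonneg t
        have h2 : s t / (2 * n) ≤ s t ^ 2 / 2 := by
          have : s t / (2 * n) = s t * (1 / n) / 2 := by ring
          rw [this]
          nlinarith [h0 t]
        have h3 := hrec' t (by nlinarith [sq_nonneg (s t)])
        set u := 2 * (n : ℝ) / (2 * n + t) with hu
        have hu1 : u ≤ 1 := by rw [hu, div_le_one (by positivity)]; linarith
        have h4 : 1 / (n : ℝ) * (s t ^ 2 / 2) ≤ 1 / n * (s t ^ 2 - s t / (2 * n)) :=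
          mul_le_mul_of_nonneg_left (by linarith) (by positivity)
        -- The map `x ↦ x - x² / (2 n)` is increasing on `[0, n]`.
        have h5 : s t - 1 / n * (s t ^ 2 / 2) ≤ u - 1 / n * (u ^ 2 / 2) := by
          have : u - 1 / n * (u ^ 2 / 2) - (s t - 1 / n * (s t ^ 2 / 2)) =
              (u - s t) * (1 - (u + s t) / (2 * n)) := by
            field_simp
            ring
          have h6 : (u + s t) / (2 * n) ≤ 1 := by
            rw [div_le_one (by positivity)]
            linarith [h1 t]
          nlinarith [mul_nonneg (sub_nonneg.mpr ih) (sub_nonneg.mpr h6)]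
        have h7 : u - 1 / n * (u ^ 2 / 2) ≤ 2 * n / (2 * n + (t + 1 : ℕ)) := by
          have : u - 1 / n * (u ^ 2 / 2) = 2 * n * (2 * n + t - 1) / (2 * n + t) ^ 2 := by
            rw [hu]
            field_simp
          rw [this, div_le_div_iff₀ (by positivity) (by positivity)]
          push_cast
          nlinarith
        linarith
    rcases key t with h | h
    · exact h
    · refine h.trans ?_
      rw [div_le_div_iff₀ (by positivity) hn0]
      nlinarith

end FreeFermion

end

theorem mainTheorem3 :
    -- The exact change of the proxy entropy, averaged over the outcomes, and its sign.
    (∀ (n : ℕ) [NeZero n] (ρ : FreeFermion.FockOp n), FreeFermion.IsGaussian ρ →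
      let M := FreeFermion.corrMatrix ρ
      let Q := FreeFermion.firstTwoProj n
      let α : ℝ := M (FreeFermion.fst n) (FreeFermion.snd n)
      Mᵀ = -M ∧ (1 + M * M).PosSemidef ∧ α ^ 2 ≤ 1 ∧
      (α ^ 2 ≠ 1 → FreeFermion.entropyChange ρ =
        -(Real.log 2 * (FreeFermion.upperLeftBlock (Q * (1 + M * M) * Q)).det / (1 - α ^ 2))) ∧
      (α ^ 2 = 1 → FreeFermion.entropyChange ρ = 0) ∧
      FreeFermion.entropyChange ρ ≤ 0) ∧
    -- A rotation maps Gaussian states to Gaussian states and acts on `M` by conjugation.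
    (∀ (n : ℕ) [NeZero n] (ρ : FreeFermion.FockOp n) (O : FreeFermion.SO n),
      FreeFermion.IsGaussian ρ →
      FreeFermion.IsGaussian (FreeFermion.rotate O ρ) ∧
      FreeFermion.corrMatrix (FreeFermion.rotate O ρ) = O.1 * FreeFermion.corrMatrix ρ * O.1ᵀ) ∧
    -- The Haar average to leading order in `1 / n`, uniformly in the Gaussian state.
    (∃ (C : ℝ) (n₀ : ℕ), ∀ (n : ℕ) [NeZero n], n₀ ≤ n →
      ∀ ρ : FreeFermion.FockOp n, FreeFermion.IsGaussian ρ →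
      Integrable (fun O => FreeFermion.entropyChange (FreeFermion.rotate O ρ))
        (FreeFermion.haarSO n) ∧
      |(|FreeFermion.haarEntropyChange ρ|) - FreeFermion.leadingTerm ρ| ≤
        C / n * FreeFermion.leadingTerm ρ) ∧
    -- The lower bound, for every ensemble of Gaussian states, without error term.
    (∀ (n : ℕ) [NeZero n] (μ : Measure (FreeFermion.FockOp n)), IsProbabilityMeasure μ →
      (∀ᵐ ρ ∂μ, FreeFermion.IsGaussian ρ) →
      let s : ℝ := (∫ ρ, FreeFermion.proxyEntropy ρ ∂μ) / (n * Real.log 2)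
      Integrable (fun ρ : FreeFermion.FockOp n => FreeFermion.proxyEntropy ρ) μ ∧
      Integrable (fun ρ : FreeFermion.FockOp n => FreeFermion.leadingTerm ρ) μ ∧
      Integrable (fun ρ : FreeFermion.FockOp n => FreeFermion.haarEntropyChange ρ) μ ∧
      ∫ ρ, FreeFermion.leadingTerm ρ ∂μ ≤ |∫ ρ, FreeFermion.haarEntropyChange ρ ∂μ| ∧
      Real.log 2 * (s ^ 2 - s / (2 * n)) ≤ ∫ ρ, FreeFermion.leadingTerm ρ ∂μ) ∧
    -- The maximally mixed state is Gaussian, of maximal proxy entropy.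
    (∀ (n : ℕ) [NeZero n], FreeFermion.IsGaussian (FreeFermion.maximallyMixed n) ∧
      FreeFermion.proxyEntropy (FreeFermion.maximallyMixed n) = n * Real.log 2) ∧
    -- Purification: half of the proxy entropy is lost after a time of order `n`, and the purity
    -- is of order one after a time of order `n ^ 2`.
    (∃ K B c : ℝ, 0 < K ∧ 0 < c ∧ ∀ (n : ℕ) [NeZero n] (ρ₀ : FreeFermion.FockOp n),
      FreeFermion.IsGaussian ρ₀ → ∀ t : ℕ,
      IsProbabilityMeasure (FreeFermion.circuitLaw ρ₀ t) ∧
      (∀ᵐ ρ ∂(FreeFermion.circuitLaw ρ₀ t), FreeFermion.IsGaussian ρ) ∧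
      (K * n ≤ t → ∫ ρ, FreeFermion.proxyEntropy ρ ∂(FreeFermion.circuitLaw ρ₀ t) ≤
        n * Real.log 2 / 2) ∧
      (K * (n : ℝ) ^ 2 ≤ t →
        ∫ ρ, FreeFermion.proxyEntropy ρ ∂(FreeFermion.circuitLaw ρ₀ t) ≤ B ∧
        c ≤ ∫ ρ, FreeFermion.purity ρ ∂(FreeFermion.circuitLaw ρ₀ t))) := by
  refine ⟨fun n _ ρ h => ?_, fun n _ ρ O h => ⟨h.rotate O, h.corrMatrix_rotate O⟩,
    ⟨13, 3, fun n _ hn ρ h =>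
      ⟨h.integrable_entropyChange_rotate, h.abs_haarEntropyChange_sub_le hn⟩⟩,
    fun n _ μ _ hμ => ?_,
    fun n _ => ⟨FreeFermion.maximallyMixed_isGaussian, FreeFermion.proxyEntropy_maximallyMixed⟩,
    ⟨4, Real.log 2, Real.exp (-Real.log 2), by norm_num, Real.exp_pos _, fun n _ ρ₀ h t => ?_⟩⟩
  · refine ⟨h.transpose_corrMatrix, h.posSemidef_one_add, h.isCorr.sq_le_one _ _, fun _ => ?_,
      fun h1 => ?_, h.entropyChange_nonpos⟩
    · rw [h.entropyChange_eq, FreeFermion.det_upperLeftBlock h.isCorr, mul_div_assoc]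
    · rw [h.entropyChange_eq, h1, sub_self, div_zero, mul_zero, neg_zero]
  · exact ⟨FreeFermion.integrable_proxyEntropy hμ, FreeFermion.integrable_leadingTerm hμ,
      FreeFermion.integrable_haarEntropyChange hμ, FreeFermion.integral_leadingTerm_le_abs hμ,
      FreeFermion.le_integral_leadingTerm hμ⟩
  · obtain ⟨h1, h2⟩ := FreeFermion.circuitLaw_properties h t
    have hn : (1 : ℝ) ≤ n := FreeFermion.one_le_cast
    have hlog : 0 ≤ Real.log 2 := Real.log_nonneg one_le_two
    obtain ⟨h3, h4⟩ := FreeFermion.entropy_recursion (n := n) (by exact_mod_cast hn)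
      (fun t => (FreeFermion.entropyDensity_bounds h t).1)
      (fun t => (FreeFermion.entropyDensity_bounds h t).2)
      (fun t => (FreeFermion.entropyDensity_succ h t).1)
      (fun t => (FreeFermion.entropyDensity_succ h t).2) t
    refine ⟨h1, h2, fun ht => ?_, fun ht => ?_⟩
    · rw [FreeFermion.integral_proxyEntropy_eq]
      have := mul_le_mul_of_nonneg_right (h3 ht) (by positivity : 0 ≤ n * Real.log 2)
      linarith
    · have h5 : ∫ ρ, FreeFermion.proxyEntropy ρ ∂(FreeFermion.circuitLaw ρ₀ t) ≤ Real.log 2 := by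
        rw [FreeFermion.integral_proxyEntropy_eq]
        refine (mul_le_mul_of_nonneg_right (h4 ht) (by positivity)).trans (le_of_eq ?_)
        field_simp
      exact ⟨h5, FreeFermion.exp_neg_le_integral_purity h2 h5⟩
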